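/- **Setting.** Let $Z^\alpha=(X^\alpha,Y^\alpha)$ be a family of planar Filippov systems with switching line $y=0$ ($X^\alpha$ for $y>0$, $Y^\alpha$ for $y<0$), where $X^\alpha,Y^\alpha$ are sufficiently smooth (say $C^8$) jointly in $(\alpha,x,y)$ near the origin. Write $X=X^0$, $Y=Y^0$, $\tilde X=\partial_\alpha X^\alpha|_{\alpha=0}$, $\tilde Y=\partial_\alpha Y^\alpha|_{\alpha=0}$, $\det Z=X^1Y^2-X^2Y^1$; quantities without argument are taken at the origin. Assume that the origin is a fold-fold point ($X^2=Y^2=0$, $X^2_xX^1\ne0$, $Y^2_xY^1\neq 0$), that $X^1>0$, $X^1Y^1<0$, $(\det Z)_x<0$, and that $\frac{\tilde Y^2}{Y^2_x}-\frac{\tilde X^2}{X^2_x}>0$. The fold of $X$ is visible if $X^2_xX^1>0$ and invisible if $X^2_xX^1<0$; the fold of $Y$ is visible if $Y^2_xY^1<0$ and invisible if $Y^2_xY^1>0$. Let $\varphi$ be continuous with $\varphi=1$ on $[1,\infty)$, $\varphi=-1$ on $(-\infty,-1]$, sufficiently smooth (say $C^8$) on $(-1,1)$ with $\varphi'>0$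 there, and let $$Z^\alpha_\varepsilon(x,y)=\tfrac12\big[(X^\alpha+Y^\alpha)(x,y)+\varphi(y/\varepsilon)(X^\alpha-Y^\alpha)(x,y)\big],$$ $$F^i(x,v;\alpha,\varepsilon)=(X^{\alpha i}+Y^{\alpha i})(x,\varepsilon v)+\varphi(v)(X^{\alpha i}-Y^{\alpha i})(x,\varepsilon v),\quad i=1,2 .$$ Put $v^*=\varphi^{-1}\big(-\frac{X^1+Y^1}{X^1-Y^1}\big)\in(-1,1)$, $x^*=-\frac{(\det Z)_y}{(\det Z)_x}v^*$, and $\delta_{\mathcal H}=-\mathcal M/\mathcal N$ with $$\mathcal M=X^1_x+Y^1_x+\varphi(v^*)(X^1_x-Y^1_x)+X^2_y+Y^2_y+\varphi(v^*)(X^2_y-Y^2_y)+\varphi'(v^*)\big[(X^2_x-Y^2_x)x^*+(X^2_y-Y^2_y)v^*\big],$$ $$\mathcal N=\frac{\varphi'(v^*)(X^1-Y^1)(Y^2_x\tilde X^2-X^2_x\tilde Y^2)}{(\det Z)_x}.$$ **Melnikov function.** With $x=\sqrt\varepsilon\,u$, $y=\varepsilon v$, $\alpha=\delta\varepsilon$,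 the rescaled system at $\varepsilon=0$ has the first integral $\frac{u^2}2+V(v)$, $V(v)=-\int_{v^*}^v\frac{F^1(0,r;0,0)}{F^2_x(0,r;0,0)}dr$. For $v_0>v^*$ (close to $v^*$) let $\bar v_0<v^*$ be the nearest point with $V(\bar v_0)=V(v_0)$, and $$M(v_0,\delta)=\frac{-2}{V'(v_0)}\int_{\bar v_0}^{v_0}f(v,v_0,\delta)\sqrt{2(V(v_0)-V(v))}\,dv,$$ $$f(v,v_0,\delta)=\frac{F^1_x}{F^2_x}+\frac{\partial}{\partial v}\left\{\frac1{F^2_x}\Big(F^2_{xx}\,(V(v_0)-V(v))+F^2_\varepsilon+\delta F^2_\alpha\Big)\right\},$$ where the derivatives of $F^1,F^2$ are taken at $(0,v;0,0)$; $M(v^*,\delta)$ is the limit as $v_0\to v^{*+}$. Derivatives of $M$ with respect to $v$ at $v^*$ are one-sided, on $[v^*,\infty)$. **Hopf curves.** A Hopf curve is a pair $\alpha(\varepsilon)\to0$, $p(\varepsilon)\to(0,0)$ as $\varepsilon\to0^+$ such that, for all small $\varepsilon>0$, the family $\alpha\mapsto Z^\alpha_\varepsilon$ has a Hopf bifurcation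 at $(\alpha(\varepsilon),p(\varepsilon))$: $p(\varepsilon)$ is an equilibrium at which the Jacobian has zero trace and positive determinant, and it continues to a $C^1$ branch of equilibria along which the derivative of the trace with respect to $\alpha$ is nonzero at $\alpha(\varepsilon)$. It is subcritical if the first Lyapunov coefficient satisfies $\ell_1>0$ and supercritical if $\ell_1<0$. **Proposition.** For every $\delta$ the function $M(\cdot,\delta)$ is $C^3$ on some interval $[v^*,v^*+\eta)$, $\eta>0$, and: 1. $M(v^*,\delta)=0$ for all $\delta$. 2. $\frac{\partial M}{\partial v}(v^*,\delta_{\mathcal H})=0$. 3. The mixed derivative exists, in both orders of differentiation, and $$\frac{\partial^2M}{\partial v\,\partial\delta}(v^*,\delta_{\mathcal H})=\frac{\pi\,\varphi'(v^*)\,(X^1-Y^1)^2}{2\,((\det Z)_x)^2\sqrt{V''(v^*)}}\,\big(X^2_x\tilde Y^2-Y^2_x\tilde X^2\big);$$ it is positive if both folds are invisible and negative if the folds have opposite visibility. 4. $\frac{\partial^2M}{\partial v^2}(v^*,\delta_{\mathcal H})=0$ always. 5. A Hopf curve exists, and every Hopf curve satisfies $\alpha(\varepsilon)=\delta_{\mathcal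 H}\varepsilon+O(\varepsilon^2)$. If the first nonzero one of $\frac{\partial^2M}{\partial v^2}(v^*,\delta_{\mathcal H})$, $\frac{\partial^3M}{\partial v^3}(v^*,\delta_{\mathcal H})$ (by item 4, the third derivative, when it is nonzero) is positive, then the Hopf bifurcation is subcritical ($\ell_1>0$) for all sufficiently small $\varepsilon>0$; if it is negative, the Hopf bifurcation is supercritical ($\ell_1<0$) for all sufficiently small $\varepsilon>0$. -/

import Mathlib

open Set Filter Topology

noncomputable section

namespace FoldFold

/-! ### Planar vector fields, Hopf bifurcation and the first Lyapunov coefficient -/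

/-- Partial derivative with respect to the first variable. -/
def dx (f : ℝ → ℝ → ℝ) : ℝ → ℝ → ℝ := fun x y => deriv (fun s => f s y) x

/-- Partial derivative with respect to the second variable. -/
def dy (f : ℝ → ℝ → ℝ) : ℝ → ℝ → ℝ := fun x y => deriv (fun s => f x s) y

/-- Trace of the Jacobian matrix of the planar vector field `(P, Q)` at `p`. -/
def traceJ (P Q : ℝ → ℝ → ℝ) (p : ℝ × ℝ) : ℝ := dx P p.1 p.2 + dy Q p.1 p.2

/-- Determinant of the Jacobian matrix of the planar vector field `(P, Q)` at `p`. -/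
def detJ (P Q : ℝ → ℝ → ℝ) (p : ℝ × ℝ) : ℝ :=
  dx P p.1 p.2 * dy Q p.1 p.2 - dy P p.1 p.2 * dx Q p.1 p.2

/-- The first Lyapunov coefficient (Guckenheimer and Holmes) at the origin of a system
`ξ' = f ξ η`, `η' = g ξ η` whose linear part is `ξ' = -ω η`, `η' = ω ξ`. The linear part does not
contribute to the derivatives of order two and three that occur here. -/
def lyapunovNormalized (ω : ℝ) (f g : ℝ → ℝ → ℝ) : ℝ :=
  1 / 16 * (dx (dx (dx f)) 0 0 + dx (dy (dy f)) 0 0 + dx (dx (dy g)) 0 0 + dy (dy (dy g)) 0 0)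
  + 1 / (16 * ω) *
    (dx (dy f) 0 0 * (dx (dx f) 0 0 + dy (dy f) 0 0)
      - dx (dy g) 0 0 * (dx (dx g) 0 0 + dy (dy g) 0 0)
      - dx (dx f) 0 0 * dx (dx g) 0 0 + dy (dy f) 0 0 * dy (dy g) 0 0)

/-- The first Lyapunov coefficient of the planar vector field `(P, Q)` at an equilibrium `p` whose
Jacobian matrix `A` has trace `0` and determinant `ω² > 0`. With `a = P_x`, `c = Q_x` at `p` (one
has `c ≠ 0`), the linear coordinates `(ξ, η)` given by `(x, y) = p + ξ e₁ + η (A e₁) / ω`, that is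
`x = p₁ + ξ + a η / ω` and `y = p₂ + c η / ω`, bring the linear part to `ξ' = -ω η`, `η' = ω ξ`. -/
def lyapunovCoeff (P Q : ℝ → ℝ → ℝ) (p : ℝ × ℝ) : ℝ :=
  let a := dx P p.1 p.2
  let c := dx Q p.1 p.2
  let ω := √(detJ P Q p)
  lyapunovNormalized ω
    (fun ξ η => P (p.1 + ξ + a * η / ω) (p.2 + c * η / ω)
      - a / c * Q (p.1 + ξ + a * η / ω) (p.2 + c * η / ω))
    (fun ξ η => ω / c * Q (p.1 + ξ + a * η / ω) (p.2 + c * η / ω))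

/-- The one-parameter family `α ↦ (P α, Q α)` of planar vector fields undergoes a Hopf bifurcation
at the parameter `α₀` and the point `p`: the point `p` is an equilibrium with purely imaginary
nonzero eigenvalues, it continues to a `C¹` branch `q` of equilibria, and the real part (half of
the trace) of the eigenvalues crosses zero with nonzero speed along the branch. -/
structure IsHopf (P Q : ℝ → ℝ → ℝ → ℝ) (α₀ : ℝ) (p : ℝ × ℝ) : Prop where
  trace_zero : traceJ (P α₀) (Q α₀) p = 0
  det_pos : 0 < detJ (P α₀) (Q α₀) p
  crossing : ∃ q : ℝ → ℝ × ℝ, ContDiffAt ℝ 1 q α₀ ∧ q α₀ = p ∧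
    (∀ᶠ α in 𝓝 α₀, P α (q α).1 (q α).2 = 0 ∧ Q α (q α).1 (q α).2 = 0) ∧
    ∃ τ : ℝ, τ ≠ 0 ∧ HasDerivAt (fun α => traceJ (P α) (Q α) (q α)) τ α₀

/-- A subcritical Hopf bifurcation: the first Lyapunov coefficient is positive. -/
def IsSubcriticalHopf (P Q : ℝ → ℝ → ℝ → ℝ) (α₀ : ℝ) (p : ℝ × ℝ) : Prop :=
  IsHopf P Q α₀ p ∧ 0 < lyapunovCoeff (P α₀) (Q α₀) p

/-- A supercritical Hopf bifurcation: the first Lyapunov coefficient is negative. -/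
def IsSupercriticalHopf (P Q : ℝ → ℝ → ℝ → ℝ) (α₀ : ℝ) (p : ℝ × ℝ) : Prop :=
  IsHopf P Q α₀ p ∧ lyapunovCoeff (P α₀) (Q α₀) p < 0

/-! ### Unfoldings of planar Filippov systems and their regularization -/

/-- A one-parameter family `Z^α = (X^α, Y^α)` of planar Filippov systems with switching line
`y = 0`: the vector field is `X^α = (X1 α, X2 α)` for `y > 0` and `Y^α = (Y1 α, Y2 α)` for
`y < 0`. The arguments of the components are `α`, `x`, `y`. -/
structure Unfolding where
  X1 : ℝ → ℝ → ℝ → ℝ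
  X2 : ℝ → ℝ → ℝ → ℝ
  Y1 : ℝ → ℝ → ℝ → ℝ
  Y2 : ℝ → ℝ → ℝ → ℝ

/-- A transition function: `φ = 1` on `[1, ∞)`, `φ = -1` on `(-∞, -1]`, and `φ` is sufficiently
smooth with positive derivative on `(-1, 1)`. -/
structure IsTransition (φ : ℝ → ℝ) : Prop where
  continuous : Continuous φ
  eq_one : ∀ v, 1 ≤ v → φ v = 1
  eq_neg_one : ∀ v, v ≤ -1 → φ v = -1
  smooth : ContDiffOn ℝ 8 φ (Ioo (-1) 1)
  deriv_pos : ∀ v ∈ Ioo (-1 : ℝ) 1, 0 < deriv φ v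

namespace Unfolding

variable (Z : Unfolding)

/-- The components are of class `C⁸` jointly in `(α, x, y)` in a neighbourhood of the origin. -/
def Smooth : Prop :=
  ContDiffAt ℝ 8 (fun q : ℝ × ℝ × ℝ => Z.X1 q.1 q.2.1 q.2.2) 0 ∧
  ContDiffAt ℝ 8 (fun q : ℝ × ℝ × ℝ => Z.X2 q.1 q.2.1 q.2.2) 0 ∧
  ContDiffAt ℝ 8 (fun q : ℝ × ℝ × ℝ => Z.Y1 q.1 q.2.1 q.2.2) 0 ∧
  ContDiffAt ℝ 8 (fun q : ℝ × ℝ × ℝ => Z.Y2 q.1 q.2.1 q.2.2) 0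

/-- `X²_x` at the origin, for `α = 0`. -/
def X2x : ℝ := dx (Z.X2 0) 0 0

/-- `Y²_x` at the origin, for `α = 0`. -/
def Y2x : ℝ := dx (Z.Y2 0) 0 0

/-- The second component of `∂X^α/∂α` at `α = 0`, at the origin. -/
def X2tilde : ℝ := deriv (fun α => Z.X2 α 0 0) 0

/-- The second component of `∂Y^α/∂α` at `α = 0`, at the origin. -/
def Y2tilde : ℝ := deriv (fun α => Z.Y2 α 0 0) 0

/-- For `α = 0` the origin is a fold point of both `X` and `Y`. -/
def IsFoldFold : Prop :=
  (Z.X2 0 0 0 = 0 ∧ Z.X2x * Z.X1 0 0 0 ≠ 0) ∧ (Z.Y2 0 0 0 = 0 ∧ Z.Y2x * Z.Y1 0 0 0 ≠ 0)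

/-- Both folds are invisible. -/
def InvisibleInvisible : Prop := Z.X2x * Z.X1 0 0 0 < 0 ∧ 0 < Z.Y2x * Z.Y1 0 0 0

/-- The folds have opposite visibility. -/
def VisibleInvisible : Prop :=
  (0 < Z.X2x * Z.X1 0 0 0 ∧ 0 < Z.Y2x * Z.Y1 0 0 0) ∨
  (Z.X2x * Z.X1 0 0 0 < 0 ∧ Z.Y2x * Z.Y1 0 0 0 < 0)

/-- `det Z = X¹ Y² - X² Y¹` for `α = 0`. -/
def det (x y : ℝ) : ℝ := Z.X1 0 x y * Z.Y2 0 x y - Z.X2 0 x y * Z.Y1 0 x y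

/-- `(det Z)_x` at the origin. -/
def detx : ℝ := dx Z.det 0 0

/-- `(det Z)_y` at the origin. -/
def dety : ℝ := dy Z.det 0 0

/-- The versality condition, with the orientation of the parameter for which the fold of `X^α`
is to the right of the fold of `Y^α` for `α > 0`. -/
def Versal : Prop := 0 < Z.Y2tilde / Z.Y2x - Z.X2tilde / Z.X2x

variable (φ : ℝ → ℝ)

/-- First component of the regularized vector field `Z^α_ε`. -/
def reg1 (ε α x y : ℝ) : ℝ :=
  1 / 2 * ((Z.X1 α x y + Z.Y1 α x y) + φ (y / ε) * (Z.X1 α x y - Z.Y1 α x y))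

/-- Second component of the regularized vector field `Z^α_ε`. -/
def reg2 (ε α x y : ℝ) : ℝ :=
  1 / 2 * ((Z.X2 α x y + Z.Y2 α x y) + φ (y / ε) * (Z.X2 α x y - Z.Y2 α x y))

/-- The right-hand side `F¹(x, v; α, ε)` of the slow-fast system
`x' = F¹(x, v; α, ε)`, `ε v' = F²(x, v; α, ε)`. -/
def F1 (x v α ε : ℝ) : ℝ :=
  (Z.X1 α x (ε * v) + Z.Y1 α x (ε * v)) + φ v * (Z.X1 α x (ε * v) - Z.Y1 α x (ε * v))

/-- The right-hand side `F²(x, v; α, ε)` of the slow-fast system. -/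
def F2 (x v α ε : ℝ) : ℝ :=
  (Z.X2 α x (ε * v) + Z.Y2 α x (ε * v)) + φ v * (Z.X2 α x (ε * v) - Z.Y2 α x (ε * v))

/-- `v* = φ⁻¹(-(X¹ + Y¹) / (X¹ - Y¹))` at the origin. -/
def vStar : ℝ :=
  Function.invFunOn φ (Ioo (-1) 1)
    (-(Z.X1 0 0 0 + Z.Y1 0 0 0) / (Z.X1 0 0 0 - Z.Y1 0 0 0))

/-- `x* = -((det Z)_y / (det Z)_x) v*`. -/
def xStar : ℝ := -(Z.dety / Z.detx) * Z.vStar φ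

/-- The constant `M(Z)`: the coefficient of `ε` in `ε` times the trace at the critical point. -/
def traceM : ℝ :=
  (dx (Z.X1 0) 0 0 + dx (Z.Y1 0) 0 0) + φ (Z.vStar φ) * (dx (Z.X1 0) 0 0 - dx (Z.Y1 0) 0 0)
  + (dy (Z.X2 0) 0 0 + dy (Z.Y2 0) 0 0) + φ (Z.vStar φ) * (dy (Z.X2 0) 0 0 - dy (Z.Y2 0) 0 0)
  + deriv φ (Z.vStar φ) *
    ((Z.X2x - Z.Y2x) * Z.xStar φ + (dy (Z.X2 0) 0 0 - dy (Z.Y2 0) 0 0) * Z.vStar φ)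

/-- The constant `N(Z, Z̃)`: the coefficient of `α` in `ε` times the trace. -/
def traceN : ℝ :=
  1 / Z.detx * deriv φ (Z.vStar φ) * (Z.X1 0 0 0 - Z.Y1 0 0 0)
    * (Z.Y2x * Z.X2tilde - Z.X2x * Z.Y2tilde)

/-- `δ_H = -M(Z) / N(Z, Z̃)`, the slope of the Hopf curve. -/
def deltaH : ℝ := -(Z.traceM φ) / Z.traceN φ

/-- `(α(ε), p(ε))`, `ε > 0` small, is a curve of Hopf bifurcations of `α ↦ Z^α_ε` that emanates
from the fold-fold point. -/
structure IsHopfCurve (α : ℝ → ℝ) (p : ℝ → ℝ × ℝ) : Prop where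
  tendsto_param : Tendsto α (𝓝[>] 0) (𝓝 0)
  tendsto_point : Tendsto p (𝓝[>] 0) (𝓝 0)
  isHopf : ∀ᶠ ε in 𝓝[>] 0, IsHopf (Z.reg1 φ ε) (Z.reg2 φ ε) (α ε) (p ε)

/-! ### The Melnikov function -/

/-- `F¹(0, v; 0, 0)`. -/
def f1 (v : ℝ) : ℝ := Z.F1 φ 0 v 0 0

/-- `F¹_x(0, v; 0, 0)`. -/
def f1x (v : ℝ) : ℝ := deriv (fun x => Z.F1 φ x v 0 0) 0

/-- `F²_x(0, v; 0, 0)`. -/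
def f2x (v : ℝ) : ℝ := deriv (fun x => Z.F2 φ x v 0 0) 0

/-- `F²_xx(0, v; 0, 0)`. -/
def f2xx (v : ℝ) : ℝ := iteratedDeriv 2 (fun x => Z.F2 φ x v 0 0) 0

/-- `F²_ε(0, v; 0, 0)`. -/
def f2eps (v : ℝ) : ℝ := deriv (fun ε => Z.F2 φ 0 v 0 ε) 0

/-- `∂F²/∂α(0, v; 0, 0)`. -/
def f2tilde (v : ℝ) : ℝ := deriv (fun α => Z.F2 φ 0 v α 0) 0

/-- The potential `V`; the function `H(u, v) = u² / 2 + V(v)` is a first integral of the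
unperturbed rescaled system `u' = F¹(0, v; 0, 0)`, `v' = F²_x(0, v; 0, 0) u`. -/
def V (v : ℝ) : ℝ := -∫ r in (Z.vStar φ)..v, Z.f1 φ r / Z.f2x φ r

/-- For `v₀ > v*` the point `(0, v̄₀)`, `v̄₀ < v*`, at which the unperturbed orbit through `(0, v₀)`
first returns to `u = 0`: the largest `w < v*` with `V(w) = V(v₀)`. -/
def vBar (v₀ : ℝ) : ℝ := sSup {w | w < Z.vStar φ ∧ Z.V φ w = Z.V φ v₀}

/-- The function `f(v, v₀, δ)` in the integrand of the Melnikov function. -/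
def fMel (v v₀ δ : ℝ) : ℝ :=
  Z.f1x φ v / Z.f2x φ v +
    deriv (fun w => 1 / Z.f2x φ w *
      (Z.f2xx φ w * (Z.V φ v₀ - Z.V φ w) + Z.f2eps φ w + δ * Z.f2tilde φ w)) v

/-- The formula for the Melnikov function at `v₀ > v*`. -/
def melnikovFormula (v₀ δ : ℝ) : ℝ :=
  -2 / deriv (Z.V φ) v₀ *
    ∫ v in (Z.vBar φ v₀)..v₀, Z.fMel φ v v₀ δ * √(2 * (Z.V φ v₀ - Z.V φ v))

/-- The Melnikov function `M(v₀, δ)`, `v₀ ≥ v*`; as `V'(v*) = 0`, its value at `v*` is the limit of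
the formula. -/
def melnikov (v₀ δ : ℝ) : ℝ :=
  if v₀ = Z.vStar φ then limUnder (𝓝[>] (Z.vStar φ)) (fun v => Z.melnikovFormula φ v δ)
  else Z.melnikovFormula φ v₀ δ

/-- `∂M/∂v(v*, δ)`, a right derivative, `M` being defined for `v ≥ v*`. -/
def dvM (δ : ℝ) : ℝ :=
  derivWithin (fun v => Z.melnikov φ v δ) (Ici (Z.vStar φ)) (Z.vStar φ)

/-- `∂ⁿM/∂vⁿ(v*, δ)`, a right derivative of order `n`. -/
def dvMn (n : ℕ) (δ : ℝ) : ℝ :=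
  iteratedDerivWithin n (fun v => Z.melnikov φ v δ) (Ici (Z.vStar φ)) (Z.vStar φ)

/-- The value of `∂²M/∂v∂δ(v*, δ_H)`. -/
def mixedValue : ℝ :=
  Real.pi * deriv φ (Z.vStar φ) * (Z.X1 0 0 0 - Z.Y1 0 0 0) ^ 2
    / (2 * Z.detx ^ 2 * √(iteratedDeriv 2 (Z.V φ) (Z.vStar φ)))
    * (Z.X2x * Z.Y2tilde - Z.Y2x * Z.X2tilde)

end Unfolding

end FoldFold

end

/-! Both the Melnikov function and the Lyapunov coefficient are governed by one number. Put E =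
`melE` + δ_H `melD`', R = `melR`, and at v* set L = E''/V'' - E' V'''/V''² + R'. Then ∂³M/∂v³(v*,
δ_H) is a negative multiple of L, while ε ℓ₁ tends to (F²_x(v*)/32) L along every Hopf curve, with
F²_x(v*) < 0. Hence ε ℓ₁ tends to a positive multiple of the third derivative, and the signs agree.

Melnikov side. The potential V has a nondegenerate minimum at v*, so V(ψ(s)) = s²/2 in a Morse
coordinate s = σ(v) (`exists_morse_coordinate`). The return point of ψ(s) is ψ(-s) (`sSup_morse`),
and v = ψ(s sin θ) turns the singular integral into s² K(s), where K is built from smooth averages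
over θ (`integral_morse`). Since V'(ψ) ψ' = s, this gives M = -2 ψ'(s) s K(s), a C⁴ function of v up
to and beyond v*. The values K(0) = (π/2) E_δ(v*) ψ'(0), with E_δ = `melE` + δ `melD`', and E_δ(v*)
= (traceM + δ traceN)/F²_x(v*) give the first derivative, its zero at δ_H and the mixed derivative.
Moreover K'(0) = 0 by oddness in θ; at δ_H also K(0) = 0, so M = O(s³), the second derivative
vanishes, and the third is a multiple of K''(0), hence of L (`melnikovData`).

Hopf side. With y = ε v, the equilibrium equations and 2ε times the trace are regular at ε = 0. The
implicit function theorem gives the equilibria (`exists_equilibria`) and then the parameter η(ε) of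
zero trace, with η'(0) = -traceM/traceN (`exists_trace_zero`). Any Hopf curve has y/ε → v*
(`tendsto_fast`), so it falls under the uniqueness part (`exists_hopfCurve`). Zero trace forces X² -
Y² = O(ε) at the equilibrium, which is exactly what makes ε ℓ₁ converge
(`tendsto_mul_lyapunovCoeff`). The limit is identified with L by algebra (`deriv_integrand`,
`lyapunovLimit_eq`). -/

noncomputable section
namespace FoldFold

/-! ### Germs of functions of two variables and their partial derivatives -/

/-- The functions `H` and `K` agree near `p`. -/
def GermEq (H K : ℝ → ℝ → ℝ) (p : ℝ × ℝ) : Prop := ∀ᶠ q in 𝓝 p, H q.1 q.2 = K q.1 q.2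

/-- The function `H` is of class `Cⁿ` at `p`. -/
def SmoothAt (n : ℕ) (H : ℝ → ℝ → ℝ) (p : ℝ × ℝ) : Prop :=
  ContDiffAt ℝ n (fun q : ℝ × ℝ => H q.1 q.2) p

theorem SmoothAt.of_le {m n : ℕ} {H : ℝ → ℝ → ℝ} {p : ℝ × ℝ} (h : SmoothAt n H p) (hmn : m ≤ n) :
    SmoothAt m H p :=
  ContDiffAt.of_le h (by exact_mod_cast hmn)

theorem SmoothAt.eventually {n : ℕ} {H : ℝ → ℝ → ℝ} {p : ℝ × ℝ} (h : SmoothAt n H p) :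
    ∀ᶠ q in 𝓝 p, SmoothAt n H q :=
  ContDiffAt.eventually h (by simp)

theorem SmoothAt.differentiableAt {n : ℕ} {H : ℝ → ℝ → ℝ} {p : ℝ × ℝ} (h : SmoothAt (n + 1) H p) :
    DifferentiableAt ℝ (fun q : ℝ × ℝ => H q.1 q.2) p :=
  ContDiffAt.differentiableAt h (by simp)

theorem hasDerivAt_comp_curve {H : ℝ → ℝ → ℝ} {c : ℝ → ℝ × ℝ} {c' : ℝ × ℝ} {t : ℝ}
    (h : DifferentiableAt ℝ (fun q : ℝ × ℝ => H q.1 q.2) (c t)) (hc : HasDerivAt c c' t) :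
    HasDerivAt (fun s => H (c s).1 (c s).2)
      (fderiv ℝ (fun q : ℝ × ℝ => H q.1 q.2) (c t) c') t :=
  h.hasFDerivAt.comp_hasDerivAt t hc

theorem dx_eq_fderiv {H : ℝ → ℝ → ℝ} {p : ℝ × ℝ}
    (h : DifferentiableAt ℝ (fun q : ℝ × ℝ => H q.1 q.2) p) :
    HasDerivAt (fun s => H s p.2) (dx H p.1 p.2) p.1 ∧
    dx H p.1 p.2 = fderiv ℝ (fun q : ℝ × ℝ => H q.1 q.2) p (1, 0) := by
  have hc : HasDerivAt (fun s : ℝ => (s, p.2)) (1, 0) p.1 :=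
    (hasDerivAt_id p.1).prodMk (hasDerivAt_const p.1 p.2)
  have := hasDerivAt_comp_curve (c := fun s : ℝ => (s, p.2)) (t := p.1) (H := H) h hc
  have e : dx H p.1 p.2 = fderiv ℝ (fun q : ℝ × ℝ => H q.1 q.2) p (1, 0) := this.deriv
  exact ⟨e ▸ this, e⟩

theorem dy_eq_fderiv {H : ℝ → ℝ → ℝ} {p : ℝ × ℝ}
    (h : DifferentiableAt ℝ (fun q : ℝ × ℝ => H q.1 q.2) p) :
    HasDerivAt (fun s => H p.1 s) (dy H p.1 p.2) p.2 ∧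
    dy H p.1 p.2 = fderiv ℝ (fun q : ℝ × ℝ => H q.1 q.2) p (0, 1) := by
  have hc : HasDerivAt (fun s : ℝ => (p.1, s)) (0, 1) p.2 :=
    (hasDerivAt_const p.2 p.1).prodMk (hasDerivAt_id p.2)
  have := hasDerivAt_comp_curve (c := fun s : ℝ => (p.1, s)) (t := p.2) (H := H) h hc
  have e : dy H p.1 p.2 = fderiv ℝ (fun q : ℝ × ℝ => H q.1 q.2) p (0, 1) := this.deriv
  exact ⟨e ▸ this, e⟩

theorem hasDerivAt_curve {H : ℝ → ℝ → ℝ} {u v : ℝ → ℝ} {u' v' t : ℝ}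
    (h : SmoothAt 1 H (u t, v t)) (hu : HasDerivAt u u' t) (hv : HasDerivAt v v' t) :
    HasDerivAt (fun s => H (u s) (v s))
      (dx H (u t) (v t) * u' + dy H (u t) (v t) * v') t := by
  have hd := SmoothAt.differentiableAt (n := 0) h
  have := hasDerivAt_comp_curve (c := fun s => (u s, v s)) hd (hu.prodMk hv)
  convert this using 1
  have e1 := (dx_eq_fderiv hd).2
  have e2 := (dy_eq_fderiv hd).2
  simp only at e1 e2
  rw [e1, e2, show ((u', v') : ℝ × ℝ) = u' • (1, 0) + v' • (0, 1) by simp]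
  rw [map_add, map_smul, map_smul]
  simp [mul_comm]

theorem SmoothAt.dx {n : ℕ} {H : ℝ → ℝ → ℝ} {p : ℝ × ℝ} (h : SmoothAt (n + 1) H p) :
    SmoothAt n (dx H) p := by
  have h1 : ContDiffAt ℝ n (fun q => fderiv ℝ (fun q : ℝ × ℝ => H q.1 q.2) q (1, 0)) p :=
    (ContDiffAt.fderiv_right h (by norm_cast)).clm_apply contDiffAt_const
  refine h1.congr_of_eventuallyEq ?_
  filter_upwards [h.eventually] with q hq
  exact (dx_eq_fderiv hq.differentiableAt).2

theorem SmoothAt.dy {n : ℕ} {H : ℝ → ℝ → ℝ} {p : ℝ × ℝ} (h : SmoothAt (n + 1) H p) :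
    SmoothAt n (dy H) p := by
  have h1 : ContDiffAt ℝ n (fun q => fderiv ℝ (fun q : ℝ × ℝ => H q.1 q.2) q (0, 1)) p :=
    (ContDiffAt.fderiv_right h (by norm_cast)).clm_apply contDiffAt_const
  refine h1.congr_of_eventuallyEq ?_
  filter_upwards [h.eventually] with q hq
  exact (dy_eq_fderiv hq.differentiableAt).2

theorem GermEq.eq {H K : ℝ → ℝ → ℝ} {p : ℝ × ℝ} (h : GermEq H K p) : H p.1 p.2 = K p.1 p.2 :=
  Eventually.self_of_nhds (p := fun q : ℝ × ℝ => H q.1 q.2 = K q.1 q.2) h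

theorem GermEq.trans {H K L : ℝ → ℝ → ℝ} {p : ℝ × ℝ} (h : GermEq H K p) (h' : GermEq K L p) :
    GermEq H L p := by
  filter_upwards [h, h'] with q h1 h2 using h1.trans h2

theorem GermEq.dx {H K : ℝ → ℝ → ℝ} {p : ℝ × ℝ} (h : GermEq H K p) : GermEq (dx H) (dx K) p := by
  filter_upwards [eventually_eventually_nhds.2 h] with q hq
  have hc : Tendsto (fun s : ℝ => (s, q.2)) (𝓝 q.1) (𝓝 q) := by
    have : Continuous (fun s : ℝ => (s, q.2)) := by fun_prop
    exact this.tendsto q.1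
  exact Filter.EventuallyEq.deriv_eq (hc.eventually hq)

theorem GermEq.dy {H K : ℝ → ℝ → ℝ} {p : ℝ × ℝ} (h : GermEq H K p) : GermEq (dy H) (dy K) p := by
  filter_upwards [eventually_eventually_nhds.2 h] with q hq
  have hc : Tendsto (fun s : ℝ => (q.1, s)) (𝓝 q.2) (𝓝 q) := by
    have : Continuous (fun s : ℝ => (q.1, s)) := by fun_prop
    exact this.tendsto q.2
  exact Filter.EventuallyEq.deriv_eq (hc.eventually hq)

/-- Symmetry of the second derivative, kept as an equality of germs so that it can be differentiated
once more for the third-order partials. -/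
theorem dy_dx_germEq {H : ℝ → ℝ → ℝ} {p : ℝ × ℝ} (h : SmoothAt 2 H p) :
    GermEq (dy (dx H)) (dx (dy H)) p := by
  filter_upwards [h.eventually] with q hq
  set G : ℝ × ℝ → ℝ := fun q => H q.1 q.2 with hG
  have hG2 : ContDiffAt ℝ 2 G q := hq
  have hs := hG2.isSymmSndFDerivAt (by simp)
  have hd : DifferentiableAt ℝ (fderiv ℝ G) q :=
    (hG2.fderiv_right (m := 1) (by norm_num)).differentiableAt (by norm_num)
  have ex : GermEq (dx H) (fun x y => fderiv ℝ G (x, y) (1, 0)) q := by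
    filter_upwards [hq.eventually] with z hz
    exact (dx_eq_fderiv hz.differentiableAt).2
  have ey : GermEq (dy H) (fun x y => fderiv ℝ G (x, y) (0, 1)) q := by
    filter_upwards [hq.eventually] with z hz
    exact (dy_eq_fderiv hz.differentiableAt).2
  rw [ex.dy.eq, ey.dx.eq]
  have a1 : DifferentiableAt ℝ (fun z : ℝ × ℝ => fderiv ℝ G (z.1, z.2) (1, 0)) q :=
    hd.clm_apply (differentiableAt_const _)
  have a2 : DifferentiableAt ℝ (fun z : ℝ × ℝ => fderiv ℝ G (z.1, z.2) (0, 1)) q :=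
    hd.clm_apply (differentiableAt_const _)
  rw [(dy_eq_fderiv a1).2, (dx_eq_fderiv a2).2]
  simp only [Prod.mk.eta]
  rw [fderiv_clm_apply hd (differentiableAt_const _),
    fderiv_clm_apply hd (differentiableAt_const _)]
  simpa using hs.eq (0, 1) (1, 0)

/-! ### Linear combinations -/

theorem SmoothAt.lin {n : ℕ} {H K : ℝ → ℝ → ℝ} {p : ℝ × ℝ} (hH : SmoothAt n H p)
    (hK : SmoothAt n K p) (k l : ℝ) : SmoothAt n (fun x y => k * H x y + l * K x y) p :=
  (contDiffAt_const.mul hH).add (contDiffAt_const.mul hK)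

theorem dx_lin {H K : ℝ → ℝ → ℝ} {p : ℝ × ℝ} (hH : SmoothAt 1 H p) (hK : SmoothAt 1 K p)
    (k l : ℝ) :
    GermEq (dx fun x y => k * H x y + l * K x y) (fun x y => k * dx H x y + l * dx K x y) p := by
  filter_upwards [hH.eventually, hK.eventually] with q h1 h2
  exact (((dx_eq_fderiv (SmoothAt.differentiableAt (n := 0) h1)).1.const_mul k).add
    ((dx_eq_fderiv (SmoothAt.differentiableAt (n := 0) h2)).1.const_mul l)).deriv

theorem dy_lin {H K : ℝ → ℝ → ℝ} {p : ℝ × ℝ} (hH : SmoothAt 1 H p) (hK : SmoothAt 1 K p)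
    (k l : ℝ) :
    GermEq (dy fun x y => k * H x y + l * K x y) (fun x y => k * dy H x y + l * dy K x y) p := by
  filter_upwards [hH.eventually, hK.eventually] with q h1 h2
  exact (((dy_eq_fderiv (SmoothAt.differentiableAt (n := 0) h1)).1.const_mul k).add
    ((dy_eq_fderiv (SmoothAt.differentiableAt (n := 0) h2)).1.const_mul l)).deriv

/-- The derivatives of order at most three of `H` at `p` that enter the first Lyapunov
coefficient. -/
structure Jet (H : ℝ → ℝ → ℝ) (p : ℝ × ℝ) (x y xx xy yy xxx xxy xyy yyy : ℝ) : Prop where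
  x : dx H p.1 p.2 = x
  y : dy H p.1 p.2 = y
  xx : dx (dx H) p.1 p.2 = xx
  xy : dx (dy H) p.1 p.2 = xy
  yy : dy (dy H) p.1 p.2 = yy
  xxx : dx (dx (dx H)) p.1 p.2 = xxx
  xxy : dx (dx (dy H)) p.1 p.2 = xxy
  xyy : dx (dy (dy H)) p.1 p.2 = xyy
  yyy : dy (dy (dy H)) p.1 p.2 = yyy

theorem Jet.self (H : ℝ → ℝ → ℝ) (p : ℝ × ℝ) :
    Jet H p (dx H p.1 p.2) (dy H p.1 p.2) (dx (dx H) p.1 p.2) (dx (dy H) p.1 p.2)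
      (dy (dy H) p.1 p.2) (dx (dx (dx H)) p.1 p.2) (dx (dx (dy H)) p.1 p.2)
      (dx (dy (dy H)) p.1 p.2) (dy (dy (dy H)) p.1 p.2) :=
  ⟨rfl, rfl, rfl, rfl, rfl, rfl, rfl, rfl, rfl⟩

theorem Jet.lin {H K : ℝ → ℝ → ℝ} {p : ℝ × ℝ} {x y xx xy yy xxx xxy xyy yyy : ℝ}
    {x' y' xx' xy' yy' xxx' xxy' xyy' yyy' : ℝ}
    (jH : Jet H p x y xx xy yy xxx xxy xyy yyy)
    (jK : Jet K p x' y' xx' xy' yy' xxx' xxy' xyy' yyy')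
    (hH : SmoothAt 3 H p) (hK : SmoothAt 3 K p) (k l : ℝ) :
    Jet (fun x y => k * H x y + l * K x y) p (k * x + l * x') (k * y + l * y') (k * xx + l * xx')
      (k * xy + l * xy') (k * yy + l * yy') (k * xxx + l * xxx') (k * xxy + l * xxy')
      (k * xyy + l * xyy') (k * yyy + l * yyy') := by
  have ex := dx_lin (hH.of_le (m := 1) (by norm_num)) (hK.of_le (m := 1) (by norm_num)) k l
  have ey := dy_lin (hH.of_le (m := 1) (by norm_num)) (hK.of_le (m := 1) (by norm_num)) k l
  have exx := ex.dx.trans (dx_lin (hH.dx.of_le (by norm_num)) (hK.dx.of_le (by norm_num)) k l)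
  have exy := ey.dx.trans (dx_lin (hH.dy.of_le (by norm_num)) (hK.dy.of_le (by norm_num)) k l)
  have eyy := ey.dy.trans (dy_lin (hH.dy.of_le (by norm_num)) (hK.dy.of_le (by norm_num)) k l)
  have exxx := exx.dx.trans (dx_lin hH.dx.dx hK.dx.dx k l)
  have exxy := exy.dx.trans (dx_lin hH.dy.dx hK.dy.dx k l)
  have exyy := eyy.dx.trans (dx_lin hH.dy.dy hK.dy.dy k l)
  have eyyy := eyy.dy.trans (dy_lin hH.dy.dy hK.dy.dy k l)
  rcases jH with ⟨rfl, rfl, rfl, rfl, rfl, rfl, rfl, rfl, rfl⟩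
  rcases jK with ⟨rfl, rfl, rfl, rfl, rfl, rfl, rfl, rfl, rfl⟩
  exact ⟨ex.eq, ey.eq, exx.eq, exy.eq, eyy.eq, exxx.eq, exxy.eq, exyy.eq, eyyy.eq⟩

/-! ### Affine changes of coordinates -/

/-- The map `(ξ, η) ↦ (p₁ + ξ + κ η, p₂ + μ η)`, composed with `H`. -/
def shear (p : ℝ × ℝ) (κ μ : ℝ) (H : ℝ → ℝ → ℝ) : ℝ → ℝ → ℝ :=
  fun ξ η => H (p.1 + ξ + κ * η) (p.2 + μ * η)

theorem tendsto_shear (p : ℝ × ℝ) (κ μ : ℝ) :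
    Tendsto (fun q : ℝ × ℝ => (p.1 + q.1 + κ * q.2, p.2 + μ * q.2)) (𝓝 0) (𝓝 p) := by
  have : Continuous (fun q : ℝ × ℝ => (p.1 + q.1 + κ * q.2, p.2 + μ * q.2)) := by fun_prop
  simpa using this.tendsto 0

theorem SmoothAt.shear {n : ℕ} {H : ℝ → ℝ → ℝ} {p : ℝ × ℝ} (h : SmoothAt n H p) (κ μ : ℝ) :
    SmoothAt n (shear p κ μ H) 0 := by
  have h1 : ContDiffAt ℝ n (fun q : ℝ × ℝ => (p.1 + q.1 + κ * q.2, p.2 + μ * q.2)) 0 := by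
    fun_prop
  have h2 : ContDiffAt ℝ n (fun q : ℝ × ℝ => H q.1 q.2)
      ((fun q : ℝ × ℝ => (p.1 + q.1 + κ * q.2, p.2 + μ * q.2)) 0) := by
    simpa using! h
  exact h2.comp (0 : ℝ × ℝ) h1

/-- The first variable is only translated, so no smoothness is needed here; only the second variable
requires the chain rule. -/
theorem dx_shear (p : ℝ × ℝ) (κ μ : ℝ) (H : ℝ → ℝ → ℝ) :
    dx (shear p κ μ H) = shear p κ μ (dx H) := by
  funext ξ η
  unfold dx shear
  have := deriv_comp_add_const (fun s => H s (p.2 + μ * η)) (p.1 + κ * η) ξ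
  simp only [show ∀ s, p.1 + s + κ * η = s + (p.1 + κ * η) by intro s; ring]
  exact this

theorem dy_shear {p : ℝ × ℝ} (κ μ : ℝ) {H : ℝ → ℝ → ℝ} (h : SmoothAt 1 H p) :
    GermEq (dy (shear p κ μ H))
      (fun ξ η => κ * shear p κ μ (dx H) ξ η + μ * shear p κ μ (dy H) ξ η) 0 := by
  filter_upwards [(tendsto_shear p κ μ).eventually h.eventually] with q hq
  have hu : HasDerivAt (fun s => p.1 + q.1 + κ * s) κ q.2 := by
    simpa using ((hasDerivAt_id q.2).const_mul κ).const_add (p.1 + q.1)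
  have hv : HasDerivAt (fun s => p.2 + μ * s) μ q.2 := by
    simpa using ((hasDerivAt_id q.2).const_mul μ).const_add p.2
  have := (hasDerivAt_curve (u := fun s => p.1 + q.1 + κ * s) (v := fun s => p.2 + μ * s)
    (t := q.2) hq hu hv).deriv
  refine Eq.trans this ?_
  simp only [shear]
  ring

/-- Differentiation in η acts as κ ∂x + μ ∂y, so the entries are binomial expansions of its powers.
Commuting partials bring the mixed terms to the order recorded in `Jet`. -/
theorem Jet.shear {H : ℝ → ℝ → ℝ} {p : ℝ × ℝ} {x y xx xy yy xxx xxy xyy yyy : ℝ}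
    (j : Jet H p x y xx xy yy xxx xxy xyy yyy) (h : SmoothAt 3 H p) (κ μ : ℝ) :
    Jet (shear p κ μ H) 0 x (κ * x + μ * y) xx (κ * xx + μ * xy)
      (κ ^ 2 * xx + 2 * κ * μ * xy + μ ^ 2 * yy) xxx (κ * xxx + μ * xxy)
      (κ ^ 2 * xxx + 2 * κ * μ * xxy + μ ^ 2 * xyy)
      (κ ^ 3 * xxx + 3 * κ ^ 2 * μ * xxy + 3 * κ * μ ^ 2 * xyy + μ ^ 3 * yyy) := by
  have val : ∀ K : ℝ → ℝ → ℝ, FoldFold.shear p κ μ K 0 0 = K p.1 p.2 := by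
    intro K; simp [FoldFold.shear]
  have cxy := dy_dx_germEq (h.of_le (m := 2) (by norm_num))
  have cxy_x := cxy.dx.eq
  have cxy_y := cxy.dy.eq
  have cxxy := (dy_dx_germEq (h.dx.of_le (m := 2) (by norm_num))).eq
  have cxyy := (dy_dx_germEq (h.dy.of_le (m := 2) (by norm_num))).eq
  have cxy0 := cxy.eq
  have h1 := h.of_le (m := 1) (by norm_num)
  have ey := dy_shear κ μ h1
  have hx := h.dx
  have hy := h.dy
  have eyy : GermEq (dy (dy (FoldFold.shear p κ μ H))) (fun ξ η =>
      κ * (κ * FoldFold.shear p κ μ (dx (dx H)) ξ η + μ * FoldFold.shear p κ μ (dy (dx H)) ξ η)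
      + μ * (κ * FoldFold.shear p κ μ (dx (dy H)) ξ η
        + μ * FoldFold.shear p κ μ (dy (dy H)) ξ η)) 0 := by
    refine ey.dy.trans ((dy_lin ((hx.shear κ μ).of_le (by norm_num))
      ((hy.shear κ μ).of_le (by norm_num)) κ μ).trans ?_)
    filter_upwards [dy_shear κ μ (hx.of_le (m := 1) (by norm_num)),
      dy_shear κ μ (hy.of_le (m := 1) (by norm_num))] with q h1 h2
    rw [h1, h2]
  have sxx := (hx.dx.shear κ μ)
  have syx := (hx.dy.shear κ μ)
  have sxy := (hy.dx.shear κ μ)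
  have syy := (hy.dy.shear κ μ)
  have exy := ey.dx.trans (dx_lin ((hx.shear κ μ).of_le (by norm_num))
      ((hy.shear κ μ).of_le (by norm_num)) κ μ)
  have exxy := exy.dx.trans (by
    rw [dx_shear, dx_shear]
    exact dx_lin sxx sxy κ μ)
  have exyy : GermEq (dx (dy (dy (FoldFold.shear p κ μ H)))) (fun ξ η =>
      κ * (κ * FoldFold.shear p κ μ (dx (dx (dx H))) ξ η
        + μ * FoldFold.shear p κ μ (dx (dy (dx H))) ξ η)
      + μ * (κ * FoldFold.shear p κ μ (dx (dx (dy H))) ξ η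
        + μ * FoldFold.shear p κ μ (dx (dy (dy H))) ξ η)) 0 := by
    refine eyy.dx.trans ((dx_lin (sxx.lin syx κ μ) (sxy.lin syy κ μ) κ μ).trans ?_)
    filter_upwards [dx_lin sxx syx κ μ, dx_lin sxy syy κ μ] with q h1 h2
    rw [h1, h2]
    simp only [dx_shear]
  have eyyy : GermEq (dy (dy (dy (FoldFold.shear p κ μ H)))) (fun ξ η =>
      κ * (κ * (κ * FoldFold.shear p κ μ (dx (dx (dx H))) ξ η
          + μ * FoldFold.shear p κ μ (dy (dx (dx H))) ξ η)
        + μ * (κ * FoldFold.shear p κ μ (dx (dy (dx H))) ξ η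
          + μ * FoldFold.shear p κ μ (dy (dy (dx H))) ξ η))
      + μ * (κ * (κ * FoldFold.shear p κ μ (dx (dx (dy H))) ξ η
          + μ * FoldFold.shear p κ μ (dy (dx (dy H))) ξ η)
        + μ * (κ * FoldFold.shear p κ μ (dx (dy (dy H))) ξ η
          + μ * FoldFold.shear p κ μ (dy (dy (dy H))) ξ η))) 0 := by
    refine eyy.dy.trans ((dy_lin (sxx.lin syx κ μ) (sxy.lin syy κ μ) κ μ).trans ?_)
    filter_upwards [dy_lin sxx syx κ μ, dy_lin sxy syy κ μ, dy_shear κ μ hx.dx, dy_shear κ μ hx.dy,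
      dy_shear κ μ hy.dx, dy_shear κ μ hy.dy] with q h1 h2 h3 h4 h5 h6
    rw [h1, h2, h3, h4, h5, h6]
  have cyyx : dy (dy (dx H)) p.1 p.2 = dx (dy (dy H)) p.1 p.2 := cxy_y.trans cxyy
  rcases j with ⟨rfl, rfl, rfl, rfl, rfl, rfl, rfl, rfl, rfl⟩
  refine ⟨?_, ?_, ?_, ?_, ?_, ?_, ?_, ?_, ?_⟩
  · rw [dx_shear]; exact val _
  · have := ey.eq
    simpa only [Prod.fst_zero, Prod.snd_zero, val] using this
  · rw [dx_shear, dx_shear]; exact val _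
  · have := exy.eq
    simpa only [Prod.fst_zero, Prod.snd_zero, val, dx_shear] using this
  · have := eyy.eq
    simp only [Prod.fst_zero, Prod.snd_zero, val] at this ⊢
    rw [this, cxy0]; ring
  · rw [dx_shear, dx_shear, dx_shear]; exact val _
  · have := exxy.eq
    simpa only [Prod.fst_zero, Prod.snd_zero, val, dx_shear] using this
  · have := exyy.eq
    simp only [Prod.fst_zero, Prod.snd_zero, val] at this ⊢
    rw [this, cxy_x]; ring
  · have := eyyy.eq
    simp only [Prod.fst_zero, Prod.snd_zero, val] at this ⊢
    rw [this, cxy_x, cyyx, cxyy, cxxy, cxy_x]; ring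

/-- The normalizing coordinates are the shear with κ = a/ω and μ = c/ω, and both normalized
components are linear combinations of P and Q. Only even powers of ω survive, so D appears without a
square root. -/
theorem lyapunovCoeff_eq {P Q : ℝ → ℝ → ℝ} {p : ℝ × ℝ}
    {a Py Pxx Pxy Pyy Pxxx Pxxy Pxyy Pyyy c Qy Qxx Qxy Qyy Qxxx Qxxy Qxyy Qyyy D : ℝ}
    (jP : Jet P p a Py Pxx Pxy Pyy Pxxx Pxxy Pxyy Pyyy)
    (jQ : Jet Q p c Qy Qxx Qxy Qyy Qxxx Qxxy Qxyy Qyyy)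
    (hP : SmoothAt 3 P p) (hQ : SmoothAt 3 Q p) (hc : c ≠ 0) (hD : 0 < D) (hDe : detJ P Q p = D) :
    lyapunovCoeff P Q p = 1 / 16 * (
      (Pxxx - a / c * Qxxx) + (a ^ 2 * (Pxxx - a / c * Qxxx) + 2 * a * c * (Pxxy - a / c * Qxxy)
        + c ^ 2 * (Pxyy - a / c * Qxyy)) / D
      + (a / c * Qxxx + Qxxy)
      + (a ^ 3 / c * Qxxx + 3 * a ^ 2 * Qxxy + 3 * a * c * Qxyy + c ^ 2 * Qyyy) / D)
      + 1 / 16 * (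
        (a * (Pxx - a / c * Qxx) + c * (Pxy - a / c * Qxy)) / D * ((Pxx - a / c * Qxx)
          + (a ^ 2 * (Pxx - a / c * Qxx) + 2 * a * c * (Pxy - a / c * Qxy)
            + c ^ 2 * (Pyy - a / c * Qyy)) / D)
        - 1 / c ^ 2 * (a * Qxx + c * Qxy) * (Qxx
          + (a ^ 2 * Qxx + 2 * a * c * Qxy + c ^ 2 * Qyy) / D)
        - (Pxx - a / c * Qxx) * Qxx / c
        + (a ^ 2 * (Pxx - a / c * Qxx) + 2 * a * c * (Pxy - a / c * Qxy)
            + c ^ 2 * (Pyy - a / c * Qyy)) / D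
          * ((a ^ 2 * Qxx + 2 * a * c * Qxy + c ^ 2 * Qyy) / D) / c) := by
  unfold lyapunovCoeff
  simp only [jP.x, jQ.x, hDe]
  set ω := √D with hω
  have hω0 : 0 < ω := Real.sqrt_pos.2 hD
  have hD2 : D = ω ^ 2 := (Real.sq_sqrt hD.le).symm
  have jf := (jP.lin jQ hP hQ 1 (-(a / c))).shear (hP.lin hQ 1 (-(a / c))) (a / ω) (c / ω)
  have jg := (jP.lin jQ hP hQ 0 (ω / c)).shear (hP.lin hQ 0 (ω / c)) (a / ω) (c / ω)
  have ef : (fun ξ η => P (p.1 + ξ + a * η / ω) (p.2 + c * η / ω)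
      - a / c * Q (p.1 + ξ + a * η / ω) (p.2 + c * η / ω))
      = shear p (a / ω) (c / ω) (fun x y => 1 * P x y + -(a / c) * Q x y) := by
    funext ξ η
    simp only [shear, div_mul_eq_mul_div]; ring
  have eg : (fun ξ η => ω / c * Q (p.1 + ξ + a * η / ω) (p.2 + c * η / ω))
      = shear p (a / ω) (c / ω) (fun x y => 0 * P x y + ω / c * Q x y) := by
    funext ξ η
    simp only [shear, div_mul_eq_mul_div]; ring
  rw [ef, eg]
  unfold lyapunovNormalized
  have f1 := jf.xx; have f2 := jf.xy; have f3 := jf.yy; have f4 := jf.xxx; have f5 := jf.xyy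
  have g1 := jg.xx; have g2 := jg.xy; have g3 := jg.yy; have g4 := jg.xxy; have g5 := jg.yyy
  simp only [Prod.fst_zero, Prod.snd_zero] at f1 f2 f3 f4 f5 g1 g2 g3 g4 g5
  rw [f1, f2, f3, f4, f5, g1, g2, g3, g4, g5, hD2]
  field_simp
  ring

/-! ### Functions of `y / ε` -/

theorem smoothAt_scale {n : ℕ} {ψ : ℝ → ℝ} {ε : ℝ} {p : ℝ × ℝ} (h : ContDiffAt ℝ n ψ (p.2 / ε)) :
    SmoothAt n (fun _ y => ψ (y / ε)) p :=
  ContDiffAt.comp (g := ψ) (f := fun q : ℝ × ℝ => q.2 / ε) p h (contDiffAt_snd.div_const ε)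

/-- The function `(x, y) ↦ ψ (y / ε) B(x, y)`. -/
def scale (ε : ℝ) (ψ : ℝ → ℝ) (B : ℝ → ℝ → ℝ) : ℝ → ℝ → ℝ := fun x y => ψ (y / ε) * B x y

theorem SmoothAt.scale {n : ℕ} {ψ : ℝ → ℝ} {ε : ℝ} {B : ℝ → ℝ → ℝ} {p : ℝ × ℝ}
    (hψ : ContDiffAt ℝ n ψ (p.2 / ε)) (hB : SmoothAt n B p) : SmoothAt n (scale ε ψ B) p :=
  ContDiffAt.mul (smoothAt_scale hψ) hB

theorem dx_scale (ε : ℝ) (ψ : ℝ → ℝ) (B : ℝ → ℝ → ℝ) :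
    dx (scale ε ψ B) = scale ε ψ (dx B) := by
  funext x y
  exact deriv_const_mul_field (ψ (y / ε))

theorem dy_scale {ε : ℝ} {ψ : ℝ → ℝ} {B : ℝ → ℝ → ℝ} {p : ℝ × ℝ}
    (hψ : ContDiffAt ℝ 1 ψ (p.2 / ε)) (hB : SmoothAt 1 B p) :
    GermEq (dy (scale ε ψ B))
      (fun x y => 1 * scale ε ψ (dy B) x y + 1 / ε * scale ε (deriv ψ) B x y) p := by
  have ht : Tendsto (fun q : ℝ × ℝ => q.2 / ε) (𝓝 p) (𝓝 (p.2 / ε)) :=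
    (continuous_snd.div_const ε).tendsto p
  filter_upwards [hB.eventually, ht.eventually (hψ.eventually (by simp))] with q h1 h2
  have d1 := (dy_eq_fderiv (SmoothAt.differentiableAt (n := 0) h1)).1
  have d2 : HasDerivAt (fun y => ψ (y / ε)) (deriv ψ (q.2 / ε) * (1 / ε)) q.2 :=
    HasDerivAt.comp q.2 ((h2.differentiableAt (by simp)).hasDerivAt)
      ((hasDerivAt_id q.2).div_const ε)
  refine (d2.mul d1).deriv.trans ?_
  simp only [scale]; ring

theorem contDiffAt_deriv {n : ℕ} {ψ : ℝ → ℝ} {v : ℝ} (h : ContDiffAt ℝ (n + 1 : ℕ) ψ v) :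
    ContDiffAt ℝ n (deriv ψ) v := by
  have h1 : ContDiffAt ℝ n (fun q => fderiv ℝ ψ q 1) v :=
    (ContDiffAt.fderiv_right h (by norm_cast)).clm_apply contDiffAt_const
  exact h1

/-- Leibniz rule: each y-derivative that falls on ψ(y/ε) costs a factor 1/ε, and x-derivatives never
touch ψ. -/
theorem Jet.scale {ε : ℝ} {ψ : ℝ → ℝ} {B : ℝ → ℝ → ℝ} {p : ℝ × ℝ}
    {b x y xx xy yy xxx xxy xyy yyy s s1 s2 s3 : ℝ}
    (j : Jet B p x y xx xy yy xxx xxy xyy yyy) (hb : B p.1 p.2 = b)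
    (hψ : ContDiffAt ℝ 3 ψ (p.2 / ε)) (hB : SmoothAt 3 B p)
    (hs : ψ (p.2 / ε) = s) (hs1 : deriv ψ (p.2 / ε) = s1) (hs2 : deriv (deriv ψ) (p.2 / ε) = s2)
    (hs3 : deriv (deriv (deriv ψ)) (p.2 / ε) = s3) :
    Jet (scale ε ψ B) p (s * x) (s * y + s1 / ε * b) (s * xx) (s * xy + s1 / ε * x)
      (s * yy + 2 * (s1 / ε) * y + s2 / ε ^ 2 * b) (s * xxx) (s * xxy + s1 / ε * xx)
      (s * xyy + 2 * (s1 / ε) * xy + s2 / ε ^ 2 * x)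
      (s * yyy + 3 * (s1 / ε) * yy + 3 * (s2 / ε ^ 2) * y + s3 / ε ^ 3 * b) := by
  have hψ1 : ContDiffAt ℝ 2 (deriv ψ) (p.2 / ε) := contDiffAt_deriv (n := 2) hψ
  have hψ2 : ContDiffAt ℝ 1 (deriv (deriv ψ)) (p.2 / ε) := contDiffAt_deriv (n := 1) hψ1
  have hψ' : ContDiffAt ℝ 2 ψ (p.2 / ε) := hψ.of_le (by norm_num)
  have hψ1' : ContDiffAt ℝ 1 (deriv ψ) (p.2 / ε) := hψ1.of_le (by norm_num)
  have hψ'' : ContDiffAt ℝ 1 ψ (p.2 / ε) := hψ.of_le (by norm_num)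
  have hB2 := hB.of_le (m := 2) (by norm_num)
  have hB1 := hB.of_le (m := 1) (by norm_num)
  have hBx1 := hB.dx.of_le (m := 1) (by norm_num)
  have hBy1 := hB.dy.of_le (m := 1) (by norm_num)
  have ey := dy_scale hψ'' hB1
  have S1 : SmoothAt 2 (FoldFold.scale ε ψ (FoldFold.dy B)) p := .scale (n := 2) hψ' hB.dy
  have S2 : SmoothAt 2 (FoldFold.scale ε (deriv ψ) B) p := .scale (n := 2) hψ1 hB2
  have exy := ey.dx.trans (dx_lin (S1.of_le (by norm_num)) (S2.of_le (by norm_num)) _ _)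
  simp only [dx_scale] at exy
  have eyy : GermEq (dy (dy (FoldFold.scale ε ψ B))) (fun x y =>
      1 * (1 * FoldFold.scale ε ψ (dy (dy B)) x y + 1 / ε * FoldFold.scale ε (deriv ψ) (dy B) x y)
      + 1 / ε * (1 * FoldFold.scale ε (deriv ψ) (dy B) x y
        + 1 / ε * FoldFold.scale ε (deriv (deriv ψ)) B x y)) p := by
    refine ey.dy.trans ((dy_lin (S1.of_le (by norm_num)) (S2.of_le (by norm_num)) _ _).trans ?_)
    filter_upwards [dy_scale hψ'' hBy1, dy_scale hψ1' hB1] with q h1 h2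
    rw [h1, h2]
  have T1 : SmoothAt 1 (FoldFold.scale ε ψ (FoldFold.dy (FoldFold.dy B))) p :=
    .scale (n := 1) hψ'' hB.dy.dy
  have T2 : SmoothAt 1 (FoldFold.scale ε (deriv ψ) (FoldFold.dy B)) p := .scale (n := 1) hψ1' hBy1
  have T3 : SmoothAt 1 (FoldFold.scale ε (deriv (deriv ψ)) B) p := .scale (n := 1) hψ2 hB1
  have exxy := exy.dx.trans (dx_lin (.scale (n := 1) hψ'' hB.dy.dx)
    (.scale (n := 1) hψ1' hBx1) _ _)
  simp only [dx_scale] at exxy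
  have exyy := eyy.dx.trans (dx_lin (T1.lin T2 _ _) (T2.lin T3 _ _) _ _)
  have v1 := (dx_lin T1 T2 1 (1 / ε)).eq
  have v2 := (dx_lin T2 T3 1 (1 / ε)).eq
  have eyyy := eyy.dy.trans (dy_lin (T1.lin T2 _ _) (T2.lin T3 _ _) _ _)
  have w1 := (dy_lin T1 T2 1 (1 / ε)).eq
  have w2 := (dy_lin T2 T3 1 (1 / ε)).eq
  have z1 := (dy_scale hψ'' hB.dy.dy).eq
  have z2 := (dy_scale hψ1' hBy1).eq
  have z3 := (dy_scale hψ2 hB1).eq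
  rcases j with ⟨rfl, rfl, rfl, rfl, rfl, rfl, rfl, rfl, rfl⟩
  subst hb hs hs1 hs2 hs3
  refine ⟨?_, ?_, ?_, ?_, ?_, ?_, ?_, ?_, ?_⟩
  · rw [dx_scale]; rfl
  · rw [ey.eq]; simp only [FoldFold.scale]; ring
  · rw [dx_scale, dx_scale]; rfl
  · rw [exy.eq]; simp only [FoldFold.scale]; ring
  · rw [eyy.eq]; simp only [FoldFold.scale]; ring
  · rw [dx_scale, dx_scale, dx_scale]; rfl
  · rw [exxy.eq]; simp only [FoldFold.scale]; ring
  · rw [exyy.eq, v1, v2]; simp only [dx_scale]; simp only [FoldFold.scale]; ring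
  · rw [eyyy.eq, w1, w2, z1, z2, z3]; simp only [FoldFold.scale]; ring

/-! ### The first Lyapunov coefficient of a regularized vector field -/

/-- `ε` times the first Lyapunov coefficient, in terms of rescaled partial derivatives. -/
def lyapunovScaled (ε a c d Pxx pxy pyy Pxxx pxxy pxyy Qxx qxy qyy Qxxx qxxy qxyy qyyy : ℝ) : ℝ :=
  1 / 16 * (ε * (Pxxx - a / c * Qxxx)
    + (ε ^ 2 * (a ^ 2 * (Pxxx - a / c * Qxxx)) + ε * (2 * a * c * (pxxy - a / c * qxxy))
      + c ^ 2 * (pxyy - a / c * qxyy)) / d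
    + (ε * (a / c * Qxxx) + qxxy)
    + (ε ^ 2 * (a ^ 3 / c * Qxxx) + ε * (3 * a ^ 2 * qxxy) + 3 * a * c * qxyy + c ^ 2 * qyyy) / d)
  + 1 / 16 * (
    (a * (ε * (Pxx - a / c * Qxx)) + c * (pxy - a / c * qxy)) / d * (ε * (Pxx - a / c * Qxx)
      + (ε ^ 2 * (a ^ 2 * (Pxx - a / c * Qxx)) + ε * (2 * a * c * (pxy - a / c * qxy))
        + c ^ 2 * (pyy - a / c * (ε * qyy))) / d)
    - 1 / c ^ 2 * (ε * (a * Qxx) + c * qxy) * (Qxx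
      + (ε * (a ^ 2 * Qxx) + 2 * a * c * qxy + c ^ 2 * qyy) / d)
    - ε * ((Pxx - a / c * Qxx) * Qxx / c)
    + (ε ^ 2 * (a ^ 2 * (Pxx - a / c * Qxx)) + ε * (2 * a * c * (pxy - a / c * qxy))
        + c ^ 2 * (pyy - a / c * (ε * qyy))) / d
      * ((ε * (a ^ 2 * Qxx) + 2 * a * c * qxy + c ^ 2 * qyy) / d) / c)

/-- Each y-derivative costs 1/ε, except that Q_yy and Q_yyy are assumed one order better: their most
singular term carries X² - Y², which is O(ε) where the trace vanishes. With a determinant of order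
1/ε, a single factor ε then makes the coefficient regular at ε = 0. -/
theorem mul_lyapunovCoeff_eq {P Q : ℝ → ℝ → ℝ} {p : ℝ × ℝ}
    {ε a Py Pxx pxy pyy Pxxx pxxy pxyy Pyyy c Qy Qxx qxy qyy Qxxx qxxy qxyy qyyy d : ℝ}
    (jP : Jet P p a Py Pxx (pxy / ε) (pyy / ε ^ 2) Pxxx (pxxy / ε) (pxyy / ε ^ 2) Pyyy)
    (jQ : Jet Q p c Qy Qxx (qxy / ε) (qyy / ε) Qxxx (qxxy / ε) (qxyy / ε ^ 2) (qyyy / ε ^ 2))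
    (hP : SmoothAt 3 P p) (hQ : SmoothAt 3 Q p) (hc : c ≠ 0) (hε : 0 < ε) (hd : 0 < d)
    (hde : detJ P Q p = d / ε) :
    ε * lyapunovCoeff P Q p
      = lyapunovScaled ε a c d Pxx pxy pyy Pxxx pxxy pxyy Qxx qxy qyy Qxxx qxxy qxyy qyyy := by
  rw [lyapunovCoeff_eq jP jQ hP hQ hc (div_pos hd hε) hde]
  unfold lyapunovScaled
  field_simp

/-- The expression is rational and its only denominators are c, c² and d, whose limits are nonzero.
-/
theorem tendsto_lyapunovScaled {l : Filter ℝ}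
    {ε a c d Pxx pxy pyy Pxxx pxxy pxyy Qxx qxy qyy Qxxx qxxy qxyy qyyy : ℝ → ℝ}
    {a₀ c₀ d₀ Pxx₀ pxy₀ pyy₀ Pxxx₀ pxxy₀ pxyy₀ Qxx₀ qxy₀ qyy₀ Qxxx₀ qxxy₀ qxyy₀ qyyy₀ : ℝ}
    (hε : Tendsto ε l (𝓝 0)) (ha : Tendsto a l (𝓝 a₀)) (hc : Tendsto c l (𝓝 c₀))
    (hd : Tendsto d l (𝓝 d₀)) (hc₀ : c₀ ≠ 0) (hd₀ : d₀ ≠ 0)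
    (h1 : Tendsto Pxx l (𝓝 Pxx₀)) (h2 : Tendsto pxy l (𝓝 pxy₀)) (h3 : Tendsto pyy l (𝓝 pyy₀))
    (h4 : Tendsto Pxxx l (𝓝 Pxxx₀)) (h5 : Tendsto pxxy l (𝓝 pxxy₀))
    (h6 : Tendsto pxyy l (𝓝 pxyy₀)) (k1 : Tendsto Qxx l (𝓝 Qxx₀))
    (k2 : Tendsto qxy l (𝓝 qxy₀)) (k3 : Tendsto qyy l (𝓝 qyy₀)) (k4 : Tendsto Qxxx l (𝓝 Qxxx₀))
    (k5 : Tendsto qxxy l (𝓝 qxxy₀)) (k6 : Tendsto qxyy l (𝓝 qxyy₀))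
    (k7 : Tendsto qyyy l (𝓝 qyyy₀)) :
    Tendsto (fun t => lyapunovScaled (ε t) (a t) (c t) (d t) (Pxx t) (pxy t) (pyy t) (Pxxx t)
      (pxxy t) (pxyy t) (Qxx t) (qxy t) (qyy t) (Qxxx t) (qxxy t) (qxyy t) (qyyy t)) l
      (𝓝 (lyapunovScaled 0 a₀ c₀ d₀ Pxx₀ pxy₀ pyy₀ Pxxx₀ pxxy₀ pxyy₀ Qxx₀ qxy₀ qyy₀ Qxxx₀ qxxy₀
        qxyy₀ qyyy₀)) := by
  have hc2 : c₀ ^ 2 ≠ 0 := pow_ne_zero 2 hc₀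
  unfold lyapunovScaled
  repeat' first
    | assumption
    | exact tendsto_const_nhds
    | with_reducible apply Tendsto.sub
    | with_reducible apply Tendsto.add
    | with_reducible apply Tendsto.mul
    | with_reducible apply Tendsto.pow
    | refine Filter.Tendsto.div ?_ ?_ ?_

/-- The limit of `ε` times the first Lyapunov coefficient: `s1, s2, s3` are the derivatives of the
transition function. -/
def lyapunovLimit (a c s1 s2 s3 b1 b1x b2x β b2y b2xx Qxx : ℝ) : ℝ :=
  -- After the leading ε = 0, the zeros stand for P_xx, P_xxx, p_xxy and Q_xxx, which occur in
  -- `lyapunovScaled` only with a factor ε.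
  lyapunovScaled 0 a c (-(s1 * b1 / 2 * c)) 0 (s1 * b1x / 2) (s2 * b1 / 2) 0 0 (s2 * b1x / 2)
    Qxx (s1 * b2x / 2) ((2 * s1 * b2y + s2 * β) / 2) 0 (s1 * b2xx / 2) (s2 * b2x / 2)
    ((3 * s2 * b2y + s3 * β) / 2)

/-- The vector field component `(A + φ (y / ε) B) / 2`. -/
def blend (ε : ℝ) (φ : ℝ → ℝ) (A B : ℝ → ℝ → ℝ) : ℝ → ℝ → ℝ :=
  fun x y => 1 / 2 * A x y + 1 / 2 * scale ε φ B x y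

/-! ### Functions of three variables -/

/-- The function `F` of `(α, x, y)` is of class `Cⁿ` at `q`. -/
def SmoothAt₃ (n : ℕ) (F : ℝ → ℝ → ℝ → ℝ) (q : ℝ × ℝ × ℝ) : Prop :=
  ContDiffAt ℝ n (fun q : ℝ × ℝ × ℝ => F q.1 q.2.1 q.2.2) q

theorem SmoothAt₃.of_le {m n : ℕ} {F : ℝ → ℝ → ℝ → ℝ} {q : ℝ × ℝ × ℝ} (h : SmoothAt₃ n F q)
    (hmn : m ≤ n) : SmoothAt₃ m F q :=
  ContDiffAt.of_le h (by exact_mod_cast hmn)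

theorem SmoothAt₃.eventually {n : ℕ} {F : ℝ → ℝ → ℝ → ℝ} {q : ℝ × ℝ × ℝ} (h : SmoothAt₃ n F q) :
    ∀ᶠ q' in 𝓝 q, SmoothAt₃ n F q' :=
  ContDiffAt.eventually h (by simp)

theorem SmoothAt₃.section {n : ℕ} {F : ℝ → ℝ → ℝ → ℝ} {q : ℝ × ℝ × ℝ} (h : SmoothAt₃ n F q) :
    SmoothAt n (F q.1) q.2 :=
  ContDiffAt.comp (g := fun q : ℝ × ℝ × ℝ => F q.1 q.2.1 q.2.2) (f := fun p : ℝ × ℝ => (q.1, p))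
    q.2 h (contDiffAt_const.prodMk contDiffAt_id)

theorem SmoothAt₃.hasDerivAt_curve {F : ℝ → ℝ → ℝ → ℝ} {α u v : ℝ → ℝ} {α' u' v' t : ℝ}
    (h : SmoothAt₃ 1 F (α t, u t, v t)) (hα : HasDerivAt α α' t) (hu : HasDerivAt u u' t)
    (hv : HasDerivAt v v' t) :
    HasDerivAt (fun s => F (α s) (u s) (v s))
      (deriv (fun s => F s (u t) (v t)) (α t) * α'
        + (dx (F (α t)) (u t) (v t) * u' + dy (F (α t)) (u t) (v t) * v')) t := by
  set G : ℝ × ℝ × ℝ → ℝ := fun q => F q.1 q.2.1 q.2.2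
  have hd : HasFDerivAt G (fderiv ℝ G (α t, u t, v t)) (α t, u t, v t) :=
    (ContDiffAt.differentiableAt h (by simp)).hasFDerivAt
  have e0 : deriv (fun s => F s (u t) (v t)) (α t) = fderiv ℝ G (α t, u t, v t) (1, 0) :=
    (HasFDerivAt.comp_hasDerivAt (f := fun s => (s, u t, v t)) (α t) hd
      ((hasDerivAt_id (α t)).prodMk (hasDerivAt_const (α t) (u t, v t)))).deriv
  have e1 : dx (F (α t)) (u t) (v t) = fderiv ℝ G (α t, u t, v t) (0, 1, 0) :=
    (HasFDerivAt.comp_hasDerivAt (f := fun s => (α t, s, v t)) (u t) hd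
      ((hasDerivAt_const (u t) (α t)).prodMk
        ((hasDerivAt_id (u t)).prodMk (hasDerivAt_const (u t) (v t))))).deriv
  have e2 : dy (F (α t)) (u t) (v t) = fderiv ℝ G (α t, u t, v t) (0, 0, 1) :=
    (HasFDerivAt.comp_hasDerivAt (f := fun s => (α t, u t, s)) (v t) hd
      ((hasDerivAt_const (v t) (α t)).prodMk
        ((hasDerivAt_const (v t) (u t)).prodMk (hasDerivAt_id (v t))))).deriv
  have := hd.comp_hasDerivAt t (hα.prodMk (hu.prodMk hv))
  refine this.congr_deriv ?_
  rw [e0, e1, e2, show ((α', u', v') : ℝ × ℝ × ℝ)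
    = α' • (1, 0) + (u' • (0, 1, 0) + v' • (0, 0, 1)) by simp]
  simp only [map_add, map_smul, smul_eq_mul]
  ring

theorem SmoothAt₃.dx {n : ℕ} {F : ℝ → ℝ → ℝ → ℝ} {q : ℝ × ℝ × ℝ} (h : SmoothAt₃ (n + 1) F q) :
    SmoothAt₃ n (fun α => dx (F α)) q := by
  have h1 : ContDiffAt ℝ n
      (fun q => fderiv ℝ (fun q : ℝ × ℝ × ℝ => F q.1 q.2.1 q.2.2) q (0, 1, 0)) q :=
    (ContDiffAt.fderiv_right h (by norm_cast)).clm_apply contDiffAt_const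
  refine h1.congr_of_eventuallyEq ?_
  filter_upwards [h.eventually] with q hq
  have hd := (ContDiffAt.differentiableAt hq (by simp)).hasFDerivAt
  exact (hd.comp_hasDerivAt q.2.1
      ((hasDerivAt_const q.2.1 q.1).prodMk
        ((hasDerivAt_id q.2.1).prodMk (hasDerivAt_const q.2.1 q.2.2)))).deriv

theorem SmoothAt₃.dy {n : ℕ} {F : ℝ → ℝ → ℝ → ℝ} {q : ℝ × ℝ × ℝ} (h : SmoothAt₃ (n + 1) F q) :
    SmoothAt₃ n (fun α => dy (F α)) q := by
  have h1 : ContDiffAt ℝ n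
      (fun q => fderiv ℝ (fun q : ℝ × ℝ × ℝ => F q.1 q.2.1 q.2.2) q (0, 0, 1)) q :=
    (ContDiffAt.fderiv_right h (by norm_cast)).clm_apply contDiffAt_const
  refine h1.congr_of_eventuallyEq ?_
  filter_upwards [h.eventually] with q hq
  have hd := (ContDiffAt.differentiableAt hq (by simp)).hasFDerivAt
  exact (hd.comp_hasDerivAt q.2.2
      ((hasDerivAt_const q.2.2 q.1).prodMk
        ((hasDerivAt_const q.2.2 q.2.1).prodMk (hasDerivAt_id q.2.2)))).deriv

theorem SmoothAt₃.tendsto {n : ℕ} {F : ℝ → ℝ → ℝ → ℝ} (h : SmoothAt₃ n F 0) {l : Filter ℝ}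
    {α : ℝ → ℝ} {p : ℝ → ℝ × ℝ} (hα : Tendsto α l (𝓝 0)) (hp : Tendsto p l (𝓝 0)) :
    Tendsto (fun t => F (α t) (p t).1 (p t).2) l (𝓝 (F 0 0 0)) := by
  have h1 : Tendsto (fun t => (α t, p t)) l (𝓝 (0 : ℝ × ℝ × ℝ)) := hα.prodMk_nhds hp
  exact (ContDiffAt.continuousAt h).tendsto.comp h1

/-! ### The limit of the first Lyapunov coefficient -/

/-- Here β is the limit of B2/ε at the points of the curve, as dictated by the vanishing trace. The
signs of φ', B1 and c make the limit -φ' B1 c / 2 of the rescaled determinant positive. -/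
theorem tendsto_mul_lyapunovCoeff {A1 B1 A2 B2 : ℝ → ℝ → ℝ → ℝ} {φ : ℝ → ℝ} {v₀ : ℝ}
    (hA1 : SmoothAt₃ 4 A1 0) (hB1 : SmoothAt₃ 4 B1 0) (hA2 : SmoothAt₃ 4 A2 0)
    (hB2 : SmoothAt₃ 4 B2 0) (hφ : ContDiffAt ℝ 4 φ v₀) {α : ℝ → ℝ} {p : ℝ → ℝ × ℝ}
    (hα : Tendsto α (𝓝[>] 0) (𝓝 0)) (hp : Tendsto p (𝓝[>] 0) (𝓝 0))
    (hv : Tendsto (fun ε => (p ε).2 / ε) (𝓝[>] 0) (𝓝 v₀))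
    (htr : ∀ᶠ ε in 𝓝[>] 0, traceJ (blend ε φ (A1 (α ε)) (B1 (α ε)))
      (blend ε φ (A2 (α ε)) (B2 (α ε))) (p ε) = 0)
    (hs1 : 0 < deriv φ v₀) (hb1 : 0 < B1 0 0 0) {a c β : ℝ}
    (ha : a = 1 / 2 * dx (A1 0) 0 0 + 1 / 2 * (φ v₀ * dx (B1 0) 0 0))
    (hc : c = 1 / 2 * dx (A2 0) 0 0 + 1 / 2 * (φ v₀ * dx (B2 0) 0 0)) (hc0 : c < 0)
    (hβ : β * deriv φ v₀ = -(2 * a + (dy (A2 0) 0 0 + φ v₀ * dy (B2 0) 0 0))) :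
    Tendsto (fun ε => ε * lyapunovCoeff (blend ε φ (A1 (α ε)) (B1 (α ε)))
      (blend ε φ (A2 (α ε)) (B2 (α ε))) (p ε)) (𝓝[>] 0)
      (𝓝 (lyapunovLimit a c (deriv φ v₀) (deriv (deriv φ) v₀) (deriv (deriv (deriv φ)) v₀)
        (B1 0 0 0) (dx (B1 0) 0 0) (dx (B2 0) 0 0)
        β (dy (B2 0) 0 0) (dx (dx (B2 0)) 0 0)
        (1 / 2 * dx (dx (A2 0)) 0 0 + 1 / 2 * (φ v₀ * dx (dx (B2 0)) 0 0)))) := by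
  have hε : Tendsto (fun ε : ℝ => ε) (𝓝[>] 0) (𝓝 0) := tendsto_nhdsWithin_of_tendsto_nhds tendsto_id
  have hφ1 : ContDiffAt ℝ 3 (deriv φ) v₀ := contDiffAt_deriv (n := 3) hφ
  have hφ2 : ContDiffAt ℝ 2 (deriv (deriv φ)) v₀ := contDiffAt_deriv (n := 2) hφ1
  have hφ3 : ContDiffAt ℝ 1 (deriv (deriv (deriv φ))) v₀ := contDiffAt_deriv (n := 1) hφ2
  have ts := hφ.continuousAt.tendsto.comp hv
  have ts1 := hφ1.continuousAt.tendsto.comp hv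
  have ts2 := hφ2.continuousAt.tendsto.comp hv
  have ts3 := hφ3.continuousAt.tendsto.comp hv
  simp only [Function.comp_def] at ts ts1 ts2 ts3
  have tA1x := hA1.dx.tendsto hα hp
  have tA1y := hA1.dy.tendsto hα hp
  have tA1xx := hA1.dx.dx.tendsto hα hp
  have tA1xy := hA1.dy.dx.tendsto hα hp
  have tA1yy := hA1.dy.dy.tendsto hα hp
  have tA1xxx := hA1.dx.dx.dx.tendsto hα hp
  have tA1xxy := hA1.dy.dx.dx.tendsto hα hp
  have tA1xyy := hA1.dy.dy.dx.tendsto hα hp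
  have tB1 := hB1.tendsto hα hp
  have tB1x := hB1.dx.tendsto hα hp
  have tB1y := hB1.dy.tendsto hα hp
  have tB1xx := hB1.dx.dx.tendsto hα hp
  have tB1xy := hB1.dy.dx.tendsto hα hp
  have tB1yy := hB1.dy.dy.tendsto hα hp
  have tB1xxx := hB1.dx.dx.dx.tendsto hα hp
  have tB1xxy := hB1.dy.dx.dx.tendsto hα hp
  have tB1xyy := hB1.dy.dy.dx.tendsto hα hp
  have tA2x := hA2.dx.tendsto hα hp
  have tA2y := hA2.dy.tendsto hα hp
  have tA2xx := hA2.dx.dx.tendsto hα hp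
  have tA2xy := hA2.dy.dx.tendsto hα hp
  have tA2yy := hA2.dy.dy.tendsto hα hp
  have tA2xxx := hA2.dx.dx.dx.tendsto hα hp
  have tA2xxy := hA2.dy.dx.dx.tendsto hα hp
  have tA2xyy := hA2.dy.dy.dx.tendsto hα hp
  have tA2yyy := hA2.dy.dy.dy.tendsto hα hp
  have tB2x := hB2.dx.tendsto hα hp
  have tB2y := hB2.dy.tendsto hα hp
  have tB2xx := hB2.dx.dx.tendsto hα hp
  have tB2xy := hB2.dy.dx.tendsto hα hp
  have tB2yy := hB2.dy.dy.tendsto hα hp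
  have tB2xxx := hB2.dx.dx.dx.tendsto hα hp
  have tB2xxy := hB2.dy.dx.dx.tendsto hα hp
  have tB2xyy := hB2.dy.dy.dx.tendsto hα hp
  have tB2yyy := hB2.dy.dy.dy.tendsto hα hp
  have hαp : Tendsto (fun t => (α t, p t)) (𝓝[>] 0) (𝓝 (0 : ℝ × ℝ × ℝ)) := hα.prodMk_nhds hp
  have tP := (tA1x.const_mul (1 / 2)).add ((ts.mul tB1x).const_mul (1 / 2))
  have tQ := (tA2x.const_mul (1 / 2)).add ((ts.mul tB2x).const_mul (1 / 2))
  rw [← ha] at tP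
  rw [← hc] at tQ
  -- The quotient to which zero trace equates B2/ε; the equation for β identifies its limit.
  have tβ := ((((tP.const_mul 2).add (tA2y.add (ts.mul tB2y))).neg).div ts1 hs1.ne')
  rw [← hβ, mul_div_cancel_right₀ _ hs1.ne', Pi.div_def] at tβ
  have tPy := ((hε.mul tA1y).const_mul (1 / 2)).add
    (((hε.mul (ts.mul tB1y)).add (ts1.mul tB1)).const_mul (1 / 2))
  have td := ((hε.mul (tP.pow 2)).neg).sub (tPy.mul tQ)
  have tpxy := ((hε.mul tA1xy).const_mul (1 / 2)).add
    (((hε.mul (ts.mul tB1xy)).add (ts1.mul tB1x)).const_mul (1 / 2))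
  have tpyy := (((hε.pow 2).mul tA1yy).const_mul (1 / 2)).add
    (((((hε.pow 2).mul (ts.mul tB1yy)).add (hε.mul ((ts1.const_mul 2).mul tB1y))).add
      (ts2.mul tB1)).const_mul (1 / 2))
  have tpxx := (tA1xx.const_mul (1 / 2)).add ((ts.mul tB1xx).const_mul (1 / 2))
  have tpxxx := (tA1xxx.const_mul (1 / 2)).add ((ts.mul tB1xxx).const_mul (1 / 2))
  have tpxxy := ((hε.mul tA1xxy).const_mul (1 / 2)).add
    (((hε.mul (ts.mul tB1xxy)).add (ts1.mul tB1xx)).const_mul (1 / 2))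
  have tpxyy := (((hε.pow 2).mul tA1xyy).const_mul (1 / 2)).add
    (((((hε.pow 2).mul (ts.mul tB1xyy)).add (hε.mul ((ts1.const_mul 2).mul tB1xy))).add
      (ts2.mul tB1x)).const_mul (1 / 2))
  have tqxx := (tA2xx.const_mul (1 / 2)).add ((ts.mul tB2xx).const_mul (1 / 2))
  have tqxxx := (tA2xxx.const_mul (1 / 2)).add ((ts.mul tB2xxx).const_mul (1 / 2))
  have tqxy := ((hε.mul tA2xy).const_mul (1 / 2)).add
    (((hε.mul (ts.mul tB2xy)).add (ts1.mul tB2x)).const_mul (1 / 2))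
  have tqxxy := ((hε.mul tA2xxy).const_mul (1 / 2)).add
    (((hε.mul (ts.mul tB2xxy)).add (ts1.mul tB2xx)).const_mul (1 / 2))
  have tqyy := ((hε.mul tA2yy).const_mul (1 / 2)).add
    ((((hε.mul (ts.mul tB2yy)).add ((ts1.const_mul 2).mul tB2y)).add
      (ts2.mul tβ)).const_mul (1 / 2))
  have tqxyy := (((hε.pow 2).mul tA2xyy).const_mul (1 / 2)).add
    (((((hε.pow 2).mul (ts.mul tB2xyy)).add (hε.mul ((ts1.const_mul 2).mul tB2xy))).add
      (ts2.mul tB2x)).const_mul (1 / 2))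
  have tqyyy := (((hε.pow 2).mul tA2yyy).const_mul (1 / 2)).add
    ((((((hε.pow 2).mul (ts.mul tB2yyy)).add (hε.mul ((ts1.const_mul 3).mul tB2yy))).add
      ((ts2.const_mul 3).mul tB2y)).add (ts3.mul tβ)).const_mul (1 / 2))
  have hd0 : 0 < -(deriv φ v₀ * B1 0 0 0 / 2 * c) := by
    have := mul_pos hs1 hb1
    nlinarith
  have td' := td
  rw [show -(0 * a ^ 2) - (1 / 2 * (0 * dy (A1 0) 0 0)
    + 1 / 2 * (0 * (φ v₀ * dy (B1 0) 0 0) + deriv φ v₀ * B1 0 0 0)) * c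
    = -(deriv φ v₀ * B1 0 0 0 / 2 * c) by ring] at td'
  have main := tendsto_lyapunovScaled hε tP tQ td' hc0.ne hd0.ne' tpxx tpxy tpyy tpxxx tpxxy tpxyy
    tqxx tqxy tqyy tqxxx tqxxy tqxyy tqyyy
  refine (main.congr' ?_).trans (le_of_eq ?_)
  · filter_upwards [htr, self_mem_nhdsWithin, hαp.eventually hA1.eventually,
      hαp.eventually hA2.eventually, hαp.eventually hB1.eventually, hαp.eventually hB2.eventually,
      hv.eventually (hφ.eventually (by simp)), td'.eventually (lt_mem_nhds hd0),
      tQ.eventually (gt_mem_nhds hc0), ts1.eventually (lt_mem_nhds hs1)]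
      with ε htr hε sA1 sA2 sB1 sB2 sφ hd hc hs1
    have hε : 0 < ε := hε
    have sA1 := sA1.section.of_le (m := 3) (by norm_num)
    have sB1 := sB1.section.of_le (m := 3) (by norm_num)
    have sA2 := sA2.section.of_le (m := 3) (by norm_num)
    have sB2 := sB2.section.of_le (m := 3) (by norm_num)
    have sφ : ContDiffAt ℝ 3 φ ((p ε).2 / ε) := sφ.of_le (by norm_num)
    have jP := (Jet.self _ _).lin ((Jet.self _ _).scale rfl sφ sB1 rfl rfl rfl rfl) sA1
      (.scale (n := 3) sφ sB1) (1 / 2) (1 / 2)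
    have jQ := (Jet.self _ _).lin ((Jet.self _ _).scale rfl sφ sB2 rfl rfl rfl rfl) sA2
      (.scale (n := 3) sφ sB2) (1 / 2) (1 / 2)
    have sP : SmoothAt 3 (blend ε φ (A1 (α ε)) (B1 (α ε))) (p ε) :=
      sA1.lin (.scale (n := 3) sφ sB1) _ _
    have sQ : SmoothAt 3 (blend ε φ (A2 (α ε)) (B2 (α ε))) (p ε) :=
      sA2.lin (.scale (n := 3) sφ sB2) _ _
    have htr' := htr
    unfold traceJ at htr'
    have eQy : dy (blend ε φ (A2 (α ε)) (B2 (α ε))) (p ε).1 (p ε).2 = _ := jQ.y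
    have ePx : dx (blend ε φ (A1 (α ε)) (B1 (α ε))) (p ε).1 (p ε).2 = _ := jP.x
    have ePy : dy (blend ε φ (A1 (α ε)) (B1 (α ε))) (p ε).1 (p ε).2 = _ := jP.y
    have eQx : dx (blend ε φ (A2 (α ε)) (B2 (α ε))) (p ε).1 (p ε).2 = _ := jQ.x
    -- Zero trace replaces Q_y by -P_x, so the determinant is -P_x² - P_y Q_x, of order 1/ε because
    -- of P_y.
    have hdet : detJ (blend ε φ (A1 (α ε)) (B1 (α ε))) (blend ε φ (A2 (α ε)) (B2 (α ε))) (p ε)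
        = (-(ε * dx (blend ε φ (A1 (α ε)) (B1 (α ε))) (p ε).1 (p ε).2 ^ 2)
          - ε * dy (blend ε φ (A1 (α ε)) (B1 (α ε))) (p ε).1 (p ε).2
            * dx (blend ε φ (A2 (α ε)) (B2 (α ε))) (p ε).1 (p ε).2) / ε := by
      unfold detJ
      rw [eq_div_iff hε.ne']
      linear_combination ε * dx (blend ε φ (A1 (α ε)) (B1 (α ε))) (p ε).1 (p ε).2 * htr'
    rw [ePx, ePy, eQx] at hdet
    rw [ePx, eQy] at htr'
    -- The trace contains φ'(y/ε) B2 / (2ε), so its vanishing gives B2 = O(ε); this removes one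
    -- power of 1/ε from Q_yy and Q_yyy.
    have hB : B2 (α ε) (p ε).1 (p ε).2 = ε * (-(2 * (1 / 2 * dx (A1 (α ε)) (p ε).1 (p ε).2
        + 1 / 2 * (φ ((p ε).2 / ε) * dx (B1 (α ε)) (p ε).1 (p ε).2))
        + (dy (A2 (α ε)) (p ε).1 (p ε).2 + φ ((p ε).2 / ε) * dy (B2 (α ε)) (p ε).1 (p ε).2))
        / deriv φ ((p ε).2 / ε)) := by
      field_simp
      field_simp at htr'
      linear_combination htr'
    refine (mul_lyapunovCoeff_eq
      (Py := dy (blend ε φ (A1 (α ε)) (B1 (α ε))) (p ε).1 (p ε).2)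
      (Pyyy := dy (dy (dy (blend ε φ (A1 (α ε)) (B1 (α ε))))) (p ε).1 (p ε).2)
      (Qy := dy (blend ε φ (A2 (α ε)) (B2 (α ε))) (p ε).1 (p ε).2)
      ?_ ?_ sP sQ hc.ne hε hd ?_).symm
    · convert jP using 1
      all_goals first
        | rfl
        | exact jP.y
        | exact jP.yyy
        | field_simp
    · rw [hB] at jQ
      convert jQ using 1
      all_goals first
        | rfl
        | exact jQ.y
        | field_simp
    · rw [hdet]
      field_simp
  · congr 1
    unfold lyapunovLimit lyapunovScaled
    ring

/-! ### Averages of a function along rays -/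

/-- The average `∫ w(θ) h(κ(θ) s) dθ` over `[a, b]`, a function of `s`. -/
def avg (κ w : ℝ → ℝ) (a b : ℝ) (h : ℝ → ℝ) (s : ℝ) : ℝ := ∫ θ in a..b, w θ * h (κ θ * s)

section avg

variable {κ w : ℝ → ℝ} {a b r : ℝ} {h k : ℝ → ℝ}

theorem avg_zero : avg κ w a b h 0 = h 0 * ∫ θ in a..b, w θ := by
  simp only [avg, mul_zero, intervalIntegral.integral_mul_const]
  ring

theorem mul_mem_ball {κ : ℝ → ℝ} (hκ1 : ∀ θ ∈ uIcc a b, |κ θ| ≤ 1) {θ s : ℝ}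
    (hθ : θ ∈ uIcc a b) (hs : |s| < r) : |κ θ * s| < r := by
  rw [abs_mul]
  nlinarith [hκ1 θ hθ, abs_nonneg s, abs_nonneg (κ θ)]

theorem intervalIntegrable_avg (hκ : Continuous κ) (hw : Continuous w)
    (hκ1 : ∀ θ ∈ uIcc a b, |κ θ| ≤ 1) (hh : ∀ x, |x| < r → ContinuousAt h x) {s : ℝ}
    (hs : |s| < r) : IntervalIntegrable (fun θ => w θ * h (κ θ * s)) MeasureTheory.volume a b := by
  refine ContinuousOn.intervalIntegrable fun θ hθ => ContinuousAt.continuousWithinAt ?_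
  exact hw.continuousAt.mul (ContinuousAt.comp (f := fun θ => κ θ * s)
    (hh _ (mul_mem_ball hκ1 hθ hs)) (by fun_prop))

theorem avg_add_mul (hκ : Continuous κ) (hw : Continuous w)
    (hκ1 : ∀ θ ∈ uIcc a b, |κ θ| ≤ 1) (hh : ∀ x, |x| < r → ContinuousAt h x)
    (hk : ∀ x, |x| < r → ContinuousAt k x) {s : ℝ} (hs : |s| < r) (δ : ℝ) :
    avg κ w a b (fun x => h x + δ * k x) s = avg κ w a b h s + δ * avg κ w a b k s := by
  unfold avg
  rw [← intervalIntegral.integral_const_mul, ← intervalIntegral.integral_add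
    (intervalIntegrable_avg hκ hw hκ1 hh hs)
    ((intervalIntegrable_avg hκ hw hκ1 hk hs).const_mul δ)]
  congr 1
  funext θ
  ring

/-- Differentiation under the integral sign; |κ| ≤ 1 keeps κ(θ) s inside the ball where h is smooth.
-/
theorem hasDerivAt_avg (hκ : Continuous κ) (hw : Continuous w)
    (hκ1 : ∀ θ ∈ uIcc a b, |κ θ| ≤ 1) (hh : ∀ x, |x| < r → ContDiffAt ℝ 1 h x) {s : ℝ}
    (hs : |s| < r) :
    HasDerivAt (avg κ w a b h) (avg κ (fun θ => w θ * κ θ) a b (deriv h) s) s := by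
  -- A smaller radius gives a compact interval on which h' is bounded, hence a dominating function.
  obtain ⟨r', hr', hr'r⟩ := exists_between hs
  have hd : ∀ x, |x| < r → ContinuousAt (deriv h) x := fun x hx =>
    (contDiffAt_deriv (n := 0) (hh x hx)).continuousAt
  have hdC : ContinuousOn (deriv h) (Icc (-r') r') := fun x hx =>
    (hd x ((abs_le.2 hx).trans_lt hr'r)).continuousWithinAt
  obtain ⟨C, hC⟩ := isCompact_Icc.exists_bound_of_continuousOn hdC
  have hmem : {x : ℝ | |x| < r'} ∈ 𝓝 s := (isOpen_lt continuous_abs continuous_const).mem_nhds hr'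
  have hint : ∀ x, |x| < r →
      IntervalIntegrable (fun θ => w θ * h (κ θ * x)) MeasureTheory.volume a b := fun x hx =>
    intervalIntegrable_avg hκ hw hκ1 (fun x hx => (hh x hx).continuousAt) hx
  have hint' := intervalIntegrable_avg (w := fun θ => w θ * κ θ) hκ (hw.mul hκ) hκ1 hd hs
  refine (intervalIntegral.hasDerivAt_integral_of_dominated_loc_of_deriv_le
    (F := fun s θ => w θ * h (κ θ * s)) (F' := fun s θ => w θ * κ θ * deriv h (κ θ * s))
    (bound := fun θ => |w θ * κ θ| * C) hmem ?_ (hint s hs) hint'.aestronglyMeasurable_restrict_uIoc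
    ?_ ?_ ?_).2
  · filter_upwards [hmem] with x hx
    exact (hint x (lt_trans hx hr'r)).aestronglyMeasurable_restrict_uIoc
  · refine Eventually.of_forall fun θ hθ x hx => ?_
    rw [norm_mul, Real.norm_eq_abs (w θ * κ θ)]
    refine mul_le_mul_of_nonneg_left (hC _ ?_) (abs_nonneg _)
    exact abs_le.1 (mul_mem_ball hκ1 (uIoc_subset_uIcc hθ) hx).le
  · exact (by fun_prop : Continuous fun θ => |w θ * κ θ| * C).intervalIntegrable _ _
  · refine Eventually.of_forall fun θ hθ x hx => ?_
    have h1 := ((hh _ (mul_mem_ball hκ1 (uIoc_subset_uIcc hθ) (lt_trans hx hr'r))).differentiableAt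
      (by simp)).hasDerivAt
    have h2 : HasDerivAt (fun s => κ θ * s) (κ θ) x := by
      simpa using (hasDerivAt_id x).const_mul (κ θ)
    refine ((HasDerivAt.comp x h1 h2).const_mul (w θ)).congr_deriv ?_
    ring

/-- The derivative of an average is an average of h' with weight w κ, so the induction runs over all
weights and functions. One degree of smoothness is given up because the base case already goes
through `hasDerivAt_avg`. -/
theorem contDiffOn_avg (hκ : Continuous κ) (hκ1 : ∀ θ ∈ uIcc a b, |κ θ| ≤ 1) (n : ℕ) :
    ∀ {w h : ℝ → ℝ}, Continuous w → (∀ x, |x| < r → ContDiffAt ℝ (n + 1 : ℕ) h x) →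
      ContDiffOn ℝ n (avg κ w a b h) {x | |x| < r} := by
  induction n with
  | zero =>
    intro w h hw hh
    refine contDiffOn_zero.2 fun s hs => ?_
    exact (hasDerivAt_avg hκ hw hκ1 hh hs).continuousAt.continuousWithinAt
  | succ n ih =>
    intro w h hw hh
    have hd := fun s (hs : |s| < r) => hasDerivAt_avg hκ hw hκ1
      (fun x hx => (hh x hx).of_le (by norm_cast; omega)) hs
    have ho : IsOpen {x : ℝ | |x| < r} := isOpen_lt continuous_abs continuous_const
    push_cast
    rw [contDiffOn_succ_iff_deriv_of_isOpen ho]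
    refine ⟨fun s hs => (hd s hs).differentiableAt.differentiableWithinAt, by simp, ?_⟩
    refine (ih (hw.mul hκ) fun x hx => contDiffAt_deriv (hh x hx)).congr fun s hs => ?_
    exact (hd s hs).deriv

theorem eventually_abs_lt_of_nhds {P : ℝ → Prop} (h : ∀ᶠ x in 𝓝 (0 : ℝ), P x) :
    ∃ r > 0, ∀ x, |x| < r → P x := by
  obtain ⟨r, hr, H⟩ := Metric.eventually_nhds_iff.1 h
  exact ⟨r, hr, fun x hx => H (by simpa using hx)⟩

theorem contDiffAt_avg (hκ : Continuous κ) (hκ1 : ∀ θ ∈ uIcc a b, |κ θ| ≤ 1) (hw : Continuous w)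
    {n : ℕ} (hh : ContDiffAt ℝ (n + 1 : ℕ) h 0) : ContDiffAt ℝ n (avg κ w a b h) 0 := by
  obtain ⟨r, hr, H⟩ := eventually_abs_lt_of_nhds (hh.eventually (by simp))
  have ho : IsOpen {x : ℝ | |x| < r} := isOpen_lt continuous_abs continuous_const
  exact (contDiffOn_avg hκ hκ1 n hw H).contDiffAt (ho.mem_nhds (by simpa using hr))

theorem eventually_deriv_avg (hκ : Continuous κ) (hκ1 : ∀ θ ∈ uIcc a b, |κ θ| ≤ 1)
    (hw : Continuous w) (hh : ContDiffAt ℝ 1 h 0) :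
    deriv (avg κ w a b h) =ᶠ[𝓝 0] avg κ (fun θ => w θ * κ θ) a b (deriv h) := by
  obtain ⟨r, hr, H⟩ := eventually_abs_lt_of_nhds (hh.eventually (by simp))
  have ho : IsOpen {x : ℝ | |x| < r} := isOpen_lt continuous_abs continuous_const
  filter_upwards [ho.mem_nhds (show (0 : ℝ) ∈ {x : ℝ | |x| < r} by simpa using hr)] with s hs
  exact (hasDerivAt_avg hκ hw hκ1 H hs).deriv

end avg

/-! ### The square root of a nondegenerate minimum -/

/-- A function with a nondegenerate minimum at `v₀` and value `0` there is `s² / 2` in a suitable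
coordinate `s`, with inverse `ψ`. -/
theorem exists_morse_coordinate {V Vp : ℝ → ℝ} {v₀ : ℝ} (hV0 : V v₀ = 0) (hVp0 : Vp v₀ = 0)
    (hV : ∀ᶠ v in 𝓝 v₀, HasDerivAt V (Vp v) v) (hVp : ContDiffAt ℝ 8 Vp v₀)
    (hpos : 0 < deriv Vp v₀) :
    ∃ σ ψ : ℝ → ℝ, ContDiffAt ℝ 6 σ v₀ ∧ ContDiffAt ℝ 6 ψ 0 ∧ σ v₀ = 0 ∧ ψ 0 = v₀ ∧
      0 < deriv σ v₀ ∧ (∀ᶠ v in 𝓝 v₀, ψ (σ v) = v) ∧ (∀ᶠ s in 𝓝 0, σ (ψ s) = s) ∧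
      ∀ᶠ s in 𝓝 0, V (ψ s) = s ^ 2 / 2 := by
  set h : ℝ → ℝ := fun x => V (v₀ + x)
  set h1 : ℝ → ℝ := fun x => Vp (v₀ + x) with h1def
  have tr : Tendsto (fun x : ℝ => v₀ + x) (𝓝 0) (𝓝 v₀) := by
    have : Continuous fun x : ℝ => v₀ + x := by fun_prop
    simpa using this.tendsto 0
  have hh : ∀ᶠ x in 𝓝 (0 : ℝ), HasDerivAt h (h1 x) x := by
    filter_upwards [tr.eventually hV] with x hx
    simpa using HasDerivAt.comp_const_add v₀ x hx
  have hh1 : ContDiffAt ℝ 8 h1 0 := by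
    refine ContDiffAt.comp (f := fun x : ℝ => v₀ + x) (0 : ℝ) ?_ (by fun_prop)
    simpa using hVp
  have hd1 : deriv h1 0 = deriv Vp v₀ := by
    have := deriv_comp_const_add Vp v₀ 0
    simpa using this
  -- Taylor's formula with integral remainder: V(v₀ + x) = x² W(x), where W is a weighted average of
  -- V'' along the segment from v₀.
  set W := avg (fun θ => θ) (fun θ => 1 - θ) 0 1 (deriv h1) with hW
  have hκ1 : ∀ θ ∈ uIcc (0 : ℝ) 1, |θ| ≤ 1 := by
    intro θ hθ
    rw [uIcc_of_le zero_le_one] at hθ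
    rw [abs_of_nonneg hθ.1]; exact hθ.2
  have hWs : ContDiffAt ℝ 6 W 0 := contDiffAt_avg (n := 6) continuous_id hκ1 (by fun_prop)
    (contDiffAt_deriv (n := 7) hh1)
  have hW0 : W 0 = deriv Vp v₀ / 2 := by
    rw [hW, avg_zero, hd1]
    have : ∫ θ in (0 : ℝ)..1, (1 - θ) = 1 / 2 := by
      rw [intervalIntegral.integral_sub (by simp) (by simp)]; norm_num
    rw [this]; ring
  have hVW : ∀ᶠ x in 𝓝 (0 : ℝ), h x = x ^ 2 * W x := by
    obtain ⟨r, hr, H⟩ := eventually_abs_lt_of_nhds (hh.and (hh1.eventually (by simp)))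
    filter_upwards [(isOpen_lt continuous_abs continuous_const).mem_nhds
      (show (0 : ℝ) ∈ {x : ℝ | |x| < r} by simpa using hr)] with x hx
    -- An antiderivative of the remainder integrand. It is 0 at t = 0, because V and V' vanish at
    -- v₀, and h x at t = 1.
    have hder : ∀ t ∈ uIcc (0 : ℝ) 1, HasDerivAt
        (fun t => (1 - t) * x * h1 (t * x) + h (t * x)) (x ^ 2 * ((1 - t) * deriv h1 (t * x))) t := by
      intro t ht
      obtain ⟨a1, a2⟩ := H _ (mul_mem_ball hκ1 ht hx)
      have m : HasDerivAt (fun t => t * x) x t := by simpa using (hasDerivAt_id t).mul_const x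
      have b1 := HasDerivAt.comp t (a2.differentiableAt (by simp)).hasDerivAt m
      have b2 := HasDerivAt.comp t a1 m
      have b3 : HasDerivAt (fun t : ℝ => (1 - t) * x) (-1 * x) t :=
        ((hasDerivAt_id t).const_sub 1).mul_const x
      refine ((b3.mul b1).add b2).congr_deriv ?_
      simp only [Function.comp]
      ring
    have hint : IntervalIntegrable (fun θ => (1 - θ) * deriv h1 (θ * x)) MeasureTheory.volume 0 1 :=
      intervalIntegrable_avg (r := r) continuous_id (by fun_prop) hκ1
        (fun x hx => (contDiffAt_deriv (n := 7) (H x hx).2).continuousAt) hx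
    have := intervalIntegral.integral_eq_sub_of_hasDerivAt hder (hint.const_mul _)
    rw [intervalIntegral.integral_const_mul] at this
    simp only [sub_self, zero_mul, one_mul, zero_add, sub_zero] at this
    have e0 : h 0 = 0 := by simp [h, hV0]
    have e1 : h1 0 = 0 := by simp [h1def, hVp0]
    rw [e0, e1] at this
    rw [hW]; unfold avg
    linarith
  have hW0pos : 0 < W 0 := by rw [hW0]; linarith
  -- The signed square root of 2V: smooth since W > 0 near 0, with slope √(2 W(0)) > 0, hence
  -- locally invertible.
  set s : ℝ → ℝ := fun x => x * √(2 * W x) with hs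
  have hs6 : ContDiffAt ℝ 6 s 0 :=
    contDiffAt_id.mul ((contDiffAt_const.mul hWs).sqrt (by positivity))
  have tr' : Tendsto (fun v : ℝ => v - v₀) (𝓝 v₀) (𝓝 0) := by
    have : Continuous fun v : ℝ => v - v₀ := by fun_prop
    simpa using this.tendsto v₀
  set σ : ℝ → ℝ := fun v => s (v - v₀) with hσ
  have hσ6 : ContDiffAt ℝ 6 σ v₀ := by
    have h0 : ContDiffAt ℝ 6 s (v₀ - v₀) := by simpa using hs6
    exact ContDiffAt.comp (f := fun v : ℝ => v - v₀) v₀ h0 (contDiffAt_id.sub contDiffAt_const)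
  have hσ0 : σ v₀ = 0 := by simp [hσ, hs]
  have hsd : HasDerivAt s (√(2 * W 0)) 0 := by
    have c : ContinuousAt (fun x => √(2 * W x)) 0 :=
      ((contDiffAt_const.mul hWs).sqrt (by positivity)).continuousAt
    rw [hasDerivAt_iff_tendsto_slope]
    refine (c.tendsto.mono_left nhdsWithin_le_nhds).congr' ?_
    filter_upwards [self_mem_nhdsWithin] with x hx
    have hx : x ≠ 0 := hx
    simp [slope, hs, hx]
  have hσd : HasDerivAt σ (√(2 * W 0)) v₀ := by
    have h0 : HasDerivAt s (√(2 * W 0)) (v₀ - v₀) := by simpa using hsd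
    exact HasDerivAt.comp_sub_const v₀ v₀ h0
  have hσpos : 0 < √(2 * W 0) := Real.sqrt_pos.2 (by positivity)
  have hVσ : ∀ᶠ v in 𝓝 v₀, V v = σ v ^ 2 / 2 := by
    filter_upwards [tr'.eventually hVW,
      tr'.eventually (hWs.continuousAt.tendsto.eventually (lt_mem_nhds hW0pos))] with v h1 h2
    simp only [h, add_sub_cancel] at h1
    simp only [hσ, hs]
    rw [h1, mul_pow, Real.sq_sqrt (by positivity)]
    ring
  have hstrict : HasStrictDerivAt σ (√(2 * W 0)) v₀ := by
    have := hσ6.hasStrictDerivAt (by simp)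
    rwa [hσd.deriv] at this
  set ψ := hstrict.localInverse σ _ v₀ hσpos.ne' with hψ
  have hfd : HasFDerivAt σ ((ContinuousLinearEquiv.unitsEquivAut ℝ
      (Units.mk0 (√(2 * W 0)) hσpos.ne') : ℝ ≃L[ℝ] ℝ) : ℝ →L[ℝ] ℝ) v₀ :=
    (hstrict.hasStrictFDerivAt_equiv hσpos.ne').hasFDerivAt
  have e1 : ∀ᶠ v in 𝓝 v₀, ψ (σ v) = v :=
    (hstrict.hasStrictFDerivAt_equiv hσpos.ne').eventually_left_inverse
  have e2 : ∀ᶠ s in 𝓝 (σ v₀), σ (ψ s) = s :=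
    (hstrict.hasStrictFDerivAt_equiv hσpos.ne').eventually_right_inverse
  have hψ6 : ContDiffAt ℝ 6 ψ (σ v₀) := hσ6.to_localInverse hfd (by simp)
  have hψ0 : ψ (σ v₀) = v₀ := e1.self_of_nhds
  rw [hσ0] at e2 hψ6 hψ0
  refine ⟨σ, ψ, hσ6, hψ6, hσ0, hψ0, by rw [hσd.deriv]; exact hσpos, e1, e2, ?_⟩
  have tψ : Tendsto ψ (𝓝 0) (𝓝 v₀) := by simpa [hψ0] using hψ6.continuousAt.tendsto
  filter_upwards [tψ.eventually hVσ, e2] with s h1 h2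
  rw [h1, h2]

/-! ### The Melnikov integral in the Morse coordinate -/

/-- The Melnikov integral in the Morse coordinate, divided by `s²`. -/
def melnikovAverage (E R ψ : ℝ → ℝ) (s : ℝ) : ℝ :=
  avg Real.sin (fun θ => Real.cos θ ^ 2) (-(Real.pi / 2)) (Real.pi / 2)
      (fun x => E (ψ x) * deriv ψ x) s
    + s ^ 2 / 2 * avg Real.sin (fun θ => Real.cos θ ^ 4) (-(Real.pi / 2)) (Real.pi / 2)
      (fun x => deriv R (ψ x) * deriv ψ x) s
    - s * avg Real.sin (fun θ => Real.sin θ * Real.cos θ ^ 2) (-(Real.pi / 2)) (Real.pi / 2)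
      (fun x => R (ψ x)) s

/-- The Melnikov function in the Morse coordinate. -/
def melnikovMorse (E R ψ : ℝ → ℝ) (s : ℝ) : ℝ := -2 * deriv ψ s * s * melnikovAverage E R ψ s

theorem abs_sin_le_one' {a b : ℝ} : ∀ θ ∈ uIcc a b, |Real.sin θ| ≤ 1 :=
  fun θ _ => Real.abs_sin_le_one θ

/-- Substitute v = ψ(s sin θ). The root becomes s cos θ, dv contributes ψ' s cos θ dθ, and V'(ψ) ψ'
= s sin θ. The terms E, R'(V(v₀) - V) and -R V' of the integrand then produce the weights cos², cos⁴
and sin cos² of `melnikovAverage`. -/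
theorem integral_morse {V Vp E R e ψ : ℝ → ℝ} {r s : ℝ} (hs : 0 < s) (hsr : s < r)
    (h1 : ∀ x, |x| < r → V (ψ x) = x ^ 2 / 2) (h2 : ∀ x, |x| < r → Vp (ψ x) * deriv ψ x = x)
    (hψ : ∀ x, |x| < r → ContDiffAt ℝ 1 ψ x) (hE : ∀ x, |x| < r → ContinuousAt E (ψ x))
    (hR : ∀ x, |x| < r → ContDiffAt ℝ 1 R (ψ x)) (hV : ∀ x, |x| < r → ContinuousAt V (ψ x))
    (he : ∀ x, |x| < r → ContinuousAt e (ψ x))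
    (heq : ∀ x, |x| < r → e (ψ x)
      = E (ψ x) + deriv R (ψ x) * (V (ψ s) - V (ψ x)) - R (ψ x) * Vp (ψ x)) :
    ∫ v in ψ (-s)..ψ s, e v * √(2 * (V (ψ s) - V v)) = s ^ 2 * melnikovAverage E R ψ s := by
  have hss : |s| < r := by rwa [abs_of_pos hs]
  have hx : ∀ θ, |Real.sin θ * s| < r := fun θ =>
    mul_mem_ball (a := θ) (b := θ) (κ := Real.sin) abs_sin_le_one' left_mem_uIcc hss
  have hψc : ∀ x, |x| < r → ContinuousAt ψ x := fun x hx => (hψ x hx).continuousAt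
  have hψ' : ∀ x, |x| < r → ContinuousAt (deriv ψ) x := fun x hx =>
    (contDiffAt_deriv (n := 0) (hψ x hx)).continuousAt
  have hR' : ∀ x, |x| < r → ContinuousAt (deriv R) (ψ x) := fun x hx =>
    (contDiffAt_deriv (n := 0) (hR x hx)).continuousAt
  have hsub := intervalIntegral.integral_comp_mul_deriv' (a := -(Real.pi / 2)) (b := Real.pi / 2)
    (f := fun θ => ψ (Real.sin θ * s)) (f' := fun θ => deriv ψ (Real.sin θ * s) * (Real.cos θ * s))
    (g := fun v => e v * √(2 * (V (ψ s) - V v)))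
    (fun θ _ => HasDerivAt.comp θ
      ((hψ _ (hx θ)).differentiableAt (by simp)).hasDerivAt ((Real.hasDerivAt_sin θ).mul_const s))
    (fun θ _ => ContinuousAt.continuousWithinAt ((ContinuousAt.comp
      (f := fun θ => Real.sin θ * s) (hψ' _ (hx θ)) (by fun_prop)).mul (by fun_prop)))
    (by
      rintro _ ⟨θ, _, rfl⟩
      refine ContinuousAt.continuousWithinAt ((he _ (hx θ)).mul ?_)
      exact ((continuousAt_const.sub (hV _ (hx θ))).const_mul 2).sqrt)
  have b1 : Real.sin (-(Real.pi / 2)) * s = -s := by simp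
  have b2 : Real.sin (Real.pi / 2) * s = s := by simp
  simp only [b1, b2] at hsub
  rw [← hsub]
  have i1 := intervalIntegrable_avg (a := -(Real.pi / 2)) (b := Real.pi / 2)
    (w := fun θ => Real.cos θ ^ 2) (h := fun x => E (ψ x) * deriv ψ x) Real.continuous_sin
    (by fun_prop) abs_sin_le_one'
    (fun x hx => (ContinuousAt.comp (f := ψ) (hE x hx) (hψc x hx)).mul (hψ' x hx)) hss
  have i2 := intervalIntegrable_avg (a := -(Real.pi / 2)) (b := Real.pi / 2)
    (w := fun θ => Real.cos θ ^ 4) (h := fun x => deriv R (ψ x) * deriv ψ x) Real.continuous_sin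
    (by fun_prop) abs_sin_le_one'
    (fun x hx => (ContinuousAt.comp (f := ψ) (hR' x hx) (hψc x hx)).mul (hψ' x hx)) hss
  have i3 := intervalIntegrable_avg (a := -(Real.pi / 2)) (b := Real.pi / 2)
    (w := fun θ => Real.sin θ * Real.cos θ ^ 2) (h := fun x => R (ψ x)) Real.continuous_sin
    (by fun_prop) abs_sin_le_one'
    (fun x hx => ContinuousAt.comp (f := ψ) (hR x hx).continuousAt (hψc x hx)) hss
  unfold melnikovAverage avg
  rw [← intervalIntegral.integral_const_mul (s ^ 2 / 2), ← intervalIntegral.integral_const_mul s,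
    ← intervalIntegral.integral_add i1 (i2.const_mul _), ← intervalIntegral.integral_sub
      (i1.add (i2.const_mul _)) (i3.const_mul _), ← intervalIntegral.integral_const_mul]
  refine intervalIntegral.integral_congr fun θ hθ => ?_
  rw [uIcc_of_le (by linarith [Real.pi_pos])] at hθ
  have hc : 0 ≤ Real.cos θ := Real.cos_nonneg_of_mem_Icc hθ
  have hx := hx θ
  have e2 := h2 _ hx
  -- Energy in the Morse coordinate; the root comes out without absolute value because cos θ ≥ 0 on
  -- the interval of integration and s > 0.
  have hsq : √(2 * (V (ψ s) - V (ψ (Real.sin θ * s)))) = Real.cos θ * s := by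
    rw [h1 s hss, h1 _ hx, show 2 * (s ^ 2 / 2 - (Real.sin θ * s) ^ 2 / 2)
      = (1 - Real.sin θ ^ 2) * s ^ 2 by ring, ← Real.cos_sq', ← mul_pow]
    exact Real.sqrt_sq (by positivity)
  simp only [Function.comp]
  rw [hsq, heq _ hx, h1 s hss, h1 _ hx]
  have hcs : Real.cos θ ^ 2 = 1 - Real.sin θ ^ 2 := Real.cos_sq' θ
  rw [show Real.cos θ ^ 4 = Real.cos θ ^ 2 * (1 - Real.sin θ ^ 2) by rw [← hcs]; ring]
  linear_combination (-R (ψ (Real.sin θ * s)) * Real.cos θ ^ 2 * s ^ 2) * e2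

/-- On [-s, 0] the map ψ increases and V ∘ ψ is x²/2, so no point strictly between ψ(-s) and ψ(0)
has the energy of ψ(s). Points below ψ(-s) cannot raise the supremum, so nothing has to be known
about V away from its minimum. -/
theorem sSup_morse {V ψ : ℝ → ℝ} {r s : ℝ} (hs : 0 < s) (hsr : s < r)
    (h1 : ∀ x, |x| < r → V (ψ x) = x ^ 2 / 2) (hψ : ∀ x, |x| < r → ContDiffAt ℝ 1 ψ x)
    (hpos : ∀ x, |x| < r → 0 < deriv ψ x) :
    sSup {w | w < ψ 0 ∧ V w = V (ψ s)} = ψ (-s) := by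
  have hab : ∀ x ∈ Icc (-s) 0, |x| < r := fun x hx =>
    abs_lt.2 ⟨by linarith [hx.1], by linarith [hx.2]⟩
  have hcont : ContinuousOn ψ (Icc (-s) 0) := fun x hx =>
    (hψ x (hab x hx)).continuousAt.continuousWithinAt
  have hmono : StrictMonoOn ψ (Icc (-s) 0) := by
    refine strictMonoOn_of_deriv_pos (convex_Icc _ _) hcont fun x hx => hpos x ?_
    rw [interior_Icc] at hx
    exact hab x (Ioo_subset_Icc_self hx)
  have hlt : ψ (-s) < ψ 0 := hmono ⟨le_rfl, by linarith⟩ ⟨by linarith, le_rfl⟩ (by linarith)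
  have hms : V (ψ s) = s ^ 2 / 2 := h1 s (by rwa [abs_of_pos hs])
  refine IsGreatest.csSup_eq ⟨⟨hlt, ?_⟩, ?_⟩
  · rw [hms, h1 (-s) (by rwa [abs_neg, abs_of_pos hs])]; ring
  · rintro w ⟨hw, hVw⟩
    by_contra! hlt'
    obtain ⟨t, ht, rfl⟩ := intermediate_value_Icc (by linarith) hcont ⟨hlt'.le, hw.le⟩
    rw [hms, h1 t (hab t ht)] at hVw
    have : (t + s) * (t - s) = 0 := by linear_combination 2 * hVw
    rcases mul_eq_zero.1 this with h | h
    · exact hlt'.ne (by rw [show t = -s by linarith])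
    · linarith [ht.2]

/-! ### Taylor coefficients of the Melnikov function -/

theorem iteratedDeriv_two_eq (f : ℝ → ℝ) (x : ℝ) : iteratedDeriv 2 f x = deriv (deriv f) x := by
  rw [iteratedDeriv_succ, iteratedDeriv_one]

theorem integral_sin_mul_cos_sq :
    ∫ θ in -(Real.pi / 2)..Real.pi / 2, Real.sin θ * Real.cos θ ^ 2 = 0 := by
  have : ∀ θ ∈ uIcc (-(Real.pi / 2)) (Real.pi / 2),
      HasDerivAt (fun θ => -(Real.cos θ ^ 3 / 3)) (Real.sin θ * Real.cos θ ^ 2) θ := by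
    intro θ _
    refine (((Real.hasDerivAt_cos θ).pow 3).div_const 3).neg.congr_deriv ?_
    norm_num; ring
  rw [intervalIntegral.integral_eq_sub_of_hasDerivAt this
    (Continuous.intervalIntegrable (by fun_prop) _ _)]
  simp

theorem integral_cos_two :
    ∫ θ in -(Real.pi / 2)..Real.pi / 2, Real.cos θ ^ 2 = Real.pi / 2 := by
  rw [integral_cos_sq]; simp

theorem integral_cos_four :
    ∫ θ in -(Real.pi / 2)..Real.pi / 2, Real.cos θ ^ 4 = 3 * Real.pi / 8 := by
  rw [show (4 : ℕ) = 2 + 2 from rfl, integral_cos_pow, integral_cos_two]; simp; ring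

theorem integral_sin_sq_cos_sq :
    ∫ θ in -(Real.pi / 2)..Real.pi / 2, Real.sin θ ^ 2 * Real.cos θ ^ 2 = Real.pi / 8 := by
  have h1 : ∀ θ, Real.sin θ ^ 2 * Real.cos θ ^ 2 = Real.cos θ ^ 2 - Real.cos θ ^ 4 := by
    intro θ; rw [Real.sin_sq]; ring
  simp only [h1]
  rw [intervalIntegral.integral_sub (Continuous.intervalIntegrable (by fun_prop) _ _)
    (Continuous.intervalIntegrable (by fun_prop) _ _), integral_cos_two, integral_cos_four]
  ring

section taylor

variable {E R ψ : ℝ → ℝ} {v₀ : ℝ}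

theorem melnikovAverage_contDiffAt (hψ : ContDiffAt ℝ 6 ψ 0) (hψ0 : ψ 0 = v₀)
    (hE : ContDiffAt ℝ 6 E v₀) (hR : ContDiffAt ℝ 7 R v₀) :
    ContDiffAt ℝ 4 (melnikovAverage E R ψ) 0 := by
  subst hψ0
  have hψ' : ContDiffAt ℝ 5 (deriv ψ) 0 := contDiffAt_deriv (n := 5) hψ
  have hR' : ContDiffAt ℝ 6 (deriv R) (ψ 0) := contDiffAt_deriv (n := 6) hR
  have hψ5 : ContDiffAt ℝ 5 ψ 0 := hψ.of_le (by norm_num)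
  have a1 := contDiffAt_avg (n := 4) (a := -(Real.pi / 2)) (b := Real.pi / 2)
    (w := fun θ => Real.cos θ ^ 2) Real.continuous_sin abs_sin_le_one' (by fun_prop)
    (ContDiffAt.mul (ContDiffAt.comp (0 : ℝ) (hE.of_le (by norm_num)) hψ5) hψ')
  have a2 := contDiffAt_avg (n := 4) (a := -(Real.pi / 2)) (b := Real.pi / 2)
    (w := fun θ => Real.cos θ ^ 4) Real.continuous_sin abs_sin_le_one' (by fun_prop)
    (ContDiffAt.mul (ContDiffAt.comp (0 : ℝ) (hR'.of_le (by norm_num)) hψ5) hψ')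
  have a3 := contDiffAt_avg (n := 4) (a := -(Real.pi / 2)) (b := Real.pi / 2)
    (w := fun θ => Real.sin θ * Real.cos θ ^ 2) Real.continuous_sin abs_sin_le_one' (by fun_prop)
    (ContDiffAt.comp (0 : ℝ) (hR.of_le (by norm_num)) hψ5)
  exact (a1.add (((contDiffAt_id.pow 2).div_const 2).mul a2)).sub (contDiffAt_id.mul a3)

theorem melnikovAverage_zero :
    melnikovAverage E R ψ 0 = Real.pi / 2 * (E (ψ 0) * deriv ψ 0) := by
  unfold melnikovAverage
  rw [avg_zero, integral_cos_two]
  ring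

/-- Integrands odd in θ integrate to zero, which removes the first order. In the second order R'
enters with 3π/8 from cos⁴ and with -2 · π/8 from sin² cos², in total π/8. -/
theorem deriv_melnikovAverage_zero (hψ : ContDiffAt ℝ 6 ψ 0) (hψ0 : ψ 0 = v₀)
    (hE : ContDiffAt ℝ 6 E v₀) (hR : ContDiffAt ℝ 7 R v₀) :
    deriv (melnikovAverage E R ψ) 0 = 0 ∧
    iteratedDeriv 2 (melnikovAverage E R ψ) 0 = Real.pi / 8 *
      (iteratedDeriv 2 (fun x => E (ψ x) * deriv ψ x) 0 + deriv R v₀ * deriv ψ 0) := by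
  subst hψ0
  have hψ' : ContDiffAt ℝ 5 (deriv ψ) 0 := contDiffAt_deriv (n := 5) hψ
  have hR' : ContDiffAt ℝ 6 (deriv R) (ψ 0) := contDiffAt_deriv (n := 6) hR
  have hψ5 : ContDiffAt ℝ 5 ψ 0 := hψ.of_le (by norm_num)
  have q1 : ContDiffAt ℝ 5 (fun x => E (ψ x) * deriv ψ x) 0 :=
    (ContDiffAt.comp (0 : ℝ) (hE.of_le (by norm_num)) hψ5).mul hψ'
  have q2 : ContDiffAt ℝ 5 (fun x => deriv R (ψ x) * deriv ψ x) 0 :=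
    (ContDiffAt.comp (0 : ℝ) (hR'.of_le (by norm_num)) hψ5).mul hψ'
  have q3 : ContDiffAt ℝ 5 (fun x => R (ψ x)) 0 :=
    ContDiffAt.comp (0 : ℝ) (hR.of_le (by norm_num)) hψ5
  set A1 := avg Real.sin (fun θ => Real.cos θ ^ 2) (-(Real.pi / 2)) (Real.pi / 2)
      (fun x => E (ψ x) * deriv ψ x) with hA1
  set A2 := avg Real.sin (fun θ => Real.cos θ ^ 4) (-(Real.pi / 2)) (Real.pi / 2)
      (fun x => deriv R (ψ x) * deriv ψ x) with hA2
  set A3 := avg Real.sin (fun θ => Real.sin θ * Real.cos θ ^ 2) (-(Real.pi / 2)) (Real.pi / 2)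
      (fun x => R (ψ x)) with hA3
  have a1 : ContDiffAt ℝ 4 A1 0 := contDiffAt_avg (n := 4) Real.continuous_sin abs_sin_le_one'
    (by fun_prop) q1
  have a2 : ContDiffAt ℝ 4 A2 0 := contDiffAt_avg (n := 4) Real.continuous_sin abs_sin_le_one'
    (by fun_prop) q2
  have a3 : ContDiffAt ℝ 4 A3 0 := contDiffAt_avg (n := 4) Real.continuous_sin abs_sin_le_one'
    (by fun_prop) q3
  have d1 := eventually_deriv_avg (a := -(Real.pi / 2)) (b := Real.pi / 2)
    (w := fun θ => Real.cos θ ^ 2) Real.continuous_sin abs_sin_le_one' (by fun_prop)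
    (q1.of_le (by norm_num))
  have d1' : deriv A1 0 = 0 := by
    rw [hA1, d1.self_of_nhds, avg_zero]
    simp only [mul_comm (Real.cos _ ^ 2), integral_sin_mul_cos_sq, mul_zero]
  have d1'' : iteratedDeriv 2 A1 0 = Real.pi / 8 *
      iteratedDeriv 2 (fun x => E (ψ x) * deriv ψ x) 0 := by
    rw [iteratedDeriv_two_eq, iteratedDeriv_two_eq, hA1, d1.deriv_eq,
      (eventually_deriv_avg Real.continuous_sin abs_sin_le_one' (by fun_prop)
        ((contDiffAt_deriv (n := 4) q1).of_le (by norm_num))).self_of_nhds, avg_zero, mul_comm]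
    congr 1
    rw [← integral_sin_sq_cos_sq]
    congr 1; funext θ; ring
  have d2 : A2 0 = 3 * Real.pi / 8 * (deriv R (ψ 0) * deriv ψ 0) := by
    rw [hA2, avg_zero, integral_cos_four]; ring
  have d3 : A3 0 = 0 := by
    rw [hA3, avg_zero, integral_sin_mul_cos_sq, mul_zero]
  have d3' : deriv A3 0 = Real.pi / 8 * (deriv R (ψ 0) * deriv ψ 0) := by
    rw [hA3, (eventually_deriv_avg Real.continuous_sin abs_sin_le_one' (by fun_prop)
      (q3.of_le (by norm_num))).self_of_nhds, avg_zero, mul_comm]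
    congr 1
    · rw [← integral_sin_sq_cos_sq]
      congr 1; funext θ; ring
    · exact ((hR.differentiableAt (by simp)).hasDerivAt.comp (0 : ℝ)
        (hψ.differentiableAt (by simp)).hasDerivAt).deriv
  have s1 : ContDiffAt ℝ 4 (fun s : ℝ => s ^ 2 / 2) 0 := by fun_prop
  have e1 : deriv (fun s : ℝ => s ^ 2 / 2) = fun s => s := by
    funext s
    simp
  have e : melnikovAverage E R ψ = fun s => A1 s + s ^ 2 / 2 * A2 s - s * A3 s := rfl
  have da1 := (a1.differentiableAt (by simp)).hasDerivAt
  have da2 := (a2.differentiableAt (by simp)).hasDerivAt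
  have da3 := (a3.differentiableAt (by simp)).hasDerivAt
  constructor
  · rw [e]
    have ds1 : HasDerivAt (fun s : ℝ => s ^ 2 / 2) 0 0 := by
      simpa [e1] using (s1.differentiableAt (by simp)).hasDerivAt
    refine ((da1.add (ds1.mul da2)).sub ((hasDerivAt_id 0).mul da3)).deriv.trans ?_
    simp [d1', d3]
  · rw [e]
    have c2 : ∀ {f : ℝ → ℝ}, ContDiffAt ℝ 4 f 0 → ContDiffAt ℝ (2 : ℕ) f 0 :=
      fun h => h.of_le (by norm_num)
    have cid : ContDiffAt ℝ 4 (fun s : ℝ => s) 0 := contDiffAt_id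
    rw [iteratedDeriv_fun_sub (c2 (a1.add (s1.mul a2))) (c2 (cid.mul a3)),
      iteratedDeriv_fun_add (c2 a1) (c2 (s1.mul a2)),
      iteratedDeriv_fun_mul (c2 s1) (c2 a2), iteratedDeriv_fun_mul (c2 cid) (c2 a3), d1'']
    simp [Finset.sum_range_succ, iteratedDeriv_two_eq, d2, d3', iteratedDeriv_fun_id]
    ring

end taylor

/-! ### Derivatives of the Melnikov function in the original coordinate v. -/

section taylor

variable {E R ψ σ Vp : ℝ → ℝ} {v₀ : ℝ}

theorem melnikovMorse_contDiffAt (hψ : ContDiffAt ℝ 6 ψ 0) (hψ0 : ψ 0 = v₀)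
    (hE : ContDiffAt ℝ 6 E v₀) (hR : ContDiffAt ℝ 7 R v₀) :
    ContDiffAt ℝ 4 (melnikovMorse E R ψ) 0 := by
  have hψ' : ContDiffAt ℝ 5 (deriv ψ) 0 := contDiffAt_deriv (n := 5) hψ
  exact ((contDiffAt_const.mul (hψ'.of_le (by norm_num))).mul contDiffAt_id).mul
    (melnikovAverage_contDiffAt hψ hψ0 hE hR)

theorem melnikovMorse_comp_contDiffAt (hψ : ContDiffAt ℝ 6 ψ 0) (hψ0 : ψ 0 = v₀)
    (hσ : ContDiffAt ℝ 6 σ v₀) (hσ0 : σ v₀ = 0)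
    (hE : ContDiffAt ℝ 6 E v₀) (hR : ContDiffAt ℝ 7 R v₀) :
    ContDiffAt ℝ 4 (fun v => melnikovMorse E R ψ (σ v)) v₀ := by
  have h : ContDiffAt ℝ 4 (melnikovMorse E R ψ) (σ v₀) := by
    rw [hσ0]
    exact melnikovMorse_contDiffAt hψ hψ0 hE hR
  exact h.comp v₀ (hσ.of_le (by norm_num))

/-- Continuity of f suffices, since the difference quotient at 0 is f itself. -/
theorem hasDerivAt_id_mul {f : ℝ → ℝ} (hf : ContinuousAt f 0) :
    HasDerivAt (fun s => s * f s) (f 0) 0 := by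
  rw [hasDerivAt_iff_tendsto_slope]
  refine (hf.tendsto.mono_left nhdsWithin_le_nhds).congr' ?_
  filter_upwards [self_mem_nhdsWithin] with x hx
  have hx : x ≠ 0 := hx
  simp [slope, hx]

theorem hasDerivAt_melnikovMorse_comp (hψ : ContDiffAt ℝ 6 ψ 0) (hψ0 : ψ 0 = v₀)
    (hσ : ContDiffAt ℝ 6 σ v₀) (hσ0 : σ v₀ = 0) (hσψ : deriv σ v₀ * deriv ψ 0 = 1)
    (hE : ContDiffAt ℝ 6 E v₀) (hR : ContDiffAt ℝ 7 R v₀) :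
    HasDerivAt (fun v => melnikovMorse E R ψ (σ v)) (-(Real.pi * (E v₀ * deriv ψ 0))) v₀ := by
  have hψ' : ContDiffAt ℝ 5 (deriv ψ) 0 := contDiffAt_deriv (n := 5) hψ
  have h1 : HasDerivAt (melnikovMorse E R ψ) (-2 * deriv ψ 0 * melnikovAverage E R ψ 0) 0 := by
    have := hasDerivAt_id_mul (f := fun s => -2 * deriv ψ s * melnikovAverage E R ψ s)
      ((continuousAt_const.mul hψ'.continuousAt).mul
        (melnikovAverage_contDiffAt hψ hψ0 hE hR).continuousAt)
    refine this.congr_of_eventuallyEq (Eventually.of_forall fun s => ?_)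
    simp only [melnikovMorse]; ring
  rw [← hσ0] at h1
  refine (HasDerivAt.comp v₀ h1 (hσ.differentiableAt (by simp)).hasDerivAt).congr_deriv ?_
  rw [hσ0, melnikovAverage_zero, hψ0]
  linear_combination (-Real.pi * E v₀ * deriv ψ 0) * hσψ

/-- The condition E(v₀) = 0 gives K(0) = K'(0) = 0, and the prefactor A(s) = -2 ψ'(s) s vanishes at
0. So the product is O(s³), and only 3 A'(0) K''(0) is left in the third derivative; the change of
variable σ adds no further terms. -/
theorem iteratedDeriv_melnikovMorse_comp (hψ : ContDiffAt ℝ 6 ψ 0) (hψ0 : ψ 0 = v₀)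
    (hσ : ContDiffAt ℝ 6 σ v₀) (hσ0 : σ v₀ = 0) (hσψ : deriv σ v₀ * deriv ψ 0 = 1)
    (hE : ContDiffAt ℝ 6 E v₀) (hR : ContDiffAt ℝ 7 R v₀) (hE0 : E v₀ = 0) :
    iteratedDeriv 2 (fun v => melnikovMorse E R ψ (σ v)) v₀ = 0 ∧
    iteratedDeriv 3 (fun v => melnikovMorse E R ψ (σ v)) v₀
      = -6 * iteratedDeriv 2 (melnikovAverage E R ψ) 0 * deriv σ v₀ ^ 2 := by
  have hψ' : ContDiffAt ℝ 5 (deriv ψ) 0 := contDiffAt_deriv (n := 5) hψ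
  set K := melnikovAverage E R ψ with hK
  have hK4 : ContDiffAt ℝ 4 K 0 := melnikovAverage_contDiffAt hψ hψ0 hE hR
  have hK0 : K 0 = 0 := by rw [hK, melnikovAverage_zero, hψ0, hE0]; ring
  have hK1 : deriv K 0 = 0 := (deriv_melnikovAverage_zero hψ hψ0 hE hR).1
  set A : ℝ → ℝ := fun s => -2 * deriv ψ s * s with hA
  have hA5 : ContDiffAt ℝ 5 A 0 := (contDiffAt_const.mul hψ').mul contDiffAt_id
  have hA0 : A 0 = 0 := by simp [hA]
  have hA1 : deriv A 0 = -2 * deriv ψ 0 := by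
    have := (hasDerivAt_id_mul (f := fun s => -2 * deriv ψ s)
      (continuousAt_const.mul hψ'.continuousAt)).deriv
    simp only [mul_comm _ (-2 * deriv ψ _)] at this
    exact this
  have hm : melnikovMorse E R ψ = fun s => A s * K s := rfl
  have m1 : deriv (melnikovMorse E R ψ) 0 = 0 := by
    rw [hm]
    refine ((hA5.differentiableAt (by simp)).hasDerivAt.mul
      (hK4.differentiableAt (by simp)).hasDerivAt).deriv.trans ?_
    rw [hA0, hK0]; ring
  have m2 : iteratedDeriv 2 (melnikovMorse E R ψ) 0 = 0 := by
    rw [hm, iteratedDeriv_fun_mul (hA5.of_le (by norm_num)) (hK4.of_le (by norm_num))]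
    simp [Finset.sum_range_succ, hA0, hK0, hK1]
  have m3 : iteratedDeriv 3 (melnikovMorse E R ψ) 0 = -6 * deriv ψ 0 * iteratedDeriv 2 K 0 := by
    rw [hm, iteratedDeriv_fun_mul (hA5.of_le (by norm_num)) (hK4.of_le (by norm_num))]
    norm_num [Finset.sum_range_succ, hA0, hK0, hK1, hA1, Nat.choose]
    exact Or.inl (by ring)
  have hm4 : ContDiffAt ℝ 4 (melnikovMorse E R ψ) (σ v₀) := by
    rw [hσ0]; exact melnikovMorse_contDiffAt hψ hψ0 hE hR
  constructor
  · have := iteratedDeriv_scomp_two (g := melnikovMorse E R ψ) (f := σ) (x := v₀)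
      (hm4.of_le (by norm_num)) (hσ.of_le (by norm_num))
    refine this.trans ?_
    rw [hσ0, m1, m2]; simp
  · have := iteratedDeriv_scomp_three (g := melnikovMorse E R ψ) (f := σ) (x := v₀)
      (hm4.of_le (by norm_num)) (hσ.of_le (by norm_num))
    refine this.trans ?_
    rw [hσ0, m1, m2, m3]
    simp only [smul_eq_mul, mul_zero, smul_zero, add_zero]
    linear_combination (-6 * iteratedDeriv 2 K 0 * deriv σ v₀ ^ 2) * hσψ

/-- The third derivative of the Melnikov function when its first derivative vanishes. -/
theorem iteratedDeriv_three_melnikovMorse_comp (hψ : ContDiffAt ℝ 6 ψ 0) (hψ0 : ψ 0 = v₀)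
    (hσ : ContDiffAt ℝ 6 σ v₀) (hσ0 : σ v₀ = 0) (hσψ : deriv σ v₀ * deriv ψ 0 = 1)
    (hE : ContDiffAt ℝ 6 E v₀) (hR : ContDiffAt ℝ 7 R v₀) (hE0 : E v₀ = 0)
    (hVp : ContDiffAt ℝ 8 Vp v₀) (hVp0 : Vp v₀ = 0)
    (hVψ : ∀ᶠ s in 𝓝 0, Vp (ψ s) * deriv ψ s = s) :
    deriv ψ 0 ^ 2 * deriv Vp v₀ = 1 ∧
    iteratedDeriv 3 (fun v => melnikovMorse E R ψ (σ v)) v₀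
      = -(3 * Real.pi / 4) * (deriv ψ 0 * deriv Vp v₀) *
        (deriv (deriv E) v₀ / deriv Vp v₀
          - deriv E v₀ * deriv (deriv Vp) v₀ / deriv Vp v₀ ^ 2 + deriv R v₀) := by
  have hψ' : ContDiffAt ℝ 5 (deriv ψ) 0 := contDiffAt_deriv (n := 5) hψ
  have hψ'' : ContDiffAt ℝ 4 (deriv (deriv ψ)) 0 := contDiffAt_deriv (n := 4) hψ'
  have hE' : ContDiffAt ℝ 5 (deriv E) v₀ := contDiffAt_deriv (n := 5) hE
  have hVp' : ContDiffAt ℝ 7 (deriv Vp) v₀ := contDiffAt_deriv (n := 7) hVp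
  have key : ∀ F : ℝ → ℝ, ContDiffAt ℝ 6 F v₀ → ∀ᶠ s in 𝓝 0,
      HasDerivAt (fun s => F (ψ s) * deriv ψ s)
        (deriv F (ψ s) * deriv ψ s * deriv ψ s + F (ψ s) * deriv (deriv ψ) s) s := by
    intro F hF
    have tψ : Tendsto ψ (𝓝 0) (𝓝 v₀) := by simpa [hψ0] using hψ.continuousAt.tendsto
    filter_upwards [tψ.eventually (hF.eventually (by simp)), hψ.eventually (by simp),
      hψ'.eventually (by simp)] with s h1 h2 h3
    exact (HasDerivAt.comp s (h1.differentiableAt (by simp)).hasDerivAt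
      (h2.differentiableAt (by simp)).hasDerivAt).mul (h3.differentiableAt (by simp)).hasDerivAt
  -- Needed for F = E, where it gives the second derivative in K''(0), and for F = Vp, where F(ψ) ψ'
  -- = s makes the left side zero.
  have key2 : ∀ F : ℝ → ℝ, ContDiffAt ℝ 6 F v₀ → F v₀ = 0 →
      iteratedDeriv 2 (fun s => F (ψ s) * deriv ψ s) 0
        = deriv (deriv F) v₀ * deriv ψ 0 ^ 3
          + 3 * deriv F v₀ * deriv ψ 0 * deriv (deriv ψ) 0 := by
    intro F hF hF0
    rw [iteratedDeriv_two_eq, Filter.EventuallyEq.deriv_eq ((key F hF).mono fun s h => h.deriv)]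
    have hF' : ContDiffAt ℝ 5 (deriv F) v₀ := contDiffAt_deriv (n := 5) hF
    have d0 := (hψ.differentiableAt (by simp)).hasDerivAt
    have d1 := (hψ'.differentiableAt (by simp)).hasDerivAt
    have d2 := (hψ''.differentiableAt (by simp)).hasDerivAt
    have c1 : HasDerivAt (fun s => F (ψ s)) (deriv F v₀ * deriv ψ 0) 0 := by
      rw [← hψ0] at hF ⊢
      exact HasDerivAt.comp (0 : ℝ) (hF.differentiableAt (by simp)).hasDerivAt d0
    have c2 : HasDerivAt (fun s => deriv F (ψ s)) (deriv (deriv F) v₀ * deriv ψ 0) 0 := by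
      rw [← hψ0] at hF' ⊢
      exact HasDerivAt.comp (0 : ℝ) (hF'.differentiableAt (by simp)).hasDerivAt d0
    refine (((c2.mul d1).mul d1).add (c1.mul d2)).deriv.trans ?_
    simp only [Pi.mul_apply, hψ0, hF0]
    ring
  -- Differentiating Vp(ψ(s)) ψ'(s) = s once and twice at 0 yields ψ'(0)² and ψ''(0) in terms of V''
  -- and V'''; the Morse coordinate thus disappears from the bracket of the final formula.
  have r1 : deriv ψ 0 ^ 2 * deriv Vp v₀ = 1 := by
    have h := (key Vp (hVp.of_le (by norm_num))).self_of_nhds.deriv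
    rw [Filter.EventuallyEq.deriv_eq hVψ, hψ0, hVp0] at h
    simp only [deriv_id''] at h
    linear_combination -h
  have r2 : deriv (deriv Vp) v₀ * deriv ψ 0 ^ 3
      + 3 * deriv Vp v₀ * deriv ψ 0 * deriv (deriv ψ) 0 = 0 := by
    rw [← key2 Vp (hVp.of_le (by norm_num)) hVp0, iteratedDeriv_two_eq]
    have e : deriv (fun s => Vp (ψ s) * deriv ψ s) =ᶠ[𝓝 0] fun _ => 1 := by
      filter_upwards [eventually_eventually_nhds.2 hVψ] with s hs
      rw [Filter.EventuallyEq.deriv_eq hs]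
      simp
    rw [e.deriv_eq]
    simp
  refine ⟨r1, ?_⟩
  rw [(iteratedDeriv_melnikovMorse_comp hψ hψ0 hσ hσ0 hσψ hE hR hE0).2,
    (deriv_melnikovAverage_zero hψ hψ0 hE hR).2, key2 E hE hE0]
  have hψne : deriv ψ 0 ≠ 0 := by
    intro h; rw [h] at hσψ; simp at hσψ
  set p := deriv ψ 0
  set p' := deriv (deriv ψ) 0
  set V2 := deriv Vp v₀
  set V3 := deriv (deriv Vp) v₀
  have hV2 : V2 = 1 / p ^ 2 := by field_simp; linear_combination r1
  have hσ2 : deriv σ v₀ = 1 / p := by field_simp; linear_combination hσψ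
  have hp' : p' = -(V3 * p ^ 4) / 3 := by
    rw [hV2] at r2
    field_simp at r2 ⊢
    linear_combination r2
  rw [hσ2, hp', hV2]
  field_simp
  ring

end taylor

/-! ### The coefficients of the Melnikov function -/

section lines

variable {F : ℝ → ℝ → ℝ → ℝ}

theorem SmoothAt₃.hasDerivAt_dx (hF : SmoothAt₃ 1 F 0) :
    HasDerivAt (fun x => F 0 x 0) (FoldFold.dx (F 0) 0 0) 0 :=
  (dx_eq_fderiv (p := 0) (SmoothAt.differentiableAt (n := 0) hF.section)).1

theorem SmoothAt₃.hasDerivAt_dy (hF : SmoothAt₃ 1 F 0) :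
    HasDerivAt (fun y => F 0 0 y) (FoldFold.dy (F 0) 0 0) 0 :=
  (dy_eq_fderiv (p := 0) (SmoothAt.differentiableAt (n := 0) hF.section)).1

theorem SmoothAt₃.hasDerivAt_param (hF : SmoothAt₃ 1 F 0) :
    HasDerivAt (fun α => F α 0 0) (deriv (fun α => F α 0 0) 0) 0 := by
  have := SmoothAt₃.hasDerivAt_curve (α := fun s => s) (u := fun _ => 0) (v := fun _ => 0)
    (t := 0) hF (hasDerivAt_id 0) (hasDerivAt_const _ _) (hasDerivAt_const _ _)
  exact this.differentiableAt.hasDerivAt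

end lines

/-! ### Standing assumptions and the coefficients of F¹ and F² at the fold-fold point. -/

namespace Unfolding

/-- The standing assumptions on the unfolding and on the transition function. -/
structure Admissible (Z : Unfolding) (φ : ℝ → ℝ) : Prop where
  transition : IsTransition φ
  smooth : Z.Smooth
  foldFold : Z.IsFoldFold
  X1_pos : 0 < Z.X1 0 0 0
  sliding : Z.X1 0 0 0 * Z.Y1 0 0 0 < 0
  detx_neg : Z.detx < 0
  versal : Z.Versal

/-- `X¹ + Y¹`. -/
def A1 (Z : Unfolding) (α x y : ℝ) : ℝ := Z.X1 α x y + Z.Y1 α x y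
/-- `X¹ - Y¹`. -/
def B1 (Z : Unfolding) (α x y : ℝ) : ℝ := Z.X1 α x y - Z.Y1 α x y
/-- `X² + Y²`. -/
def A2 (Z : Unfolding) (α x y : ℝ) : ℝ := Z.X2 α x y + Z.Y2 α x y
/-- `X² - Y²`. -/
def B2 (Z : Unfolding) (α x y : ℝ) : ℝ := Z.X2 α x y - Z.Y2 α x y

variable {Z : Unfolding} {φ : ℝ → ℝ}

namespace Admissible

theorem A1_smooth (h : Z.Admissible φ) : SmoothAt₃ 8 Z.A1 0 := h.smooth.1.add h.smooth.2.2.1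
theorem B1_smooth (h : Z.Admissible φ) : SmoothAt₃ 8 Z.B1 0 := h.smooth.1.sub h.smooth.2.2.1
theorem A2_smooth (h : Z.Admissible φ) : SmoothAt₃ 8 Z.A2 0 := h.smooth.2.1.add h.smooth.2.2.2
theorem B2_smooth (h : Z.Admissible φ) : SmoothAt₃ 8 Z.B2 0 := h.smooth.2.1.sub h.smooth.2.2.2

theorem Y1_neg (h : Z.Admissible φ) : Z.Y1 0 0 0 < 0 := by
  have := h.sliding; have := h.X1_pos
  by_contra! hc
  nlinarith

theorem B1_pos (h : Z.Admissible φ) : 0 < Z.B1 0 0 0 := by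
  have := h.Y1_neg; have := h.X1_pos
  unfold B1; linarith

theorem A2_zero (h : Z.Admissible φ) : Z.A2 0 0 0 = 0 := by
  simp [A2, h.foldFold.1.1, h.foldFold.2.1]

theorem B2_zero (h : Z.Admissible φ) : Z.B2 0 0 0 = 0 := by
  simp [B2, h.foldFold.1.1, h.foldFold.2.1]

/-- Since X¹ > 0 > Y¹, the prescribed value of φ lies strictly between -1 and 1. Intermediate values
give a preimage, so `Function.invFunOn` returns a genuine one and not its default. -/
theorem vStar_spec (h : Z.Admissible φ) : Z.vStar φ ∈ Ioo (-1 : ℝ) 1 ∧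
    Z.A1 0 0 0 + φ (Z.vStar φ) * Z.B1 0 0 0 = 0 := by
  have hY := h.Y1_neg
  have hX := h.X1_pos
  have hB : 0 < Z.X1 0 0 0 - Z.Y1 0 0 0 := h.B1_pos
  have hex : ∃ v ∈ Ioo (-1 : ℝ) 1,
      φ v = -(Z.X1 0 0 0 + Z.Y1 0 0 0) / (Z.X1 0 0 0 - Z.Y1 0 0 0) := by
    have hc : ContinuousOn φ (Icc (-1) 1) := h.transition.continuous.continuousOn
    have := intermediate_value_Ioo (by norm_num : (-1 : ℝ) ≤ 1) hc
    rw [h.transition.eq_one 1 le_rfl, h.transition.eq_neg_one (-1) le_rfl] at this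
    refine this ⟨?_, ?_⟩
    · rw [lt_div_iff₀ hB]; linarith
    · rw [div_lt_iff₀ hB]; linarith
  have h1 := Function.invFunOn_mem hex
  have h2 := Function.invFunOn_eq hex
  refine ⟨h1, ?_⟩
  unfold vStar A1 B1
  rw [h2]
  field_simp
  ring

theorem phi_smooth (h : Z.Admissible φ) : ContDiffAt ℝ 8 φ (Z.vStar φ) :=
  h.transition.smooth.contDiffAt (isOpen_Ioo.mem_nhds h.vStar_spec.1)

theorem deriv_phi_pos (h : Z.Admissible φ) : 0 < deriv φ (Z.vStar φ) :=
  h.transition.deriv_pos _ h.vStar_spec.1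

end Admissible

theorem f1_eq : Z.f1 φ = fun v => Z.A1 0 0 0 + φ v * Z.B1 0 0 0 := by
  funext v
  simp [f1, F1, A1, B1]

theorem Admissible.f1x_eq (h : Z.Admissible φ) :
    Z.f1x φ = fun v => dx (Z.A1 0) 0 0 + φ v * dx (Z.B1 0) 0 0 := by
  funext v
  have := ((h.A1_smooth.of_le (m := 1) (by norm_num)).hasDerivAt_dx.add
    ((h.B1_smooth.of_le (m := 1) (by norm_num)).hasDerivAt_dx.const_mul (φ v))).deriv
  unfold f1x F1
  simp only [zero_mul]
  exact this

theorem Admissible.f2x_eq (h : Z.Admissible φ) :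
    Z.f2x φ = fun v => dx (Z.A2 0) 0 0 + φ v * dx (Z.B2 0) 0 0 := by
  funext v
  have := ((h.A2_smooth.of_le (m := 1) (by norm_num)).hasDerivAt_dx.add
    ((h.B2_smooth.of_le (m := 1) (by norm_num)).hasDerivAt_dx.const_mul (φ v))).deriv
  unfold f2x F2
  simp only [zero_mul]
  exact this

theorem contDiffAt_line {F : ℝ → ℝ → ℝ → ℝ} {n : ℕ} (hF : SmoothAt₃ n F 0) :
    ContDiffAt ℝ n (fun x => F 0 x 0) 0 :=
  ContDiffAt.comp (g := fun q : ℝ × ℝ × ℝ => F q.1 q.2.1 q.2.2)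
    (f := fun x : ℝ => ((0 : ℝ), x, (0 : ℝ))) (0 : ℝ) hF (by fun_prop)

theorem Admissible.f2xx_eq (h : Z.Admissible φ) :
    Z.f2xx φ = fun v => dx (dx (Z.A2 0)) 0 0 + φ v * dx (dx (Z.B2 0)) 0 0 := by
  funext v
  have e : Z.f2xx φ v = iteratedDeriv 2 (fun x => Z.A2 0 x 0 + φ v * Z.B2 0 x 0) 0 := by
    unfold f2xx F2
    simp only [zero_mul]
    rfl
  have sA := contDiffAt_line (h.A2_smooth.of_le (m := 2) (by norm_num))
  have sB := contDiffAt_line (h.B2_smooth.of_le (m := 2) (by norm_num))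
  rw [e, iteratedDeriv_fun_add sA (contDiffAt_const.mul sB), iteratedDeriv_const_mul_field,
    iteratedDeriv_two_eq, iteratedDeriv_two_eq]
  rfl

theorem hasDerivAt_scaled_line {F : ℝ → ℝ → ℝ → ℝ} (hF : SmoothAt₃ 1 F 0) (v : ℝ) :
    HasDerivAt (fun ε => F 0 0 (ε * v)) (dy (F 0) 0 0 * v) 0 := by
  have h0 : HasDerivAt (fun y => F 0 0 y) (dy (F 0) 0 0) (0 * v) := by
    simpa using hF.hasDerivAt_dy
  have := HasDerivAt.comp (0 : ℝ) h0 ((hasDerivAt_id (0 : ℝ)).mul_const v)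
  simpa using! this

theorem Admissible.f2eps_eq (h : Z.Admissible φ) :
    Z.f2eps φ = fun v => v * (dy (Z.A2 0) 0 0 + φ v * dy (Z.B2 0) 0 0) := by
  funext v
  refine ((hasDerivAt_scaled_line (h.A2_smooth.of_le (m := 1) (by norm_num)) v).add
    ((hasDerivAt_scaled_line (h.B2_smooth.of_le (m := 1) (by norm_num)) v).const_mul
      (φ v))).deriv.trans ?_
  ring

theorem Admissible.f2tilde_eq (h : Z.Admissible φ) :
    Z.f2tilde φ = fun v => deriv (fun α => Z.A2 α 0 0) 0
      + φ v * deriv (fun α => Z.B2 α 0 0) 0 := by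
  funext v
  have := ((h.A2_smooth.of_le (m := 1) (by norm_num)).hasDerivAt_param.add
    ((h.B2_smooth.of_le (m := 1) (by norm_num)).hasDerivAt_param.const_mul (φ v))).deriv
  unfold f2tilde F2
  simp only [zero_mul]
  exact this

/-! ### Relations between the constants -/

theorem Admissible.smooth_components (h : Z.Admissible φ) : SmoothAt₃ 1 Z.X1 0 ∧
    SmoothAt₃ 1 Z.X2 0 ∧ SmoothAt₃ 1 Z.Y1 0 ∧ SmoothAt₃ 1 Z.Y2 0 :=
  ⟨ContDiffAt.of_le h.smooth.1 (by norm_num), ContDiffAt.of_le h.smooth.2.1 (by norm_num),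
    ContDiffAt.of_le h.smooth.2.2.1 (by norm_num), ContDiffAt.of_le h.smooth.2.2.2 (by norm_num)⟩

theorem Admissible.partials (h : Z.Admissible φ) :
    dx (Z.A1 0) 0 0 = dx (Z.X1 0) 0 0 + dx (Z.Y1 0) 0 0 ∧
    dx (Z.B1 0) 0 0 = dx (Z.X1 0) 0 0 - dx (Z.Y1 0) 0 0 ∧
    dx (Z.A2 0) 0 0 = Z.X2x + Z.Y2x ∧ dx (Z.B2 0) 0 0 = Z.X2x - Z.Y2x ∧
    dy (Z.A2 0) 0 0 = dy (Z.X2 0) 0 0 + dy (Z.Y2 0) 0 0 ∧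
    dy (Z.B2 0) 0 0 = dy (Z.X2 0) 0 0 - dy (Z.Y2 0) 0 0 ∧
    deriv (fun α => Z.A2 α 0 0) 0 = Z.X2tilde + Z.Y2tilde ∧
    deriv (fun α => Z.B2 α 0 0) 0 = Z.X2tilde - Z.Y2tilde := by
  obtain ⟨s1, s2, s3, s4⟩ := h.smooth_components
  exact ⟨(s1.hasDerivAt_dx.add s3.hasDerivAt_dx).deriv,
    (s1.hasDerivAt_dx.sub s3.hasDerivAt_dx).deriv,
    (s2.hasDerivAt_dx.add s4.hasDerivAt_dx).deriv, (s2.hasDerivAt_dx.sub s4.hasDerivAt_dx).deriv,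
    (s2.hasDerivAt_dy.add s4.hasDerivAt_dy).deriv, (s2.hasDerivAt_dy.sub s4.hasDerivAt_dy).deriv,
    (s2.hasDerivAt_param.add s4.hasDerivAt_param).deriv,
    (s2.hasDerivAt_param.sub s4.hasDerivAt_param).deriv⟩

theorem Admissible.det_partials (h : Z.Admissible φ) :
    Z.detx = Z.X1 0 0 0 * Z.Y2x - Z.X2x * Z.Y1 0 0 0 ∧
    Z.dety = Z.X1 0 0 0 * dy (Z.Y2 0) 0 0 - dy (Z.X2 0) 0 0 * Z.Y1 0 0 0 := by
  obtain ⟨s1, s2, s3, s4⟩ := h.smooth_components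
  constructor
  · refine ((s1.hasDerivAt_dx.mul s4.hasDerivAt_dx).sub
      (s2.hasDerivAt_dx.mul s3.hasDerivAt_dx)).deriv.trans ?_
    rw [h.foldFold.1.1, h.foldFold.2.1]
    unfold X2x Y2x; ring
  · refine ((s1.hasDerivAt_dy.mul s4.hasDerivAt_dy).sub
      (s2.hasDerivAt_dy.mul s3.hasDerivAt_dy)).deriv.trans ?_
    rw [h.foldFold.1.1, h.foldFold.2.1]
    ring

/-- `F²_x` at the critical point. -/
theorem Admissible.f2x_vStar (h : Z.Admissible φ) :
    Z.f2x φ (Z.vStar φ) * Z.B1 0 0 0 = 2 * Z.detx := by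
  have e := h.vStar_spec.2
  obtain ⟨_, _, p3, p4, _⟩ := h.partials
  rw [h.f2x_eq, p3, p4, h.det_partials.1]
  unfold A1 B1 at *
  linear_combination (Z.X2x - Z.Y2x) * e

theorem Admissible.f2x_vStar_neg (h : Z.Admissible φ) : Z.f2x φ (Z.vStar φ) < 0 := by
  have e := h.f2x_vStar
  have := h.B1_pos
  have := h.detx_neg
  by_contra! hc
  nlinarith

theorem Admissible.tilde_ne (h : Z.Admissible φ) :
    Z.Y2x * Z.X2tilde - Z.X2x * Z.Y2tilde ≠ 0 := by
  have hv := h.versal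
  have h1 : Z.X2x ≠ 0 := left_ne_zero_of_mul h.foldFold.1.2
  have h2 : Z.Y2x ≠ 0 := left_ne_zero_of_mul h.foldFold.2.2
  intro h0
  unfold Versal at hv
  have : Z.Y2tilde / Z.Y2x - Z.X2tilde / Z.X2x = 0 := by
    field_simp
    linear_combination -h0
  exact hv.ne' this

theorem Admissible.traceN_ne (h : Z.Admissible φ) : Z.traceN φ ≠ 0 := by
  unfold traceN
  exact mul_ne_zero (mul_ne_zero (mul_ne_zero (one_div_ne_zero h.detx_neg.ne)
    h.deriv_phi_pos.ne') h.B1_pos.ne') h.tilde_ne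

/-- The last factor equals X²_x Y²_x times the positive versality quantity, so the sign is that of
X²_x Y²_x, which the visibilities determine because X¹ > 0 > Y¹. -/
theorem Admissible.mixed_sign (h : Z.Admissible φ)
    (hV : 0 < iteratedDeriv 2 (Z.V φ) (Z.vStar φ)) :
    (Z.InvisibleInvisible → 0 < Z.mixedValue φ) ∧ (Z.VisibleInvisible → Z.mixedValue φ < 0) := by
  have hpos : 0 < Real.pi * deriv φ (Z.vStar φ) * (Z.X1 0 0 0 - Z.Y1 0 0 0) ^ 2
      / (2 * Z.detx ^ 2 * √(iteratedDeriv 2 (Z.V φ) (Z.vStar φ))) := by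
    have h1 : 0 < (Z.X1 0 0 0 - Z.Y1 0 0 0) ^ 2 := pow_pos h.B1_pos 2
    have h2 : 0 < Z.detx ^ 2 := by have := h.detx_neg.ne; positivity
    have := h.deriv_phi_pos
    have := Real.sqrt_pos.2 hV
    have := Real.pi_pos
    positivity
  have hX := h.X1_pos
  have hY := h.Y1_neg
  have hv := h.versal
  have hx1 : Z.X2x ≠ 0 := left_ne_zero_of_mul h.foldFold.1.2
  have hy1 : Z.Y2x ≠ 0 := left_ne_zero_of_mul h.foldFold.2.2
  have e : Z.X2x * Z.Y2tilde - Z.Y2x * Z.X2tilde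
      = (Z.X2x * Z.Y2x) * (Z.Y2tilde / Z.Y2x - Z.X2tilde / Z.X2x) := by
    field_simp
  unfold mixedValue
  rw [e]
  constructor
  · rintro ⟨i1, i2⟩
    have j1 : Z.X2x < 0 := by by_contra! hc; nlinarith
    have j2 : Z.Y2x < 0 := by by_contra! hc; nlinarith
    exact mul_pos hpos (mul_pos (mul_pos_of_neg_of_neg j1 j2) hv)
  · intro hvi
    refine mul_neg_of_pos_of_neg hpos (mul_neg_of_neg_of_pos ?_ hv)
    rcases hvi with ⟨i1, i2⟩ | ⟨i1, i2⟩
    · have j1 : 0 < Z.X2x := by by_contra! hc; nlinarith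
      have j2 : Z.Y2x < 0 := by by_contra! hc; nlinarith
      exact mul_neg_of_pos_of_neg j1 j2
    · have j1 : Z.X2x < 0 := by by_contra! hc; nlinarith
      have j2 : 0 < Z.Y2x := by by_contra! hc; nlinarith
      exact mul_neg_of_neg_of_pos j1 j2

end Unfolding

namespace Unfolding

variable {Z : Unfolding} {φ : ℝ → ℝ}

/-! ### The Melnikov function of an unfolding -/

/-- The derivative `-F¹ / F²_x` of the potential. -/
def Vp (Z : Unfolding) (φ : ℝ → ℝ) (v : ℝ) : ℝ := -(Z.f1 φ v / Z.f2x φ v)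

/-- `F²_xx / F²_x`. -/
def melR (Z : Unfolding) (φ : ℝ → ℝ) (v : ℝ) : ℝ := Z.f2xx φ v / Z.f2x φ v

/-- `F²_ε / F²_x`. -/
def melC (Z : Unfolding) (φ : ℝ → ℝ) (v : ℝ) : ℝ := Z.f2eps φ v / Z.f2x φ v

/-- `F²_α / F²_x`. -/
def melD (Z : Unfolding) (φ : ℝ → ℝ) (v : ℝ) : ℝ := Z.f2tilde φ v / Z.f2x φ v

/-- The part of the integrand that depends on neither `v₀` nor `δ`. -/
def melE (Z : Unfolding) (φ : ℝ → ℝ) (v : ℝ) : ℝ :=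
  Z.f1x φ v / Z.f2x φ v + deriv (Z.melC φ) v

theorem Admissible.contDiffAt_affine (h : Z.Admissible φ) (a b : ℝ) :
    ContDiffAt ℝ 8 (fun v => a + φ v * b) (Z.vStar φ) :=
  contDiffAt_const.add (h.phi_smooth.mul contDiffAt_const)

theorem Admissible.f2x_smooth (h : Z.Admissible φ) : ContDiffAt ℝ 8 (Z.f2x φ) (Z.vStar φ) := by
  rw [h.f2x_eq]; exact h.contDiffAt_affine _ _

theorem Admissible.Vp_smooth (h : Z.Admissible φ) : ContDiffAt ℝ 8 (Z.Vp φ) (Z.vStar φ) := by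
  refine ContDiffAt.neg (ContDiffAt.div ?_ h.f2x_smooth h.f2x_vStar_neg.ne)
  rw [f1_eq]; exact h.contDiffAt_affine _ _

theorem Admissible.melR_smooth (h : Z.Admissible φ) : ContDiffAt ℝ 8 (Z.melR φ) (Z.vStar φ) := by
  refine ContDiffAt.div ?_ h.f2x_smooth h.f2x_vStar_neg.ne
  rw [h.f2xx_eq]; exact h.contDiffAt_affine _ _

theorem Admissible.melC_smooth (h : Z.Admissible φ) : ContDiffAt ℝ 8 (Z.melC φ) (Z.vStar φ) := by
  refine ContDiffAt.div ?_ h.f2x_smooth h.f2x_vStar_neg.ne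
  rw [h.f2eps_eq]; exact contDiffAt_id.mul (h.contDiffAt_affine _ _)

theorem Admissible.melD_smooth (h : Z.Admissible φ) : ContDiffAt ℝ 8 (Z.melD φ) (Z.vStar φ) := by
  refine ContDiffAt.div ?_ h.f2x_smooth h.f2x_vStar_neg.ne
  rw [h.f2tilde_eq]; exact h.contDiffAt_affine _ _

theorem Admissible.melE_smooth (h : Z.Admissible φ) : ContDiffAt ℝ 7 (Z.melE φ) (Z.vStar φ) := by
  refine ContDiffAt.add (ContDiffAt.div ?_ (h.f2x_smooth.of_le (by norm_num)) h.f2x_vStar_neg.ne)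
    (contDiffAt_deriv (n := 7) h.melC_smooth)
  rw [h.f1x_eq]; exact (h.contDiffAt_affine _ _).of_le (by norm_num)

theorem Admissible.melE_add_smooth (h : Z.Admissible φ) (δ : ℝ) :
    ContDiffAt ℝ 6 (fun v => Z.melE φ v + δ * deriv (Z.melD φ) v) (Z.vStar φ) :=
  (h.melE_smooth.of_le (by norm_num)).add (contDiffAt_const.mul
    ((contDiffAt_deriv (n := 7) h.melD_smooth).of_le (by norm_num)))

theorem Admissible.hasDerivAt_affine (h : Z.Admissible φ) (a b : ℝ) :
    HasDerivAt (fun v => a + φ v * b) (deriv φ (Z.vStar φ) * b) (Z.vStar φ) :=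
  ((h.phi_smooth.differentiableAt (by simp)).hasDerivAt.mul_const b).const_add a

theorem Admissible.Vp_vStar (h : Z.Admissible φ) : Z.Vp φ (Z.vStar φ) = 0 := by
  unfold Vp
  rw [f1_eq]
  simp [h.vStar_spec.2]

theorem Admissible.deriv_Vp (h : Z.Admissible φ) :
    deriv (Z.Vp φ) (Z.vStar φ)
      = -(deriv φ (Z.vStar φ) * Z.B1 0 0 0 / Z.f2x φ (Z.vStar φ)) := by
  have h1 : HasDerivAt (Z.f1 φ) (deriv φ (Z.vStar φ) * Z.B1 0 0 0) (Z.vStar φ) := by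
    rw [f1_eq]; exact h.hasDerivAt_affine _ _
  have h0 : Z.f1 φ (Z.vStar φ) = 0 := by rw [f1_eq]; exact h.vStar_spec.2
  have h2 := (h.f2x_smooth.differentiableAt (by simp)).hasDerivAt
  have hne := h.f2x_vStar_neg.ne
  refine ((h1.div h2 hne).neg).deriv.trans ?_
  rw [h0]
  field_simp
  ring

theorem Admissible.deriv_Vp_pos (h : Z.Admissible φ) : 0 < deriv (Z.Vp φ) (Z.vStar φ) := by
  rw [h.deriv_Vp, ← div_neg]
  exact div_pos (mul_pos h.deriv_phi_pos h.B1_pos) (neg_pos.2 h.f2x_vStar_neg)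

theorem Admissible.hasDerivAt_V (h : Z.Admissible φ) :
    ∀ᶠ v in 𝓝 (Z.vStar φ), HasDerivAt (Z.V φ) (Z.Vp φ v) v := by
  set g : ℝ → ℝ := fun r => Z.f1 φ r / Z.f2x φ r with hg
  have hgs : ContDiffAt ℝ 8 g (Z.vStar φ) := by
    refine ContDiffAt.div ?_ h.f2x_smooth h.f2x_vStar_neg.ne
    rw [f1_eq]; exact h.contDiffAt_affine _ _
  obtain ⟨ρ, hρ, H⟩ := Metric.eventually_nhds_iff_ball.1 (hgs.eventually (by simp))
  filter_upwards [Metric.ball_mem_nhds _ hρ] with v hv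
  have hc : ∀ x ∈ Metric.ball (Z.vStar φ) ρ, ContinuousAt g x := fun x hx => (H x hx).continuousAt
  have hsub : uIcc (Z.vStar φ) v ⊆ Metric.ball (Z.vStar φ) ρ :=
    (convex_ball _ _).ordConnected.uIcc_subset (Metric.mem_ball_self hρ) hv
  have hint : IntervalIntegrable g MeasureTheory.volume (Z.vStar φ) v :=
    ContinuousOn.intervalIntegrable fun x hx => (hc x (hsub hx)).continuousWithinAt
  exact (intervalIntegral.integral_hasDerivAt_right hint
    (ContinuousAt.stronglyMeasurableAtFilter Metric.isOpen_ball hc v hv) (hc v hv)).neg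

theorem V_vStar : Z.V φ (Z.vStar φ) = 0 := by simp [V]

theorem Admissible.iteratedDeriv_two_V (h : Z.Admissible φ) :
    iteratedDeriv 2 (Z.V φ) (Z.vStar φ) = deriv (Z.Vp φ) (Z.vStar φ) := by
  rw [iteratedDeriv_two_eq, Filter.EventuallyEq.deriv_eq (h.hasDerivAt_V.mono fun v hv => hv.deriv)]

/-- The product rule, with V(v₀) a constant for the differentiation: the term R (V(v₀) - V) yields
R' (V(v₀) - V) - R V'. This is the shape of integrand that `integral_morse` accepts. -/
theorem Admissible.fMel_eq (h : Z.Admissible φ) :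
    ∀ᶠ v in 𝓝 (Z.vStar φ), ∀ v₀ δ, Z.fMel φ v v₀ δ = Z.melE φ v + δ * deriv (Z.melD φ) v
      + deriv (Z.melR φ) v * (Z.V φ v₀ - Z.V φ v) - Z.melR φ v * Z.Vp φ v := by
  filter_upwards [h.hasDerivAt_V, h.melR_smooth.eventually (by simp),
    h.melC_smooth.eventually (by simp), h.melD_smooth.eventually (by simp)] with v hV hR hC hD v₀ δ
  have e : (fun w => 1 / Z.f2x φ w *
      (Z.f2xx φ w * (Z.V φ v₀ - Z.V φ w) + Z.f2eps φ w + δ * Z.f2tilde φ w))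
      = fun w => Z.melR φ w * (Z.V φ v₀ - Z.V φ w) + Z.melC φ w + δ * Z.melD φ w := by
    funext w
    simp only [melR, melC, melD]
    ring
  have d : deriv (fun w => Z.melR φ w * (Z.V φ v₀ - Z.V φ w) + Z.melC φ w + δ * Z.melD φ w) v
      = _ := ((((hR.differentiableAt (by simp)).hasDerivAt.mul (hV.const_sub (Z.V φ v₀))).add
      (hC.differentiableAt (by simp)).hasDerivAt).add
      ((hD.differentiableAt (by simp)).hasDerivAt.const_mul δ)).deriv
  unfold fMel melE
  rw [e, d]
  ring

/-- The parameter δ enters only through the E-term, which is linear. The R-terms are counted in the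
part independent of δ, whence R = 0 in the slope. -/
theorem melnikovMorse_add_mul {E D R ψ : ℝ → ℝ} {r : ℝ} (hψ : ∀ x, |x| < r → ContDiffAt ℝ 1 ψ x)
    (hE : ∀ x, |x| < r → ContinuousAt E (ψ x)) (hD : ∀ x, |x| < r → ContinuousAt D (ψ x))
    {s : ℝ} (hs : |s| < r) (δ : ℝ) :
    melnikovMorse (fun v => E v + δ * D v) R ψ s
      = melnikovMorse E R ψ s + δ * melnikovMorse D (fun _ => 0) ψ s := by
  have hψ' : ∀ x, |x| < r → ContinuousAt (deriv ψ) x := fun x hx =>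
    (contDiffAt_deriv (n := 0) (hψ x hx)).continuousAt
  have := avg_add_mul (a := -(Real.pi / 2)) (b := Real.pi / 2) (w := fun θ => Real.cos θ ^ 2)
    (h := fun x => E (ψ x) * deriv ψ x) (k := fun x => D (ψ x) * deriv ψ x)
    Real.continuous_sin (by fun_prop) abs_sin_le_one'
    (fun x hx => (ContinuousAt.comp (f := ψ) (hE x hx) (hψ x hx).continuousAt).mul (hψ' x hx))
    (fun x hx => (ContinuousAt.comp (f := ψ) (hD x hx) (hψ x hx).continuousAt).mul (hψ' x hx))
    hs δ
  unfold melnikovMorse melnikovAverage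
  have e : (fun x => (E (ψ x) + δ * D (ψ x)) * deriv ψ x)
      = fun x => E (ψ x) * deriv ψ x + δ * (D (ψ x) * deriv ψ x) := by
    funext x; ring
  rw [e, this]
  simp [avg]
  ring

/-- The Melnikov function in the Morse coordinate of the potential. -/
theorem Admissible.exists_coordinate (h : Z.Admissible φ) :
    ∃ σ ψ : ℝ → ℝ, ContDiffAt ℝ 6 σ (Z.vStar φ) ∧ ContDiffAt ℝ 6 ψ 0 ∧ σ (Z.vStar φ) = 0 ∧
      ψ 0 = Z.vStar φ ∧ deriv σ (Z.vStar φ) * deriv ψ 0 = 1 ∧ 0 < deriv ψ 0 ∧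
      (∀ᶠ s in 𝓝 0, Z.Vp φ (ψ s) * deriv ψ s = s) ∧
      ∀ᶠ v in 𝓝[≥] (Z.vStar φ), ∀ δ,
        Z.melnikov φ v δ
          = melnikovMorse (fun v => Z.melE φ v + δ * deriv (Z.melD φ) v) (Z.melR φ) ψ (σ v) ∧
        Z.melnikov φ v δ = melnikovMorse (Z.melE φ) (Z.melR φ) ψ (σ v)
          + δ * melnikovMorse (deriv (Z.melD φ)) (fun _ => 0) ψ (σ v) := by
  obtain ⟨σ, ψ, hσ, hψ, hσ0, hψ0, hσpos, hψσ, hσψ, hVψ⟩ := exists_morse_coordinate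
    (V := Z.V φ) (Vp := Z.Vp φ) V_vStar h.Vp_vStar h.hasDerivAt_V h.Vp_smooth h.deriv_Vp_pos
  have tψ : Tendsto ψ (𝓝 0) (𝓝 (Z.vStar φ)) := by simpa [hψ0] using hψ.continuousAt.tendsto
  have hprod : deriv σ (Z.vStar φ) * deriv ψ 0 = 1 := by
    have d1 : HasDerivAt σ (deriv σ (Z.vStar φ)) (ψ 0) := by
      rw [hψ0]; exact (hσ.differentiableAt (by simp)).hasDerivAt
    have := (HasDerivAt.comp (0 : ℝ) d1 (hψ.differentiableAt (by simp)).hasDerivAt).deriv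
    exact this.symm.trans ((Filter.EventuallyEq.deriv_eq (f₁ := σ ∘ ψ) (f := fun s => s) hσψ).trans
      (by simp))
  have hψpos : 0 < deriv ψ 0 := by
    by_contra! hc
    nlinarith
  have hVψ' : ∀ᶠ s in 𝓝 0, Z.Vp φ (ψ s) * deriv ψ s = s := by
    filter_upwards [eventually_eventually_nhds.2 hVψ, tψ.eventually h.hasDerivAt_V,
      hψ.eventually (by simp)] with s h1 h2 h3
    have := (HasDerivAt.comp s h2 (h3.differentiableAt (by simp)).hasDerivAt).deriv
    exact this.symm.trans ((Filter.EventuallyEq.deriv_eq (f₁ := Z.V φ ∘ ψ)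
      (f := fun s => s ^ 2 / 2) h1).trans (by simp))
  refine ⟨σ, ψ, hσ, hψ, hσ0, hψ0, hprod, hψpos, hVψ', ?_⟩
  have hψ'pos : ∀ᶠ s in 𝓝 0, 0 < deriv ψ s :=
    (contDiffAt_deriv (n := 5) hψ).continuousAt.tendsto.eventually (lt_mem_nhds hψpos)
  -- One radius on which all the local properties hold; all points ψ(s sin θ) with |s| < r are then
  -- covered.
  obtain ⟨r, hr, H⟩ := eventually_abs_lt_of_nhds
    ((hVψ.and (hVψ'.and (hψ'pos.and (hψ.eventually (by simp))))).and
      (tψ.eventually ((h.melR_smooth.eventually (by simp)).and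
        ((h.melE_smooth.eventually (by simp)).and ((h.melD_smooth.eventually (by simp)).and
        ((h.Vp_smooth.eventually (by simp)).and (h.hasDerivAt_V.and
          (eventually_eventually_nhds.2 h.fMel_eq))))))))
  have hψ1 : ∀ x, |x| < r → ContDiffAt ℝ 1 ψ x := fun x hx =>
    (H x hx).1.2.2.2.of_le (by norm_num)
  have hEc : ∀ x, |x| < r → ContinuousAt (Z.melE φ) (ψ x) := fun x hx =>
    (H x hx).2.2.1.continuousAt
  have hDc : ∀ x, |x| < r → ContinuousAt (deriv (Z.melD φ)) (ψ x) := fun x hx =>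
    (contDiffAt_deriv (n := 7) (H x hx).2.2.2.1).continuousAt
  have hVc : ∀ x, |x| < r → ContinuousAt (Z.V φ) (ψ x) := fun x hx =>
    (H x hx).2.2.2.2.2.1.continuousAt
  have formula : ∀ s, 0 < s → s < r → ∀ δ, Z.melnikovFormula φ (ψ s) δ
      = melnikovMorse (fun v => Z.melE φ v + δ * deriv (Z.melD φ) v) (Z.melR φ) ψ s := by
    intro s hs hsr δ
    have hss : |s| < r := by rwa [abs_of_pos hs]
    have hbar : Z.vBar φ (ψ s) = ψ (-s) := by
      unfold vBar
      rw [← hψ0]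
      exact sSup_morse hs hsr (fun x hx => (H x hx).1.1) hψ1 (fun x hx => (H x hx).1.2.2.1)
    have hI := integral_morse (V := Z.V φ) (Vp := Z.Vp φ) (R := Z.melR φ)
      (E := fun v => Z.melE φ v + δ * deriv (Z.melD φ) v) (e := fun v => Z.fMel φ v (ψ s) δ) hs hsr
      (fun x hx => (H x hx).1.1) (fun x hx => (H x hx).1.2.1) hψ1
      (fun x hx => (hEc x hx).add (continuousAt_const.mul (hDc x hx)))
      (fun x hx => (H x hx).2.1.of_le (by norm_num)) hVc
      (fun x hx => by
        refine ContinuousAt.congr ?_ ((H x hx).2.2.2.2.2.2.mono fun v hv => (hv (ψ s) δ).symm)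
        have hR' : ContinuousAt (deriv (Z.melR φ)) (ψ x) :=
          (contDiffAt_deriv (n := 7) (H x hx).2.1).continuousAt
        exact (((hEc x hx).add (continuousAt_const.mul (hDc x hx))).add
          (hR'.mul (continuousAt_const.sub (hVc x hx)))).sub
          ((H x hx).2.1.continuousAt.mul (H x hx).2.2.2.2.1.continuousAt))
      (fun x hx => (H x hx).2.2.2.2.2.2.self_of_nhds (ψ s) δ)
    unfold melnikovFormula
    rw [hbar, hI, (H s hss).2.2.2.2.2.1.deriv]
    have e1 := (H s hss).1.2.1
    have e2 := (H s hss).1.2.2.1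
    -- The relation V'(ψ) ψ' = s shows that V' has no zero off the minimum, so the division in the
    -- formula is legitimate.
    have hne : Z.Vp φ (ψ s) ≠ 0 := by
      intro h0
      rw [h0, zero_mul] at e1
      exact hs.ne e1
    unfold melnikovMorse
    field_simp
    linear_combination (melnikovAverage (fun v => Z.melE φ v + δ * deriv (Z.melD φ) v)
      (Z.melR φ) ψ s) * e1
  have tσ : Tendsto σ (𝓝 (Z.vStar φ)) (𝓝 0) := by simpa [hσ0] using hσ.continuousAt.tendsto
  -- The formula in the Morse coordinate was obtained for s > 0; σ(v*) = 0 and σ'(v*) > 0 give s > 0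
  -- for v > v*.
  have hσgt : ∀ᶠ v in 𝓝[>] (Z.vStar φ), 0 < σ v := by
    have hd := (hσ.differentiableAt (by simp)).hasDerivAt
    have := (hasDerivAt_iff_tendsto_slope.1 hd).eventually (lt_mem_nhds hσpos)
    filter_upwards [this.filter_mono (nhdsWithin_mono _ fun v hv => ne_of_gt hv),
      self_mem_nhdsWithin] with v h1 h2
    have h2 : Z.vStar φ < v := h2
    rw [slope_def_field, hσ0, sub_zero] at h1
    exact (div_pos_iff_of_pos_right (by linarith)).1 h1
  have hσr : ∀ᶠ v in 𝓝 (Z.vStar φ), |σ v| < r :=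
    tσ.eventually ((isOpen_lt continuous_abs continuous_const).mem_nhds
      (show (0 : ℝ) ∈ {x : ℝ | |x| < r} by simpa using hr))
  have hgt : ∀ᶠ v in 𝓝[>] (Z.vStar φ), ∀ δ, Z.melnikovFormula φ v δ
      = melnikovMorse (fun v => Z.melE φ v + δ * deriv (Z.melD φ) v) (Z.melR φ) ψ (σ v) := by
    filter_upwards [hσgt, hσr.filter_mono nhdsWithin_le_nhds,
      hψσ.filter_mono nhdsWithin_le_nhds] with v h1 h2 h3 δ
    rw [← formula (σ v) h1 ((le_abs_self _).trans_lt h2) δ, h3]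
  -- The formula for v > v* has the limit 0, so `limUnder` is a true limit and the representation
  -- extends to v = v*.
  have hat : ∀ δ, Z.melnikov φ (Z.vStar φ) δ = 0 := by
    intro δ
    unfold melnikov
    rw [if_pos rfl]
    refine Tendsto.limUnder_eq ?_
    have hc := (melnikovMorse_comp_contDiffAt hψ hψ0 hσ hσ0 (h.melE_add_smooth δ)
      (h.melR_smooth.of_le (by norm_num))).continuousAt.tendsto
    have h0 : melnikovMorse (fun v => Z.melE φ v + δ * deriv (Z.melD φ) v) (Z.melR φ) ψ
        (σ (Z.vStar φ)) = 0 := by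
      rw [hσ0]; simp [melnikovMorse]
    rw [h0] at hc
    exact (hc.mono_left nhdsWithin_le_nhds).congr' (hgt.mono fun v hv => (hv δ).symm)
  have hfirst : ∀ᶠ v in 𝓝[≥] (Z.vStar φ), ∀ δ, Z.melnikov φ v δ
      = melnikovMorse (fun v => Z.melE φ v + δ * deriv (Z.melD φ) v) (Z.melR φ) ψ (σ v) := by
    rw [← Ioi_insert, nhdsWithin_insert, eventually_sup, eventually_pure]
    refine ⟨fun δ => ?_, ?_⟩
    · rw [hat, hσ0]; simp [melnikovMorse]
    · filter_upwards [hgt, self_mem_nhdsWithin] with v h1 h2 δ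
      unfold melnikov
      rw [if_neg (ne_of_gt h2), h1 δ]
  filter_upwards [hfirst, hσr.filter_mono nhdsWithin_le_nhds] with v h1 h2 δ
  refine ⟨h1 δ, ?_⟩
  rw [h1 δ, melnikovMorse_add_mul hψ1 hEc hDc h2 δ]

end Unfolding

namespace Unfolding

variable {Z : Unfolding} {φ : ℝ → ℝ}

/-! ### Derivatives of the Melnikov function at the critical point -/

theorem Admissible.hasDerivAt_f2x (h : Z.Admissible φ) :
    HasDerivAt (Z.f2x φ) (deriv φ (Z.vStar φ) * dx (Z.B2 0) 0 0) (Z.vStar φ) := by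
  rw [h.f2x_eq]; exact h.hasDerivAt_affine _ _

theorem Admissible.hasDerivAt_f2tilde (h : Z.Admissible φ) : HasDerivAt (Z.f2tilde φ)
    (deriv φ (Z.vStar φ) * deriv (fun α => Z.B2 α 0 0) 0) (Z.vStar φ) := by
  rw [h.f2tilde_eq]; exact h.hasDerivAt_affine _ _

theorem Admissible.hasDerivAt_f2eps (h : Z.Admissible φ) : HasDerivAt (Z.f2eps φ)
    (dy (Z.A2 0) 0 0 + φ (Z.vStar φ) * dy (Z.B2 0) 0 0
      + Z.vStar φ * (deriv φ (Z.vStar φ) * dy (Z.B2 0) 0 0)) (Z.vStar φ) := by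
  rw [h.f2eps_eq]
  simpa using! (hasDerivAt_id _).mul
    (h.hasDerivAt_affine (dy (Z.A2 0) 0 0) (dy (Z.B2 0) 0 0))

/-- In the quotient rule φ(v*) cancels: the numerator is φ'(v*) times a 2 × 2 determinant of
coefficients, which equals 2 (Y²_x X̃² - X²_x Ỹ²). -/
theorem Admissible.deriv_melD (h : Z.Admissible φ) :
    deriv (Z.melD φ) (Z.vStar φ) = Z.traceN φ / Z.f2x φ (Z.vStar φ) := by
  have hN := h.f2x_vStar
  have hne := h.f2x_vStar_neg.ne
  have hd := h.detx_neg.ne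
  refine (h.hasDerivAt_f2tilde.div h.hasDerivAt_f2x hne).deriv.trans ?_
  have hB : Z.B1 0 0 0 ≠ 0 := h.B1_pos.ne'
  have hN' : Z.detx = Z.f2x φ (Z.vStar φ) * Z.B1 0 0 0 / 2 := by linear_combination -hN / 2
  unfold traceN
  rw [hN']
  change _ = 1 / _ * _ * Z.B1 0 0 0 * _ / _
  field_simp
  rw [h.f2tilde_eq, h.f2x_eq]
  obtain ⟨_, _, p3, p4, _, _, p7, p8⟩ := h.partials
  rw [p3, p4, p7, p8]
  ring

/-- The first order displacement of the equilibrium. -/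
theorem Admissible.xStar_mul (h : Z.Admissible φ) : Z.xStar φ * Z.f2x φ (Z.vStar φ)
    = -(Z.vStar φ * (dy (Z.A2 0) 0 0 + φ (Z.vStar φ) * dy (Z.B2 0) 0 0)) := by
  have hN := h.f2x_vStar
  have hd := h.detx_neg.ne
  have hφ := h.vStar_spec.2
  have hB : Z.B1 0 0 0 ≠ 0 := h.B1_pos.ne'
  obtain ⟨_, _, _, _, p5, p6, _, _⟩ := h.partials
  have h2 : (dy (Z.A2 0) 0 0 + φ (Z.vStar φ) * dy (Z.B2 0) 0 0) * Z.B1 0 0 0 = 2 * Z.dety := by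
    rw [p5, p6, h.det_partials.2]
    unfold A1 B1 at *
    linear_combination (dy (Z.X2 0) 0 0 - dy (Z.Y2 0) 0 0) * hφ
  apply mul_right_cancel₀ hB
  unfold xStar
  have h3 : -(Z.dety / Z.detx) * Z.vStar φ * (2 * Z.detx) = -(2 * Z.dety * Z.vStar φ) := by
    field_simp
  linear_combination -(Z.dety / Z.detx) * Z.vStar φ * hN + h3 + Z.vStar φ * h2

/-- The quotient rule for F²_ε / F²_x multiplies (F²_x)' by -F²_ε / F²_x, and by `xStar_mul` this
factor is x*. That is how x* enters the trace constant. -/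
theorem Admissible.melE_vStar (h : Z.Admissible φ) :
    Z.melE φ (Z.vStar φ) = Z.traceM φ / Z.f2x φ (Z.vStar φ) := by
  have hN := h.f2x_vStar
  have hne := h.f2x_vStar_neg.ne
  have hd := h.detx_neg.ne
  have hφ := h.vStar_spec.2
  have e3 : deriv (Z.melC φ) (Z.vStar φ) = _ := (h.hasDerivAt_f2eps.div h.hasDerivAt_f2x hne).deriv
  have hB : Z.B1 0 0 0 ≠ 0 := h.B1_pos.ne'
  obtain ⟨p1, p2, p3, p4, p5, p6, _, _⟩ := h.partials
  have hx := h.xStar_mul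
  unfold melE
  rw [e3]
  have hx' : Z.xStar φ
      = -(Z.vStar φ * (dy (Z.A2 0) 0 0 + φ (Z.vStar φ) * dy (Z.B2 0) 0 0))
        / Z.f2x φ (Z.vStar φ) := by
    rw [eq_div_iff hne, hx]
  unfold traceM
  rw [hx', h.f2eps_eq, h.f1x_eq, ← p1, ← p2, ← p4, ← p6]
  rw [show dy (Z.X2 0) 0 0 + dy (Z.Y2 0) 0 0 = dy (Z.A2 0) 0 0 from p5.symm]
  field_simp
  ring

theorem Admissible.melE_deltaH (h : Z.Admissible φ) :
    Z.melE φ (Z.vStar φ) + Z.deltaH φ * deriv (Z.melD φ) (Z.vStar φ) = 0 := by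
  have := h.traceN_ne
  have hne := h.f2x_vStar_neg.ne
  rw [h.melE_vStar, h.deriv_melD]
  unfold deltaH
  field_simp
  ring

/-- The Melnikov function and its derivatives up to order three at the critical point. -/
structure MelnikovData (Z : Unfolding) (φ : ℝ → ℝ) : Prop where
  regular : ∀ δ : ℝ,
    ContDiffWithinAt ℝ 3 (fun v => Z.melnikov φ v δ) (Ici (Z.vStar φ)) (Z.vStar φ)
  zero : ∀ δ : ℝ, Z.melnikov φ (Z.vStar φ) δ = 0
  first : Z.dvM φ (Z.deltaH φ) = 0
  mixed : HasDerivAt (Z.dvM φ) (Z.mixedValue φ) (Z.deltaH φ)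
  differentiable : ∀ᶠ v in 𝓝[≥] (Z.vStar φ), DifferentiableAt ℝ (Z.melnikov φ v) (Z.deltaH φ)
  mixed' : HasDerivWithinAt (fun v => deriv (Z.melnikov φ v) (Z.deltaH φ)) (Z.mixedValue φ)
      (Ici (Z.vStar φ)) (Z.vStar φ)
  second : Z.dvMn φ 2 (Z.deltaH φ) = 0
  third : ∃ k : ℝ, k < 0 ∧ Z.dvMn φ 3 (Z.deltaH φ) = k *
    (deriv (deriv (fun v => Z.melE φ v + Z.deltaH φ * deriv (Z.melD φ) v)) (Z.vStar φ)
        / deriv (Z.Vp φ) (Z.vStar φ)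
      - deriv (fun v => Z.melE φ v + Z.deltaH φ * deriv (Z.melD φ) v) (Z.vStar φ)
        * deriv (deriv (Z.Vp φ)) (Z.vStar φ) / deriv (Z.Vp φ) (Z.vStar φ) ^ 2
      + deriv (Z.melR φ) (Z.vStar φ))

/-- To the right of v* the Melnikov function is the restriction of a function that is C⁴ on both
sides, so its one-sided derivatives are the ordinary derivatives of that extension. -/
theorem Admissible.melnikovData (h : Z.Admissible φ) : Z.MelnikovData φ := by
  obtain ⟨σ, ψ, hσ, hψ, hσ0, hψ0, hσψ, hψpos, hVψ, H⟩ := h.exists_coordinate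
  have hR : ContDiffAt ℝ 7 (Z.melR φ) (Z.vStar φ) := h.melR_smooth.of_le (by norm_num)
  have hself : Z.vStar φ ∈ Ici (Z.vStar φ) := self_mem_Ici
  have hE0 := h.melE_deltaH
  have eq1 : ∀ δ, (fun v => Z.melnikov φ v δ) =ᶠ[𝓝[≥] (Z.vStar φ)]
      fun v => melnikovMorse (fun v => Z.melE φ v + δ * deriv (Z.melD φ) v) (Z.melR φ) ψ (σ v) :=
    fun δ => H.mono fun v hv => (hv δ).1
  have eqs : ∀ δ, Z.melnikov φ (Z.vStar φ) δ = melnikovMorse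
      (fun v => Z.melE φ v + δ * deriv (Z.melD φ) v) (Z.melR φ) ψ (σ (Z.vStar φ)) :=
    fun δ => (eq1 δ).self_of_nhdsWithin hself
  have cd := fun δ => melnikovMorse_comp_contDiffAt hψ hψ0 hσ hσ0 (h.melE_add_smooth δ) hR
  have hdv : ∀ δ, Z.dvM φ δ
      = -(Real.pi * ((Z.melE φ (Z.vStar φ) + δ * deriv (Z.melD φ) (Z.vStar φ)) * deriv ψ 0)) := by
    intro δ
    have hd := hasDerivAt_melnikovMorse_comp hψ hψ0 hσ hσ0 hσψ (h.melE_add_smooth δ) hR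
    exact (hd.hasDerivWithinAt.congr_of_eventuallyEq (eq1 δ) (eqs δ)).derivWithin
      (uniqueDiffOn_Ici _ _ hself)
  have h3 := iteratedDeriv_three_melnikovMorse_comp hψ hψ0 hσ hσ0 hσψ
    (h.melE_add_smooth (Z.deltaH φ)) hR hE0 h.Vp_smooth h.Vp_vStar hVψ
  -- V''(v*) ψ'(0)² = 1 with ψ'(0) > 0; this is the source of the square root in the mixed
  -- derivative.
  have hsqrt : √(iteratedDeriv 2 (Z.V φ) (Z.vStar φ)) * deriv ψ 0 = 1 := by
    rw [h.iteratedDeriv_two_V]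
    have : deriv (Z.Vp φ) (Z.vStar φ) = (1 / deriv ψ 0) ^ 2 := by
      have := h3.1
      field_simp
      linear_combination this
    rw [this, Real.sqrt_sq (by positivity)]
    field_simp
  have hmix : Z.mixedValue φ
      = -(Real.pi * (deriv (Z.melD φ) (Z.vStar φ) * deriv ψ 0)) := by
    have hN := h.f2x_vStar
    have hne := h.f2x_vStar_neg.ne
    have hB : Z.B1 0 0 0 ≠ 0 := h.B1_pos.ne'
    have hN' : Z.detx = Z.f2x φ (Z.vStar φ) * Z.B1 0 0 0 / 2 := by linear_combination -hN / 2
    have hs : √(iteratedDeriv 2 (Z.V φ) (Z.vStar φ)) = 1 / deriv ψ 0 := by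
      rw [eq_div_iff hψpos.ne', hsqrt]
    rw [h.deriv_melD]
    unfold mixedValue traceN
    rw [hs, hN']
    change _ * _ * Z.B1 0 0 0 ^ 2 / _ * _ = -(_ * (_ * _ * Z.B1 0 0 0 * _ / _ * _))
    field_simp
    ring
  have hn : ∀ n : ℕ, n ≤ 4 → Z.dvMn φ n (Z.deltaH φ) = iteratedDeriv n (fun v => melnikovMorse
      (fun v => Z.melE φ v + Z.deltaH φ * deriv (Z.melD φ) v) (Z.melR φ) ψ (σ v)) (Z.vStar φ) := by
    intro n hn
    unfold dvMn
    rw [(eq1 (Z.deltaH φ)).iteratedDerivWithin_eq (eqs _)]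
    exact iteratedDerivWithin_eq_iteratedDeriv (uniqueDiffOn_Ici _)
      ((cd (Z.deltaH φ)).of_le (by exact_mod_cast hn)) hself
  have haff : ∀ᶠ v in 𝓝[≥] (Z.vStar φ), HasDerivAt (Z.melnikov φ v)
      (melnikovMorse (deriv (Z.melD φ)) (fun _ => 0) ψ (σ v)) (Z.deltaH φ) := by
    filter_upwards [H] with v hv
    have : Z.melnikov φ v = fun δ => melnikovMorse (Z.melE φ) (Z.melR φ) ψ (σ v)
          + δ * melnikovMorse (deriv (Z.melD φ)) (fun _ => 0) ψ (σ v) := funext fun δ => (hv δ).2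
    rw [this]
    simpa using! ((hasDerivAt_id (Z.deltaH φ)).mul_const
      (melnikovMorse (deriv (Z.melD φ)) (fun _ => 0) ψ (σ v))).const_add
        (melnikovMorse (Z.melE φ) (Z.melR φ) ψ (σ v))
  refine ⟨fun δ => ?_, fun δ => ?_, ?_, ?_, ?_, ?_, ?_, ?_⟩
  · exact (((cd δ).of_le (by norm_num)).contDiffWithinAt).congr_of_eventuallyEq (eq1 δ) (eqs δ)
  · rw [eqs δ, hσ0]; simp [melnikovMorse]
  · rw [hdv, hE0]; ring
  · rw [show Z.dvM φ = _ from funext hdv, hmix]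
    have := ((((hasDerivAt_id (Z.deltaH φ)).mul_const (deriv (Z.melD φ) (Z.vStar φ))).const_add
      (Z.melE φ (Z.vStar φ))).mul_const (deriv ψ 0)).const_mul Real.pi
    simpa using! this.neg
  · exact haff.mono fun v hv => hv.differentiableAt
  · have hd := hasDerivAt_melnikovMorse_comp hψ hψ0 hσ hσ0 hσψ (R := fun _ => 0)
      ((contDiffAt_deriv (n := 7) h.melD_smooth).of_le (by norm_num)) contDiffAt_const
    rw [hmix]
    have e := haff.mono fun v hv => hv.deriv
    exact hd.hasDerivWithinAt.congr_of_eventuallyEq e (e.self_of_nhdsWithin hself)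
  · rw [hn 2 (by norm_num)]
    exact (iteratedDeriv_melnikovMorse_comp hψ hψ0 hσ hσ0 hσψ
      (h.melE_add_smooth (Z.deltaH φ)) hR hE0).1
  · rw [hn 3 (by norm_num), h3.2]
    refine ⟨_, ?_, rfl⟩
    have := h.deriv_Vp_pos
    have := Real.pi_pos
    have : 0 < 3 * Real.pi / 4 * (deriv ψ 0 * deriv (Z.Vp φ) (Z.vStar φ)) := by positivity
    linarith

end Unfolding

/-! ### The Lyapunov coefficient and the third derivative of the Melnikov function -/

/-- At a zero of the numerator all terms containing f itself drop out. It serves both for the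
integrand and for V' = -F¹/F²_x. -/
theorem deriv_div_of_zero {f f' D D' : ℝ → ℝ} {f'' w : ℝ}
    (hf : ∀ᶠ v in 𝓝 w, HasDerivAt f (f' v) v) (hf' : HasDerivAt f' f'' w)
    (hD : ∀ᶠ v in 𝓝 w, HasDerivAt D (D' v) v) (hD' : DifferentiableAt ℝ D' w)
    (hf0 : f w = 0) (hD0 : D w ≠ 0) :
    deriv (fun v => f v / D v) w = f' w / D w ∧
    deriv (deriv (fun v => f v / D v)) w = f'' / D w - 2 * f' w * D' w / D w ^ 2 := by
  have hne : ∀ᶠ v in 𝓝 w, D v ≠ 0 :=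
    hD.self_of_nhds.continuousAt.eventually_ne hD0
  have h1 : ∀ᶠ v in 𝓝 w, deriv (fun v => f v / D v) v = (f' v * D v - f v * D' v) / D v ^ 2 := by
    filter_upwards [hf, hD, hne] with v h1 h2 h3
    exact (h1.div h2 h3).deriv
  refine ⟨?_, ?_⟩
  · rw [h1.self_of_nhds, hf0]
    field_simp
    ring
  · rw [Filter.EventuallyEq.deriv_eq h1]
    refine (((hf'.mul hD.self_of_nhds).sub (hf.self_of_nhds.mul hD'.hasDerivAt)).div
      (hD.self_of_nhds.pow 2) (pow_ne_zero 2 hD0)).deriv.trans ?_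
    simp only [Pi.mul_apply, Pi.sub_apply, Pi.pow_apply, hf0]
    field_simp
    ring

section melnikovIntegrand

variable {φ : ℝ → ℝ} {w : ℝ}

/-- The first two derivatives of the integrand of the Melnikov function at a zero. -/
theorem deriv_integrand (hφ : ContDiffAt ℝ 8 φ w) {a b n₀ n₁ y₀ y₁ t₀ t₁ δ k β : ℝ}
    (hn : n₀ + φ w * n₁ ≠ 0)
    (hk : w * (y₀ + φ w * y₁) + δ * (t₀ + φ w * t₁) = k * (n₀ + φ w * n₁))
    (hβ : β = w * y₁ + δ * t₁ - k * n₁) {E : ℝ → ℝ}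
    (hE : E = fun v => (a + φ v * b) / (n₀ + φ v * n₁)
      + deriv (fun v => v * (y₀ + φ v * y₁) / (n₀ + φ v * n₁)) v
      + δ * deriv (fun v => (t₀ + φ v * t₁) / (n₀ + φ v * n₁)) v) (hE0 : E w = 0) :
    β * deriv φ w = -((a + φ w * b) + (y₀ + φ w * y₁)) ∧
    deriv E w = ((n₀ + φ w * n₁) * (deriv φ w * b + 2 * deriv φ w * y₁ + deriv (deriv φ) w * β)
      + (a + φ w * b) * deriv φ w * n₁) / (n₀ + φ w * n₁) ^ 2 ∧
    deriv (deriv E) w =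
      ((n₀ + φ w * n₁) * (deriv (deriv φ) w * b + 3 * deriv (deriv φ) w * y₁
          + deriv (deriv (deriv φ)) w * β)
        + 2 * deriv φ w ^ 2 * b * n₁ + (a + φ w * b) * deriv (deriv φ) w * n₁
        + 2 * deriv φ w ^ 2 * y₁ * n₁ - (y₀ + φ w * y₁) * deriv (deriv φ) w * n₁)
          / (n₀ + φ w * n₁) ^ 2
      - 4 * ((n₀ + φ w * n₁) * (deriv φ w * b + 2 * deriv φ w * y₁ + deriv (deriv φ) w * β)
      + (a + φ w * b) * deriv φ w * n₁) * (deriv φ w * n₁) / (n₀ + φ w * n₁) ^ 3 := by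
  have hφ1 : ContDiffAt ℝ 7 (deriv φ) w := contDiffAt_deriv (n := 7) hφ
  have hφ2 : ContDiffAt ℝ 6 (deriv (deriv φ)) w := contDiffAt_deriv (n := 6) hφ1
  set φ1 := deriv φ with e1
  set φ2 := deriv φ1 with e2
  set φ3 := deriv φ2 with e3
  have d0 : ∀ᶠ v in 𝓝 w, HasDerivAt φ (φ1 v) v :=
    (hφ.eventually (by simp)).mono fun v h => (h.differentiableAt (by simp)).hasDerivAt
  have d1 : ∀ᶠ v in 𝓝 w, HasDerivAt φ1 (φ2 v) v :=
    (hφ1.eventually (by simp)).mono fun v h => (h.differentiableAt (by simp)).hasDerivAt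
  have d2 : HasDerivAt φ2 (φ3 w) w := (hφ2.differentiableAt (by simp)).hasDerivAt
  have hne : ∀ᶠ v in 𝓝 w, n₀ + φ v * n₁ ≠ 0 :=
    (continuousAt_const.add (hφ.continuousAt.mul continuousAt_const)).eventually_ne hn
  have aff : ∀ {v : ℝ} (s t : ℝ), HasDerivAt φ (φ1 v) v →
      HasDerivAt (fun v => s + φ v * t) (φ1 v * t) v := fun s t h => (h.mul_const t).const_add s
  -- The numerator of E over the common denominator (F²_x)²; the zero of E at w is a zero of J.
  set J : ℝ → ℝ := fun v => (a + φ v * b) * (n₀ + φ v * n₁)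
    + (y₀ + φ v * y₁ + v * φ1 v * y₁ + δ * (φ1 v * t₁)) * (n₀ + φ v * n₁)
    - (v * (y₀ + φ v * y₁) + δ * (t₀ + φ v * t₁)) * (φ1 v * n₁) with hJ
  set J' : ℝ → ℝ := fun v => φ1 v * b * (n₀ + φ v * n₁) + (a + φ v * b) * (φ1 v * n₁)
    + (2 * φ1 v * y₁ + v * φ2 v * y₁ + δ * (φ2 v * t₁)) * (n₀ + φ v * n₁)
    - (v * (y₀ + φ v * y₁) + δ * (t₀ + φ v * t₁)) * (φ2 v * n₁) with hJ'
  have hEJ : ∀ᶠ v in 𝓝 w, E v = J v / (n₀ + φ v * n₁) ^ 2 := by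
    filter_upwards [d0, hne] with v h0 hv
    have q1 : deriv (fun v => v * (y₀ + φ v * y₁) / (n₀ + φ v * n₁)) v = _ :=
      (((hasDerivAt_id v).mul (aff y₀ y₁ h0)).div (aff n₀ n₁ h0) hv).deriv
    have q2 : deriv (fun v => (t₀ + φ v * t₁) / (n₀ + φ v * n₁)) v = _ :=
      ((aff t₀ t₁ h0).div (aff n₀ n₁ h0) hv).deriv
    simp only [hE, hJ]
    rw [q1, q2]
    simp only [Pi.mul_apply, id]
    field_simp
    ring
  have hJd : ∀ᶠ v in 𝓝 w, HasDerivAt J (J' v) v := by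
    filter_upwards [d0, d1] with v h0 h1
    refine ((((aff a b h0).mul (aff n₀ n₁ h0)).add ((((aff y₀ y₁ h0).add
      (((hasDerivAt_id v).mul h1).mul_const y₁)).add ((h1.mul_const t₁).const_mul δ)).mul
      (aff n₀ n₁ h0))).sub ((((hasDerivAt_id v).mul (aff y₀ y₁ h0)).add
      ((aff t₀ t₁ h0).const_mul δ)).mul (h1.mul_const n₁))).congr_deriv ?_
    simp only [hJ', Pi.mul_apply, Pi.add_apply, id]
    ring
  have hD : ∀ᶠ v in 𝓝 w, HasDerivAt (fun v => (n₀ + φ v * n₁) ^ 2)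
      (2 * (n₀ + φ v * n₁) * (φ1 v * n₁)) v := by
    filter_upwards [d0] with v h0
    simpa using! (aff n₀ n₁ h0).pow 2
  have h0 := d0.self_of_nhds
  have h1 := d1.self_of_nhds
  have hJ'd := ((((h1.mul_const b).mul (aff n₀ n₁ h0)).add
    ((aff a b h0).mul (h1.mul_const n₁))).add (((((h1.const_mul 2).mul_const y₁).add
    (((hasDerivAt_id w).mul d2).mul_const y₁)).add ((d2.mul_const t₁).const_mul δ)).mul
      (aff n₀ n₁ h0))).sub ((((hasDerivAt_id w).mul (aff y₀ y₁ h0)).add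
      ((aff t₀ t₁ h0).const_mul δ)).mul (d2.mul_const n₁))
  have hJ0 : J w = 0 := by
    have := hEJ.self_of_nhds
    rw [hE0, eq_comm, div_eq_zero_iff] at this
    exact this.resolve_right (pow_ne_zero 2 hn)
  -- With k eliminated by its defining relation, E(w) = 0 becomes the same linear equation for β as
  -- the first-order zero-trace condition.
  have hβ' : β * φ1 w = -((a + φ w * b) + (y₀ + φ w * y₁)) := by
    apply mul_right_cancel₀ hn
    rw [hβ]
    simp only [hJ] at hJ0
    linear_combination hJ0 + φ1 w * n₁ * hk
  obtain ⟨r1, r2⟩ := deriv_div_of_zero (f' := J') hJd hJ'd hD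
    (((aff n₀ n₁ h0).const_mul 2).mul (h1.mul_const n₁)).differentiableAt hJ0 (pow_ne_zero 2 hn)
  have hEJ' : E =ᶠ[𝓝 w] fun v => J v / (n₀ + φ v * n₁) ^ 2 := hEJ
  refine ⟨hβ', ?_, ?_⟩
  · rw [hEJ'.deriv_eq, r1]
    congr 1
    simp only [hJ']
    linear_combination -(φ2 w * n₁) * hk - (n₀ + φ w * n₁) * φ2 w * hβ
  · rw [hEJ'.deriv.deriv_eq, r2]
    simp only [Pi.mul_apply, Pi.add_apply, id, hJ']
    have hs : J' w = (n₀ + φ w * n₁) * (φ1 w * b + 2 * φ1 w * y₁ + φ2 w * β)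
      + (a + φ w * b) * φ1 w * n₁ := by
      simp only [hJ']
      linear_combination -(φ2 w * n₁) * hk - (n₀ + φ w * n₁) * φ2 w * hβ
    simp only [hJ'] at hs
    rw [hs]
    field_simp
    linear_combination (-(φ3 w * n₁) * hk - (n₀ + φ w * n₁) * φ3 w * hβ) * (n₀ + φ w * n₁)

end melnikovIntegrand

namespace Unfolding

variable {Z : Unfolding} {φ : ℝ → ℝ}

/-- The limit of `ε` times the Lyapunov coefficient along a Hopf curve is a negative multiple of
the factor that decides the sign of the third derivative of the Melnikov function. -/
theorem Admissible.lyapunovLimit_eq (h : Z.Admissible φ) : ∃ β : ℝ,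
    β * deriv φ (Z.vStar φ) = -(Z.f1x φ (Z.vStar φ)
      + (dy (Z.A2 0) 0 0 + φ (Z.vStar φ) * dy (Z.B2 0) 0 0)) ∧
    lyapunovLimit (Z.f1x φ (Z.vStar φ) / 2) (Z.f2x φ (Z.vStar φ) / 2) (deriv φ (Z.vStar φ))
        (deriv (deriv φ) (Z.vStar φ)) (deriv (deriv (deriv φ)) (Z.vStar φ))
        (Z.B1 0 0 0) (dx (Z.B1 0) 0 0) (dx (Z.B2 0) 0 0)
        β (dy (Z.B2 0) 0 0) (dx (dx (Z.B2 0)) 0 0) (Z.f2xx φ (Z.vStar φ) / 2)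
      = Z.f2x φ (Z.vStar φ) / 32 *
    (deriv (deriv (fun v => Z.melE φ v + Z.deltaH φ * deriv (Z.melD φ) v)) (Z.vStar φ)
        / deriv (Z.Vp φ) (Z.vStar φ)
      - deriv (fun v => Z.melE φ v + Z.deltaH φ * deriv (Z.melD φ) v) (Z.vStar φ)
        * deriv (deriv (Z.Vp φ)) (Z.vStar φ) / deriv (Z.Vp φ) (Z.vStar φ) ^ 2
      + deriv (Z.melR φ) (Z.vStar φ)) := by
  have hneg := h.f2x_vStar_neg
  have hb := h.B1_pos
  have hp := h.deriv_phi_pos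
  have hφ2 : ContDiffAt ℝ 7 (deriv φ) (Z.vStar φ) := contDiffAt_deriv (n := 7) h.phi_smooth
  have d0 : ∀ᶠ v in 𝓝 (Z.vStar φ), HasDerivAt φ (deriv φ v) v :=
    (h.phi_smooth.eventually (by simp)).mono fun v h => (h.differentiableAt (by simp)).hasDerivAt
  have d1 := (hφ2.differentiableAt (by simp)).hasDerivAt
  have aff : ∀ s t : ℝ, ∀ᶠ v in 𝓝 (Z.vStar φ),
      HasDerivAt (fun v => s + φ v * t) (deriv φ v * t) v := fun s t =>
    d0.mono fun v h => (h.mul_const t).const_add s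
  have hne : dx (Z.A2 0) 0 0 + φ (Z.vStar φ) * dx (Z.B2 0) 0 0 ≠ 0 := by
    have := hneg.ne
    rwa [h.f2x_eq] at this
  -- To first order the equilibria on α = δ_H ε have x = -k ε. The β introduced next is then the
  -- first-order coefficient of X² - Y² along them, that is, the limit of B2/ε.
  obtain ⟨k, hk⟩ : ∃ k, Z.vStar φ * (dy (Z.A2 0) 0 0 + φ (Z.vStar φ) * dy (Z.B2 0) 0 0) +
      Z.deltaH φ * (deriv (fun α => Z.A2 α 0 0) 0 + φ (Z.vStar φ) * deriv (fun α => Z.B2 α 0 0) 0)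
      = k * (dx (Z.A2 0) 0 0 + φ (Z.vStar φ) * dx (Z.B2 0) 0 0) :=
    ⟨_, (div_mul_cancel₀ _ hne).symm⟩
  obtain ⟨β, hβdef⟩ : ∃ β, β = Z.vStar φ * dy (Z.B2 0) 0 0
    + Z.deltaH φ * deriv (fun α => Z.B2 α 0 0) 0 - k * dx (Z.B2 0) 0 0 := ⟨_, rfl⟩
  obtain ⟨hβ, hE1, hE2⟩ := deriv_integrand (a := dx (Z.A1 0) 0 0) (b := dx (Z.B1 0) 0 0)
    (E := fun v => Z.melE φ v + Z.deltaH φ * deriv (Z.melD φ) v) h.phi_smooth hne hk hβdef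
    (by
      unfold melE melD melC
      rw [h.f1x_eq, h.f2x_eq, h.f2eps_eq, h.f2tilde_eq]) h.melE_deltaH
  have hV : Z.Vp φ = fun v => (-Z.A1 0 0 0 + φ v * (-Z.B1 0 0 0))
      / (dx (Z.A2 0) 0 0 + φ v * dx (Z.B2 0) 0 0) := by
    funext v
    unfold Vp
    rw [f1_eq, h.f2x_eq]
    ring
  obtain ⟨hV2, hV3⟩ := deriv_div_of_zero (w := Z.vStar φ) (aff (-Z.A1 0 0 0) (-Z.B1 0 0 0))
    (d1.mul_const (-Z.B1 0 0 0)) (aff (dx (Z.A2 0) 0 0) (dx (Z.B2 0) 0 0))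
    (d1.mul_const (dx (Z.B2 0) 0 0)).differentiableAt
    (by linear_combination -h.vStar_spec.2) hne
  rw [← hV] at hV2 hV3
  have hR : deriv (Z.melR φ) (Z.vStar φ)
      = (deriv φ (Z.vStar φ) * dx (dx (Z.B2 0)) 0 0
          * (dx (Z.A2 0) 0 0 + φ (Z.vStar φ) * dx (Z.B2 0) 0 0)
        - (dx (dx (Z.A2 0)) 0 0 + φ (Z.vStar φ) * dx (dx (Z.B2 0)) 0 0)
          * (deriv φ (Z.vStar φ) * dx (Z.B2 0) 0 0))
        / (dx (Z.A2 0) 0 0 + φ (Z.vStar φ) * dx (Z.B2 0) 0 0) ^ 2 := by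
    unfold melR
    rw [h.f2xx_eq, h.f2x_eq]
    exact ((aff (dx (dx (Z.A2 0)) 0 0) (dx (dx (Z.B2 0)) 0 0)).self_of_nhds.div
      (aff (dx (Z.A2 0) 0 0) (dx (Z.B2 0) 0 0)).self_of_nhds hne).deriv
  refine ⟨β, by rw [h.f1x_eq]; exact hβ, ?_⟩
  rw [hE1, hE2, hV2, hV3, hR, h.f1x_eq, h.f2x_eq, h.f2xx_eq]
  simp only
  clear hE1 hE2 hV2 hV3 hR hV hβdef hk aff
  -- Eliminating the y-derivative of F² in favour of β leaves an identity between rational functions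
  -- of the remaining jet entries.
  have hY : dy (Z.A2 0) 0 0 + φ (Z.vStar φ) * dy (Z.B2 0) 0 0
      = -(β * deriv φ (Z.vStar φ)) - (dx (Z.A1 0) 0 0 + φ (Z.vStar φ) * dx (Z.B1 0) 0 0) := by
    linear_combination hβ
  rw [hY]
  generalize dx (Z.A2 0) 0 0 + φ (Z.vStar φ) * dx (Z.B2 0) 0 0 = n at *
  generalize dx (Z.A1 0) 0 0 + φ (Z.vStar φ) * dx (Z.B1 0) 0 0 = m at *
  generalize dx (dx (Z.A2 0)) 0 0 + φ (Z.vStar φ) * dx (dx (Z.B2 0)) 0 0 = l at *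
  have hp' := hp.ne'
  have hb' := hb.ne'
  unfold lyapunovLimit lyapunovScaled
  generalize deriv φ (Z.vStar φ) = p at *
  generalize Z.B1 0 0 0 = b at *
  field_simp
  ring

end Unfolding

/-! ### The regularized system in slow-fast coordinates

Points are written `((ε, α), (x, v))` with `y = ε v`. -/

/-- A function of `(α, x, y)` in the coordinates `((ε, α), (x, v))`. -/
def pull (F : ℝ → ℝ → ℝ → ℝ) (u : (ℝ × ℝ) × (ℝ × ℝ)) : ℝ := F u.1.2 u.2.1 (u.1.1 * u.2.2)

/-- The function `A + φ(v) B` in the coordinates `((ε, α), (x, v))`. -/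
def slowFast (φ : ℝ → ℝ) (A B : ℝ → ℝ → ℝ → ℝ) (u : (ℝ × ℝ) × (ℝ × ℝ)) : ℝ :=
  pull A u + φ u.2.2 * pull B u

theorem tendsto_pull (w : ℝ) : Tendsto (fun u : (ℝ × ℝ) × (ℝ × ℝ) => (u.1.2, u.2.1, u.1.1 * u.2.2))
    (𝓝 ((0, 0), (0, w))) (𝓝 0) := by
  have hc : Continuous (fun u : (ℝ × ℝ) × (ℝ × ℝ) => (u.1.2, u.2.1, u.1.1 * u.2.2)) := by fun_prop
  have := hc.tendsto ((0, 0), (0, w))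
  simpa using! this

theorem SmoothAt₃.pull {n : ℕ} {F : ℝ → ℝ → ℝ → ℝ} (hF : SmoothAt₃ n F 0) (w : ℝ) :
    ContDiffAt ℝ n (pull F) ((0, 0), (0, w)) := by
  have hF' : ContDiffAt ℝ n (fun q : ℝ × ℝ × ℝ => F q.1 q.2.1 q.2.2)
      ((fun u : (ℝ × ℝ) × (ℝ × ℝ) => (u.1.2, u.2.1, u.1.1 * u.2.2)) ((0, 0), (0, w))) := by
    simpa using! hF
  exact ContDiffAt.comp (g := fun q : ℝ × ℝ × ℝ => F q.1 q.2.1 q.2.2)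
    (f := fun u : (ℝ × ℝ) × (ℝ × ℝ) => (u.1.2, u.2.1, u.1.1 * u.2.2)) _ hF' (by fun_prop)

theorem contDiffAt_fast {n : ℕ} {ψ : ℝ → ℝ} {w : ℝ} (hψ : ContDiffAt ℝ n ψ w) :
    ContDiffAt ℝ n (fun u : (ℝ × ℝ) × (ℝ × ℝ) => ψ u.2.2) ((0, 0), (0, w)) :=
  ContDiffAt.comp (g := ψ) (f := fun u : (ℝ × ℝ) × (ℝ × ℝ) => u.2.2) _ hψ (by fun_prop)

theorem contDiffAt_slowFast {n : ℕ} {φ : ℝ → ℝ} {A B : ℝ → ℝ → ℝ → ℝ} {w : ℝ}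
    (hφ : ContDiffAt ℝ n φ w) (hA : SmoothAt₃ n A 0) (hB : SmoothAt₃ n B 0) :
    ContDiffAt ℝ n (slowFast φ A B) ((0, 0), (0, w)) :=
  (hA.pull w).add ((contDiffAt_fast hφ).mul (hB.pull w))

section curves

variable {A B : ℝ → ℝ → ℝ → ℝ} {φ ε α x v : ℝ → ℝ} {ε' α' x' v' w p t : ℝ}

theorem hasDerivAt_pull_curve (hA : SmoothAt₃ 1 A 0)
    (hε : HasDerivAt ε ε' t) (hα : HasDerivAt α α' t) (hx : HasDerivAt x x' t)
    (hv : HasDerivAt v v' t) (ε0 : ε t = 0) (α0 : α t = 0) (x0 : x t = 0) (v0 : v t = w) :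
    HasDerivAt (fun s => pull A ((ε s, α s), (x s, v s)))
      (deriv (fun s => A s 0 0) 0 * α' + (dx (A 0) 0 0 * x' + dy (A 0) 0 0 * (ε' * w))) t := by
  have h0 : SmoothAt₃ 1 A (α t, x t, ε t * v t) := by
    rw [ε0, α0, x0, zero_mul]; exact hA
  have := SmoothAt₃.hasDerivAt_curve (v := fun s => ε s * v s) h0 hα hx (hε.mul hv)
  simpa [ε0, α0, x0, v0] using! this

theorem hasDerivAt_slowFast_curve (hA : SmoothAt₃ 1 A 0) (hB : SmoothAt₃ 1 B 0)
    (hφ : HasDerivAt φ p w) (hε : HasDerivAt ε ε' t) (hα : HasDerivAt α α' t)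
    (hx : HasDerivAt x x' t) (hv : HasDerivAt v v' t)
    (ε0 : ε t = 0) (α0 : α t = 0) (x0 : x t = 0) (v0 : v t = w) :
    HasDerivAt (fun s => slowFast φ A B ((ε s, α s), (x s, v s)))
      (deriv (fun s => A s 0 0) 0 * α' + (dx (A 0) 0 0 * x' + dy (A 0) 0 0 * (ε' * w))
      + (p * v' * B 0 0 0 + φ w * (deriv (fun s => B s 0 0) 0 * α'
        + (dx (B 0) 0 0 * x' + dy (B 0) 0 0 * (ε' * w))))) t := by
  have hφ' : HasDerivAt φ p (v t) := by rwa [v0]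
  have := (hasDerivAt_pull_curve hA hε hα hx hv ε0 α0 x0 v0).add
    ((HasDerivAt.comp t hφ' hv).mul (hasDerivAt_pull_curve hB hε hα hx hv ε0 α0 x0 v0))
  simpa [ε0, α0, x0, v0, pull] using! this

end curves

theorem dx_blend {ε : ℝ} {φ : ℝ → ℝ} {A B : ℝ → ℝ → ℝ} {p : ℝ × ℝ}
    (hφ : ContDiffAt ℝ 1 φ (p.2 / ε)) (hA : SmoothAt 1 A p) (hB : SmoothAt 1 B p) :
    dx (blend ε φ A B) p.1 p.2 = 1 / 2 * (dx A p.1 p.2 + φ (p.2 / ε) * dx B p.1 p.2) := by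
  refine (dx_lin hA (SmoothAt.scale hφ hB) (1 / 2) (1 / 2)).eq.trans ?_
  rw [dx_scale]
  unfold scale
  ring

theorem dy_blend {ε : ℝ} {φ : ℝ → ℝ} {A B : ℝ → ℝ → ℝ} {p : ℝ × ℝ}
    (hφ : ContDiffAt ℝ 1 φ (p.2 / ε)) (hA : SmoothAt 1 A p) (hB : SmoothAt 1 B p) :
    dy (blend ε φ A B) p.1 p.2 = 1 / 2 * (dy A p.1 p.2 + φ (p.2 / ε) * dy B p.1 p.2
      + deriv φ (p.2 / ε) / ε * B p.1 p.2) := by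
  refine (dy_lin hA (SmoothAt.scale hφ hB) (1 / 2) (1 / 2)).eq.trans ?_
  rw [(dy_scale hφ hB).eq]
  unfold scale
  ring

namespace Unfolding

variable {Z : Unfolding} {φ : ℝ → ℝ}

theorem reg1_eq (ε α : ℝ) : Z.reg1 φ ε α = blend ε φ (Z.A1 α) (Z.B1 α) := by
  funext x y
  simp only [reg1, blend, scale, A1, B1]
  ring

theorem reg2_eq (ε α : ℝ) : Z.reg2 φ ε α = blend ε φ (Z.A2 α) (Z.B2 α) := by
  funext x y
  simp only [reg2, blend, scale, A2, B2]
  ring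

theorem reg_slowFast {ε : ℝ} (hε : ε ≠ 0) (α x v : ℝ) :
    Z.reg1 φ ε α x (ε * v) = slowFast φ Z.A1 Z.B1 ((ε, α), (x, v)) / 2 ∧
    Z.reg2 φ ε α x (ε * v) = slowFast φ Z.A2 Z.B2 ((ε, α), (x, v)) / 2 := by
  simp only [reg1_eq, reg2_eq, blend, scale, slowFast, pull, mul_div_cancel_left₀ v hε]
  constructor <;> ring

/-- `2 ε` times the trace of the Jacobian matrix of the regularized system. -/
def traceFun (Z : Unfolding) (φ : ℝ → ℝ) (u : (ℝ × ℝ) × (ℝ × ℝ)) : ℝ :=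
  u.1.1 * slowFast φ (fun α => dx (Z.A1 α)) (fun α => dx (Z.B1 α)) u
    + u.1.1 * slowFast φ (fun α => dy (Z.A2 α)) (fun α => dy (Z.B2 α)) u
    + deriv φ u.2.2 * pull Z.B2 u

/-- `4 ε` times the determinant of the Jacobian matrix of the regularized system. -/
def detFun (Z : Unfolding) (φ : ℝ → ℝ) (u : (ℝ × ℝ) × (ℝ × ℝ)) : ℝ :=
  slowFast φ (fun α => dx (Z.A1 α)) (fun α => dx (Z.B1 α)) u
    * (u.1.1 * slowFast φ (fun α => dy (Z.A2 α)) (fun α => dy (Z.B2 α)) u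
      + deriv φ u.2.2 * pull Z.B2 u)
  - (u.1.1 * slowFast φ (fun α => dy (Z.A1 α)) (fun α => dy (Z.B1 α)) u
      + deriv φ u.2.2 * pull Z.B1 u)
    * slowFast φ (fun α => dx (Z.A2 α)) (fun α => dx (Z.B2 α)) u

/-- Cleared of 1/ε, the trace and the determinant are regular at ε = 0, where ((0, 0), (0, v*))
becomes an ordinary base point for the implicit function theorem. -/
theorem Admissible.jacobian (h : Z.Admissible φ) :
    ∀ᶠ u : (ℝ × ℝ) × (ℝ × ℝ) in 𝓝 ((0, 0), (0, Z.vStar φ)), u.1.1 ≠ 0 →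
      traceJ (Z.reg1 φ u.1.1 u.1.2) (Z.reg2 φ u.1.1 u.1.2) (u.2.1, u.1.1 * u.2.2)
        = Z.traceFun φ u / (2 * u.1.1) ∧
      detJ (Z.reg1 φ u.1.1 u.1.2) (Z.reg2 φ u.1.1 u.1.2) (u.2.1, u.1.1 * u.2.2)
        = Z.detFun φ u / (4 * u.1.1) := by
  have hφ : ∀ᶠ u : (ℝ × ℝ) × (ℝ × ℝ) in 𝓝 ((0, 0), (0, Z.vStar φ)), ContDiffAt ℝ 8 φ u.2.2 := by
    have hc : Continuous (fun u : (ℝ × ℝ) × (ℝ × ℝ) => u.2.2) := by fun_prop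
    exact (hc.tendsto ((0, 0), (0, Z.vStar φ))).eventually (h.phi_smooth.eventually (by simp))
  have sm : ∀ {F : ℝ → ℝ → ℝ → ℝ}, SmoothAt₃ 8 F 0 →
      ∀ᶠ u : (ℝ × ℝ) × (ℝ × ℝ) in 𝓝 ((0, 0), (0, Z.vStar φ)),
        SmoothAt 1 (F u.1.2) (u.2.1, u.1.1 * u.2.2) := fun hF =>
    ((tendsto_pull _).eventually hF.eventually).mono fun u hu =>
      (SmoothAt₃.section hu).of_le (by norm_num)
  filter_upwards [hφ, sm h.A1_smooth, sm h.B1_smooth, sm h.A2_smooth, sm h.B2_smooth]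
    with u hφ a1 b1 a2 b2 hε
  have e : (u.2.1, u.1.1 * u.2.2).2 / u.1.1 = u.2.2 := mul_div_cancel_left₀ _ hε
  have hφ' : ContDiffAt ℝ 1 φ ((u.2.1, u.1.1 * u.2.2).2 / u.1.1) := by
    rw [e]; exact hφ.of_le (by norm_num)
  unfold traceJ detJ
  rw [reg1_eq, reg2_eq, dx_blend hφ' a1 b1, dy_blend hφ' a2 b2, dy_blend hφ' a1 b1,
    dx_blend hφ' a2 b2, e]
  simp only [traceFun, detFun, slowFast, pull]
  constructor
  · field_simp
    ring
  · field_simp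
    ring

theorem Admissible.traceFun_smooth (h : Z.Admissible φ) :
    ContDiffAt ℝ 2 (Z.traceFun φ) ((0, 0), (0, Z.vStar φ)) := by
  have hε : ContDiffAt ℝ 2 (fun u : (ℝ × ℝ) × (ℝ × ℝ) => u.1.1) ((0, 0), (0, Z.vStar φ)) := by
    fun_prop
  have hφ : ContDiffAt ℝ 2 φ (Z.vStar φ) := h.phi_smooth.of_le (by norm_num)
  exact ((hε.mul (contDiffAt_slowFast (n := 2) hφ (h.A1_smooth.dx.of_le (by norm_num))
    (h.B1_smooth.dx.of_le (by norm_num)))).add (hε.mul (contDiffAt_slowFast (n := 2) hφ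
    (h.A2_smooth.dy.of_le (by norm_num)) (h.B2_smooth.dy.of_le (by norm_num))))).add
    ((contDiffAt_fast (n := 2) ((contDiffAt_deriv (n := 7) h.phi_smooth).of_le (by norm_num))).mul
      ((h.B2_smooth.of_le (m := 2) (by norm_num)).pull _))

/-- At the base point ε and X² - Y² vanish, which leaves -φ' B1 F²_x > 0. -/
theorem Admissible.detFun_pos (h : Z.Admissible φ) :
    ∀ᶠ u in 𝓝 ((0, 0), (0, Z.vStar φ)), 0 < Z.detFun φ u := by
  have hφ : ContDiffAt ℝ 0 φ (Z.vStar φ) := h.phi_smooth.of_le (by norm_num)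
  have hφ' : ContDiffAt ℝ 0 (deriv φ) (Z.vStar φ) :=
    (contDiffAt_deriv (n := 7) h.phi_smooth).of_le (by norm_num)
  have hε : ContinuousAt (fun u : (ℝ × ℝ) × (ℝ × ℝ) => u.1.1) ((0, 0), (0, Z.vStar φ)) := by
    fun_prop
  have s1 := (contDiffAt_slowFast (n := 0) hφ (h.A1_smooth.dx.of_le (by norm_num))
    (h.B1_smooth.dx.of_le (by norm_num))).continuousAt
  have s2 := (contDiffAt_slowFast (n := 0) hφ (h.A2_smooth.dy.of_le (by norm_num))
    (h.B2_smooth.dy.of_le (by norm_num))).continuousAt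
  have s3 := (contDiffAt_slowFast (n := 0) hφ (h.A1_smooth.dy.of_le (by norm_num))
    (h.B1_smooth.dy.of_le (by norm_num))).continuousAt
  have s4 := (contDiffAt_slowFast (n := 0) hφ (h.A2_smooth.dx.of_le (by norm_num))
    (h.B2_smooth.dx.of_le (by norm_num))).continuousAt
  have f1 := (contDiffAt_fast (n := 0) hφ').continuousAt
  have p1 := ((h.B1_smooth.of_le (m := 0) (by norm_num)).pull (Z.vStar φ)).continuousAt
  have p2 := ((h.B2_smooth.of_le (m := 0) (by norm_num)).pull (Z.vStar φ)).continuousAt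
  have hc : ContinuousAt (Z.detFun φ) ((0, 0), (0, Z.vStar φ)) :=
    (s1.mul ((hε.mul s2).add (f1.mul p2))).sub (((hε.mul s3).add (f1.mul p1)).mul s4)
  refine hc.eventually (lt_mem_nhds ?_)
  have hn := h.f2x_vStar_neg
  rw [h.f2x_eq] at hn
  have := mul_pos h.deriv_phi_pos h.B1_pos
  simp only [detFun, slowFast, pull, mul_zero, zero_mul, h.B2_zero, zero_add, zero_sub, add_zero]
  nlinarith

/-- Along a curve of zeros of `F²` through the critical point the derivative of `2 ε` times the
trace is a linear combination of `M` and `N`. -/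
theorem Admissible.hasDerivAt_traceFun (h : Z.Admissible φ) {ε α x v : ℝ → ℝ} {ε' α' x' v' : ℝ}
    (hε : HasDerivAt ε ε' 0) (hα : HasDerivAt α α' 0) (hx : HasDerivAt x x' 0)
    (hv : HasDerivAt v v' 0) (ε0 : ε 0 = 0) (α0 : α 0 = 0) (x0 : x 0 = 0)
    (v0 : v 0 = Z.vStar φ)
    (hF : ∀ᶠ s in 𝓝 0, slowFast φ Z.A2 Z.B2 ((ε s, α s), (x s, v s)) = 0) :
    HasDerivAt (fun s => Z.traceFun φ ((ε s, α s), (x s, v s)))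
      (ε' * Z.traceM φ + α' * Z.traceN φ) 0 := by
  have dφ := (h.phi_smooth.differentiableAt (by simp)).hasDerivAt
  have hφ' : ContDiffAt ℝ 7 (deriv φ) (Z.vStar φ) := contDiffAt_deriv (n := 7) h.phi_smooth
  have dφ' := (hφ'.differentiableAt (by simp)).hasDerivAt
  have d2 := hasDerivAt_slowFast_curve (h.A2_smooth.of_le (by norm_num))
    (h.B2_smooth.of_le (by norm_num)) dφ hε hα hx hv ε0 α0 x0 v0
  -- Differentiating F² = 0 along the curve expresses x' by ε' and α'; v' drops out because X² - Y²
  -- vanishes at the origin.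
  have d2' := d2.unique ((hasDerivAt_const (0 : ℝ) (0 : ℝ)).congr_of_eventuallyEq hF)
  have s1 := hasDerivAt_slowFast_curve (h.A1_smooth.dx.of_le (by norm_num))
    (h.B1_smooth.dx.of_le (by norm_num)) dφ hε hα hx hv ε0 α0 x0 v0
  have s2 := hasDerivAt_slowFast_curve (h.A2_smooth.dy.of_le (by norm_num))
    (h.B2_smooth.dy.of_le (by norm_num)) dφ hε hα hx hv ε0 α0 x0 v0
  rw [← v0] at dφ'
  have s3 := (HasDerivAt.comp (0 : ℝ) dφ' hv).mul
    (hasDerivAt_pull_curve (h.B2_smooth.of_le (by norm_num)) hε hα hx hv ε0 α0 x0 v0)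
  have hd := ((hε.mul s1).add (hε.mul s2)).add s3
  refine (hd.congr_deriv ?_).congr_of_eventuallyEq (Eventually.of_forall fun s => rfl)
  · simp only [Function.comp_apply, ε0, α0, x0, v0, slowFast, pull, zero_mul, h.B2_zero]
    obtain ⟨p1, p2, p3, p4, p5, p6, p7, p8⟩ := h.partials
    have hne := h.f2x_vStar_neg.ne
    have hs := h.xStar_mul
    have hN : Z.traceN φ * Z.f2x φ (Z.vStar φ)
        = 2 * deriv φ (Z.vStar φ) * (Z.Y2x * Z.X2tilde - Z.X2x * Z.Y2tilde) := by
      have hd := h.detx_neg.ne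
      have e : Z.f2x φ (Z.vStar φ) = 2 * Z.detx / Z.B1 0 0 0 := by
        rw [eq_div_iff h.B1_pos.ne', h.f2x_vStar]
      have hB := h.B1_pos.ne'
      unfold traceN
      rw [e]
      change _ * Z.B1 0 0 0 * _ * _ = _
      field_simp
    rw [h.B2_zero] at d2'
    apply mul_right_cancel₀ hne
    unfold traceM
    simp only [h.f2x_eq] at hs hN ⊢
    rw [p3, p4, p5, p6] at hs
    rw [p3, p4] at hN
    rw [p3, p4, p5, p6, p7, p8] at d2'
    rw [p1, p2, p3, p4, p5, p6, p8]
    set X := Z.xStar φ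
    set N := Z.traceN φ
    set p := deriv φ (Z.vStar φ)
    set f := φ (Z.vStar φ)
    linear_combination (-ε' * p * (Z.X2x - Z.Y2x)) * hs - α' * hN
      + p * (Z.X2x - Z.Y2x) * d2'

end Unfolding

/-! ### Implicit functions: the equilibria and the parameter of zero trace. -/

theorem isInvertible_of_ker {V : Type*} [NormedAddCommGroup V] [NormedSpace ℝ V]
    [FiniteDimensional ℝ V] {L : V →L[ℝ] V} (h : ∀ z, L z = 0 → z = 0) : L.IsInvertible := by
  have hinj : Function.Injective L.toLinearMap := (injective_iff_map_eq_zero _).2 h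
  exact ⟨(LinearEquiv.ofInjectiveEndo L.toLinearMap hinj).toContinuousLinearEquiv, by ext z; rfl⟩

/-- Mean value inequality: the derivative f' - f'(0) is O(|s|) because f' is differentiable at 0. -/
theorem isBigO_sub_linear {f : ℝ → ℝ} (hf : ContDiffAt ℝ 2 f 0) (hf0 : f 0 = 0) :
    (fun t => f t - deriv f 0 * t) =O[𝓝 0] fun t => t ^ 2 := by
  have hd : DifferentiableAt ℝ (deriv f) 0 :=
    (contDiffAt_deriv (n := 1) hf).differentiableAt (by simp)
  obtain ⟨C, hC⟩ := hd.isBigO_sub.bound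
  obtain ⟨ρ, hρ, H⟩ := Metric.eventually_nhds_iff_ball.1 (hC.and (hf.eventually (by simp)))
  refine Asymptotics.IsBigO.of_bound C ?_
  filter_upwards [Metric.ball_mem_nhds _ hρ] with t ht
  have hsub : uIcc 0 t ⊆ Metric.ball (0 : ℝ) ρ :=
    (convex_ball _ _).ordConnected.uIcc_subset (Metric.mem_ball_self hρ) ht
  have hC0 : ∀ s ∈ uIcc 0 t, ‖deriv f s - deriv f 0‖ ≤ C * ‖s‖ := fun s hs => by
    simpa using (H s (hsub hs)).1
  have hCpos : 0 ≤ C * ‖t‖ := (norm_nonneg _).trans (hC0 t right_mem_uIcc)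
  have key := Convex.norm_image_sub_le_of_norm_hasDerivWithin_le (C := C * ‖t‖)
    (f := fun s => f s - deriv f 0 * s) (f' := fun s => deriv f s - deriv f 0) (s := uIcc 0 t)
    (x := 0) (y := t)
    (fun s hs => by
      have h1 := ((H s (hsub hs)).2.differentiableAt (by simp)).hasDerivAt
      have h2 := (hasDerivAt_id s).const_mul (deriv f 0)
      simpa using! (h1.sub h2).hasDerivWithinAt)
    (fun s hs => by
      rcases eq_or_ne t 0 with rfl | ht0
      · simp only [uIcc_self, mem_singleton_iff] at hs
        subst hs
        simp
      · have hCn : 0 ≤ C := nonneg_of_mul_nonneg_left hCpos (norm_pos_iff.2 ht0)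
        refine (hC0 s hs).trans (mul_le_mul_of_nonneg_left ?_ hCn)
        have := abs_sub_left_of_mem_uIcc hs
        simpa using this)
    (convex_uIcc 0 t) left_mem_uIcc right_mem_uIcc
  simp only [hf0, mul_zero, sub_zero] at key
  rw [norm_pow, pow_two, ← mul_assoc]
  exact key

namespace Unfolding

variable {Z : Unfolding} {φ : ℝ → ℝ}

/-- The equilibria of the regularized system near the critical point, as a function of the
parameters. -/
theorem Admissible.exists_equilibria (h : Z.Admissible φ) :
    ∃ E : ℝ × ℝ → ℝ × ℝ, ContDiffAt ℝ 2 E (0, 0) ∧ E (0, 0) = (0, Z.vStar φ) ∧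
      (∀ᶠ z in 𝓝 (0, 0), slowFast φ Z.A1 Z.B1 (z, E z) = 0 ∧ slowFast φ Z.A2 Z.B2 (z, E z) = 0) ∧
      ∀ᶠ u in 𝓝 ((0, 0), (0, Z.vStar φ)), slowFast φ Z.A1 Z.B1 u = 0 →
        slowFast φ Z.A2 Z.B2 u = 0 → E u.1 = u.2 := by
  set Φ : (ℝ × ℝ) × (ℝ × ℝ) → ℝ × ℝ :=
    fun u => (slowFast φ Z.A1 Z.B1 u, slowFast φ Z.A2 Z.B2 u) with hΦ
  have hφ : ContDiffAt ℝ 2 φ (Z.vStar φ) := h.phi_smooth.of_le (by norm_num)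
  have cdf : ContDiffAt ℝ 2 Φ ((0, 0), (0, Z.vStar φ)) :=
    (contDiffAt_slowFast (n := 2) hφ (h.A1_smooth.of_le (by norm_num))
      (h.B1_smooth.of_le (by norm_num))).prodMk
    (contDiffAt_slowFast (n := 2) hφ (h.A2_smooth.of_le (by norm_num))
      (h.B2_smooth.of_le (by norm_num)))
  have hn := h.f2x_vStar_neg.ne
  have hΦ0 : Φ ((0, 0), (0, Z.vStar φ)) = 0 := by
    have := h.vStar_spec.2
    simp [hΦ, slowFast, pull, this, h.A2_zero, h.B2_zero]
  have hinv : (fderiv ℝ Φ ((0, 0), (0, Z.vStar φ)) ∘L .inr ℝ (ℝ × ℝ) (ℝ × ℝ)).IsInvertible := by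
    -- In (x, v) the Jacobian at the base point has rows (F¹_x, φ' B1) and (F²_x, 0), since F²_v =
    -- φ' B2 = 0. The second row forces x = 0, then the first forces v = 0.
    refine isInvertible_of_ker fun z hz => ?_
    have c0 : HasDerivAt (fun _ : ℝ => (0 : ℝ)) 0 0 := hasDerivAt_const _ _
    have c1 : HasDerivAt (fun s : ℝ => s * z.1) z.1 0 := by
      simpa using (hasDerivAt_id (0 : ℝ)).mul_const z.1
    have c2 : HasDerivAt (fun s : ℝ => Z.vStar φ + s * z.2) z.2 0 := by
      simpa using ((hasDerivAt_id (0 : ℝ)).mul_const z.2).const_add (Z.vStar φ)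
    have dφ := (hφ.differentiableAt (by simp)).hasDerivAt
    have s1 := hasDerivAt_slowFast_curve (h.A1_smooth.of_le (by norm_num))
      (h.B1_smooth.of_le (by norm_num)) dφ c0 c0 c1 c2 rfl rfl (by simp) (by simp)
    have s2 := hasDerivAt_slowFast_curve (h.A2_smooth.of_le (by norm_num))
      (h.B2_smooth.of_le (by norm_num)) dφ c0 c0 c1 c2 rfl rfl (by simp) (by simp)
    have hd : HasFDerivAt Φ (fderiv ℝ Φ ((0, 0), (0, Z.vStar φ)))
        (((0 : ℝ), (0 : ℝ)), ((0 : ℝ) * z.1, Z.vStar φ + (0 : ℝ) * z.2)) := by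
      simpa using (cdf.differentiableAt (by simp)).hasFDerivAt
    have s3 := HasFDerivAt.comp_hasDerivAt (f := fun s : ℝ => (((0 : ℝ), (0 : ℝ)),
      (s * z.1, Z.vStar φ + s * z.2))) (0 : ℝ) hd ((c0.prodMk c0).prodMk (c1.prodMk c2))
    have e := s3.unique (s1.prodMk s2)
    have hz' : fderiv ℝ Φ ((0, 0), (0, Z.vStar φ)) ((0, 0), (z.1, z.2)) = 0 := hz
    rw [hz'] at e
    have e1 := congrArg Prod.fst e
    have e2 := congrArg Prod.snd e
    simp only [Prod.fst_zero, Prod.snd_zero, mul_zero, zero_mul, add_zero, zero_add,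
      h.B2_zero] at e1 e2
    have hz1 : z.1 = 0 := by
      rw [h.f2x_eq] at hn
      have : (dx (Z.A2 0) 0 0 + φ (Z.vStar φ) * dx (Z.B2 0) 0 0) * z.1 = 0 := by
        linear_combination -e2
      exact (mul_eq_zero.1 this).resolve_left hn
    have hz2 : z.2 = 0 := by
      rw [hz1] at e1
      have : (deriv φ (Z.vStar φ) * Z.B1 0 0 0) * z.2 = 0 := by linear_combination -e1
      exact (mul_eq_zero.1 this).resolve_left (mul_pos h.deriv_phi_pos h.B1_pos).ne'
    exact Prod.ext hz1 hz2
  refine ⟨cdf.implicitFunction (by simp) hinv, cdf.contDiffAt_implicitFunction (by simp) hinv,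
    cdf.implicitFunction_apply_self (by simp) hinv, ?_, ?_⟩
  · filter_upwards [cdf.eventually_apply_implicitFunction (by simp) hinv] with z hz
    rw [hΦ0] at hz
    exact ⟨congrArg Prod.fst hz, congrArg Prod.snd hz⟩
  · filter_upwards [cdf.eventually_apply_eq_iff_implicitFunction (by simp) hinv] with u hu h1 h2
    refine hu.1 ?_
    rw [hΦ0]
    exact Prod.ext h1 h2

/-- The parameter value at which the trace along the equilibria vanishes. -/
theorem Admissible.exists_trace_zero (h : Z.Admissible φ) {E : ℝ × ℝ → ℝ × ℝ}
    (hE : ContDiffAt ℝ 2 E (0, 0)) (hE0 : E (0, 0) = (0, Z.vStar φ))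
    (hEF : ∀ᶠ z in 𝓝 (0, 0), slowFast φ Z.A2 Z.B2 (z, E z) = 0) :
    ∃ η : ℝ → ℝ, ContDiffAt ℝ 2 η 0 ∧ η 0 = 0 ∧ deriv η 0 = Z.deltaH φ ∧
      (∀ᶠ ε in 𝓝 0, Z.traceFun φ ((ε, η ε), E (ε, η ε)) = 0) ∧
      (∀ᶠ z in 𝓝 (0, 0), Z.traceFun φ (z, E z) = 0 → η z.1 = z.2) ∧
      ∀ᶠ z : ℝ × ℝ in 𝓝 (0, 0), ∃ τ : ℝ, τ ≠ 0 ∧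
        HasDerivAt (fun α => Z.traceFun φ ((z.1, α), E (z.1, α))) τ z.2 := by
  set T : ℝ × ℝ → ℝ := fun z => Z.traceFun φ (z, E z) with hT
  have cdf : ContDiffAt ℝ 2 T (0, 0) := by
    have h0 : ContDiffAt ℝ 2 (Z.traceFun φ) ((0, 0), E (0, 0)) := by
      rw [hE0]; exact h.traceFun_smooth
    exact ContDiffAt.comp (g := Z.traceFun φ) (f := fun z => (z, E z)) (0, 0) h0
      (contDiffAt_id.prodMk hE)
  have hT0 : T (0, 0) = 0 := by
    simp [hT, hE0, traceFun, pull, h.B2_zero]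
  -- The parameter curve (0, s) will give ∂T/∂α = traceN, and (s, η(s)) will give traceM + η'(0)
  -- traceN = 0.
  have curve : ∀ {ε α : ℝ → ℝ} {ε' α' : ℝ}, HasDerivAt ε ε' 0 → HasDerivAt α α' 0 → ε 0 = 0 →
      α 0 = 0 → HasDerivAt (fun s => T (ε s, α s)) (ε' * Z.traceM φ + α' * Z.traceN φ) 0 := by
    intro ε α ε' α' hε hα ε0 α0
    have hEd : HasFDerivAt E (fderiv ℝ E (0, 0)) (ε 0, α 0) := by
      rw [ε0, α0]; exact (hE.differentiableAt (by simp)).hasFDerivAt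
    have c := HasFDerivAt.comp_hasDerivAt (f := fun s => (ε s, α s)) (0 : ℝ) hEd (hε.prodMk hα)
    have c1 := (ContinuousLinearMap.fst ℝ ℝ ℝ).hasFDerivAt.comp_hasDerivAt (0 : ℝ) c
    have c2 := (ContinuousLinearMap.snd ℝ ℝ ℝ).hasFDerivAt.comp_hasDerivAt (0 : ℝ) c
    have ht : Tendsto (fun s => (ε s, α s)) (𝓝 0) (𝓝 (0, 0)) := by
      have := hε.continuousAt.tendsto.prodMk_nhds hα.continuousAt.tendsto
      rwa [ε0, α0] at this
    exact h.hasDerivAt_traceFun hε hα c1 c2 ε0 α0 (by simp [ε0, α0, hE0]) (by simp [ε0, α0, hE0])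
      (ht.eventually hEF)
  have hdT : HasFDerivAt T (fderiv ℝ T (0, 0)) (0, 0) :=
    (cdf.differentiableAt (by simp)).hasFDerivAt
  have hN : fderiv ℝ T (0, 0) (0, 1) = Z.traceN φ := by
    have c0 : HasDerivAt (fun _ : ℝ => (0 : ℝ)) 0 0 := hasDerivAt_const _ _
    have c1 := HasFDerivAt.comp_hasDerivAt (f := fun s : ℝ => ((0 : ℝ), s)) (0 : ℝ) hdT
      (c0.prodMk (hasDerivAt_id 0))
    simpa using! c1.unique (curve c0 (hasDerivAt_id 0) rfl rfl)
  have hinv : (fderiv ℝ T (0, 0) ∘L .inr ℝ ℝ ℝ).IsInvertible := by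
    refine isInvertible_of_ker fun z hz => ?_
    have hz' : fderiv ℝ T (0, 0) (0, z) = 0 := hz
    rw [show ((0 : ℝ), z) = z • ((0 : ℝ), (1 : ℝ)) by simp, map_smul, hN, smul_eq_mul] at hz'
    exact (mul_eq_zero.1 hz').resolve_right h.traceN_ne
  have hη := cdf.contDiffAt_implicitFunction (by simp) hinv
  have hη0 := cdf.implicitFunction_apply_self (by simp) hinv
  have hηT := cdf.eventually_apply_implicitFunction (by simp) hinv
  have hηu := cdf.eventually_apply_eq_iff_implicitFunction (by simp) hinv
  set η := cdf.implicitFunction (by simp) hinv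
  simp only [hT0] at hη0 hηT hηu
  refine ⟨η, hη, hη0, ?_, hηT, hηu.mono fun z hz => hz.1, ?_⟩
  · have c := curve (hasDerivAt_id 0) (hη.differentiableAt (by simp)).hasDerivAt rfl hη0
    have e := c.unique ((hasDerivAt_const (0 : ℝ) (0 : ℝ)).congr_of_eventuallyEq hηT)
    unfold deltaH
    rw [eq_div_iff h.traceN_ne]
    linear_combination e
  -- ∂T/∂α is nonzero at the base point, hence nearby; this is the transversal crossing of the trace
  -- at the Hopf points.
  · have hc : ContinuousAt (fun z => fderiv ℝ T z (0, 1)) (0, 0) :=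
      ((cdf.fderiv_right (m := 1) (by norm_num)).clm_apply contDiffAt_const).continuousAt
    have hne : fderiv ℝ T (0, 0) (0, 1) ≠ 0 := by rw [hN]; exact h.traceN_ne
    filter_upwards [hc.eventually_ne hne, cdf.eventually (by simp)] with z h1 h2
    refine ⟨_, h1, ?_⟩
    exact HasFDerivAt.comp_hasDerivAt (f := fun s : ℝ => (z.1, s)) z.2
      (h2.differentiableAt (by simp)).hasFDerivAt ((hasDerivAt_const z.2 z.1).prodMk
        (hasDerivAt_id z.2))

end Unfolding

/-! ### Hopf curves: localization, existence, uniqueness and the limit of ε ℓ₁. -/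

theorem IsTransition.monotone {φ : ℝ → ℝ} (h : IsTransition φ) : Monotone φ := by
  have hm : MonotoneOn φ (Icc (-1) 1) := by
    refine monotoneOn_of_deriv_nonneg (convex_Icc _ _) h.continuous.continuousOn ?_ ?_
    · rw [interior_Icc]
      exact h.smooth.differentiableOn (by norm_num)
    · rw [interior_Icc]
      exact fun x hx => (h.deriv_pos x hx).le
  -- φ is constant on either side of [-1, 1], so clamping the argument reduces monotonicity to that
  -- interval.
  have hc : ∀ v, φ v = φ (max (-1) (min v 1)) := by
    intro v
    rcases le_total v (-1) with h1 | h1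
    · rw [min_eq_left (by linarith), max_eq_left h1, h.eq_neg_one v h1, h.eq_neg_one (-1) le_rfl]
    · rcases le_total v 1 with h2 | h2
      · rw [min_eq_left h2, max_eq_right h1]
      · rw [min_eq_right h2, max_eq_right (by norm_num), h.eq_one v h2, h.eq_one 1 le_rfl]
  intro a b hab
  rw [hc a, hc b]
  refine hm ⟨le_max_left _ _, max_le (by norm_num) (min_le_right _ _)⟩
    ⟨le_max_left _ _, max_le (by norm_num) (min_le_right _ _)⟩ ?_
  exact max_le_max le_rfl (min_le_min hab le_rfl)

namespace Unfolding

variable {Z : Unfolding} {φ : ℝ → ℝ}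

/-- Equilibria that converge to the fold-fold point do so with `y / ε` converging to `v*`. -/
theorem Admissible.tendsto_fast (h : Z.Admissible φ) {α : ℝ → ℝ} {p : ℝ → ℝ × ℝ}
    (hα : Tendsto α (𝓝[>] 0) (𝓝 0)) (hp : Tendsto p (𝓝[>] 0) (𝓝 0))
    (heq : ∀ᶠ ε in 𝓝[>] 0, Z.reg1 φ ε (α ε) (p ε).1 (p ε).2 = 0) :
    Tendsto (fun ε => (p ε).2 / ε) (𝓝[>] 0) (𝓝 (Z.vStar φ)) := by
  have hmono := h.transition.monotone
  have hB := h.B1_smooth.tendsto hα hp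
  -- The equation F¹ = 0 gives φ(y/ε) = -A1/B1 at the equilibrium, and this tends to φ(v*).
  have hlim : Tendsto (fun ε => φ ((p ε).2 / ε)) (𝓝[>] 0) (𝓝 (φ (Z.vStar φ))) := by
    have hq := ((h.A1_smooth.tendsto hα hp).neg.div hB h.B1_pos.ne')
    have e : -Z.A1 0 0 0 / Z.B1 0 0 0 = φ (Z.vStar φ) := by
      rw [div_eq_iff h.B1_pos.ne']
      linear_combination -h.vStar_spec.2
    rw [e] at hq
    refine hq.congr' ?_
    filter_upwards [heq, hB.eventually (lt_mem_nhds h.B1_pos)] with ε h1 h2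
    rw [reg1_eq] at h1
    simp only [blend, scale] at h1
    simp only [Pi.div_apply]
    rw [div_eq_iff h2.ne']
    linear_combination -2 * h1
  have hd : HasDerivAt φ (deriv φ (Z.vStar φ)) (Z.vStar φ) :=
    (h.phi_smooth.differentiableAt (by simp)).hasDerivAt
  have hstrict : StrictMonoOn φ (Ioo (-1) 1) :=
    strictMonoOn_of_deriv_pos (convex_Ioo _ _) h.transition.continuous.continuousOn
      (by rw [interior_Ioo]; exact h.transition.deriv_pos)
  obtain ⟨w1, w2⟩ := h.vStar_spec.1
  rw [tendsto_order]
  constructor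
  · intro a ha
    -- The midpoint of -1 and v* keeps the test point in (-1, 1), where φ is strictly increasing.
    -- Monotonicity on all of ℝ then transfers the inequality to y/ε, which need not be known to lie
    -- in (-1, 1).
    have ha' : max a ((-1 + Z.vStar φ) / 2) < Z.vStar φ := max_lt ha (by linarith)
    have hlt := hstrict ⟨lt_of_lt_of_le (by linarith) (le_max_right a _), by linarith⟩
      h.vStar_spec.1 ha'
    filter_upwards [hlim.eventually (lt_mem_nhds hlt)] with ε hε
    exact (le_max_left _ _).trans_lt (hmono.reflect_lt hε)
  · intro b hb
    have hb' : Z.vStar φ < min b ((1 + Z.vStar φ) / 2) := lt_min hb (by linarith)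
    have hlt := hstrict h.vStar_spec.1 ⟨by linarith, lt_of_le_of_lt (min_le_right b _)
      (by linarith)⟩ hb'
    filter_upwards [hlim.eventually (gt_mem_nhds hlt)] with ε hε
    exact (hmono.reflect_lt hε).trans_le (min_le_left _ _)

theorem isHopf_equilibrium {P Q : ℝ → ℝ → ℝ → ℝ} {α₀ : ℝ} {p : ℝ × ℝ} (h : IsHopf P Q α₀ p) :
    P α₀ p.1 p.2 = 0 ∧ Q α₀ p.1 p.2 = 0 := by
  obtain ⟨q, _, hq, he, _⟩ := h.crossing
  have := he.self_of_nhds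
  rwa [hq] at this

/-- Near the base point, the Hopf points with ε > 0 are the common zeros of F¹, F² and the rescaled
trace, and these lie over the graph of η. By `tendsto_fast` every Hopf curve enters the
neighbourhood in which both implicit functions are unique. -/
theorem Admissible.exists_hopfCurve (h : Z.Admissible φ) :
    ∃ η : ℝ → ℝ, (fun ε => η ε - Z.deltaH φ * ε) =O[𝓝 0] (fun ε => ε ^ 2) ∧
      (∃ p, Z.IsHopfCurve φ η p) ∧
      ∀ α p, Z.IsHopfCurve φ α p → α =ᶠ[𝓝[>] 0] η := by
  obtain ⟨E, hE, hE0, hEF, hEu⟩ := h.exists_equilibria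
  obtain ⟨η, hη, hη0, hη', hηT, hηu, hτ⟩ := h.exists_trace_zero hE hE0 (hEF.mono fun z hz => hz.2)
  have tE : Tendsto (fun z => (z, E z)) (𝓝 (0, 0)) (𝓝 ((0, 0), (0, Z.vStar φ))) := by
    rw [← hE0]
    exact tendsto_id.prodMk_nhds hE.continuousAt.tendsto
  have hJ : ∀ᶠ u : (ℝ × ℝ) × (ℝ × ℝ) in 𝓝 ((0, 0), (0, Z.vStar φ)), u.1.1 ≠ 0 →
      traceJ (Z.reg1 φ u.1.1 u.1.2) (Z.reg2 φ u.1.1 u.1.2) (u.2.1, u.1.1 * u.2.2)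
        = Z.traceFun φ u / (2 * u.1.1) ∧
      0 < u.1.1 * detJ (Z.reg1 φ u.1.1 u.1.2) (Z.reg2 φ u.1.1 u.1.2) (u.2.1, u.1.1 * u.2.2) := by
    filter_upwards [h.jacobian, h.detFun_pos] with u h1 h2 h3
    refine ⟨(h1 h3).1, ?_⟩
    rw [(h1 h3).2, show u.1.1 * (Z.detFun φ u / (4 * u.1.1)) = Z.detFun φ u / 4 by field_simp]
    positivity
  refine ⟨η, ?_, ⟨fun ε => ((E (ε, η ε)).1, ε * (E (ε, η ε)).2), ?_⟩, ?_⟩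
  · rw [← hη']
    exact isBigO_sub_linear hη hη0
  · have tη : Tendsto η (𝓝[>] 0) (𝓝 0) := by
      have := hη.continuousAt.tendsto
      rw [hη0] at this
      exact this.mono_left nhdsWithin_le_nhds
    have tid : Tendsto (fun ε : ℝ => ε) (𝓝[>] 0) (𝓝 0) :=
      tendsto_nhdsWithin_of_tendsto_nhds tendsto_id
    have tz : Tendsto (fun ε => (ε, η ε)) (𝓝[>] 0) (𝓝 (0, 0)) := tid.prodMk_nhds tη
    have tEz : Tendsto (fun ε => E (ε, η ε)) (𝓝[>] 0) (𝓝 (0, Z.vStar φ)) := by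
      rw [← hE0]
      exact hE.continuousAt.tendsto.comp tz
    refine ⟨tη, ?_, ?_⟩
    · have h1 := (continuous_fst.tendsto _).comp tEz
      have h2 := tid.mul ((continuous_snd.tendsto _).comp tEz)
      simpa using! h1.prodMk_nhds h2
    · filter_upwards [self_mem_nhdsWithin, tz.eventually (tE.eventually hJ),
        hηT.filter_mono nhdsWithin_le_nhds, tz.eventually (hE.eventually (by simp)),
        tz.eventually (eventually_eventually_nhds.2 (hEF.and (tE.eventually hJ))),
        tz.eventually hτ] with ε hε j t0 e1 e2 ⟨τ, hτ0, hτd⟩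
      have hε : 0 < ε := hε
      have tα : Tendsto (fun α => (ε, α)) (𝓝 (η ε)) (𝓝 (ε, η ε)) :=
        tendsto_const_nhds.prodMk_nhds tendsto_id
      -- `traceFun` is 2ε times the trace, so the trace crosses zero with speed τ / (2ε).
      refine ⟨?_, ?_, fun α => ((E (ε, α)).1, ε * (E (ε, α)).2), ?_, rfl, ?_, τ / (2 * ε), ?_, ?_⟩
      · rw [(j hε.ne').1, t0, zero_div]
      · exact (mul_pos_iff_of_pos_left hε).1 (j hε.ne').2
      · have c : ContDiffAt ℝ 1 (fun α => E (ε, α)) (η ε) :=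
          ContDiffAt.comp (g := E) (f := fun α => (ε, α)) (η ε) (e1.of_le (by norm_num))
            (by fun_prop)
        exact (contDiffAt_fst.comp (η ε) c).prodMk
          (contDiffAt_const.mul (contDiffAt_snd.comp (η ε) c))
      · filter_upwards [tα.eventually e2] with α hα
        have := reg_slowFast (Z := Z) (φ := φ) hε.ne' α (E (ε, α)).1 (E (ε, α)).2
        simp only [Prod.mk.eta, hα.1.1, hα.1.2, zero_div] at this
        exact this
      · exact div_ne_zero hτ0 (by positivity)
      · refine (hτd.div_const (2 * ε)).congr_of_eventuallyEq ?_
        filter_upwards [tα.eventually e2] with α hα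
        exact (hα.2 hε.ne').1
  · intro α p hc
    have heq := hc.isHopf.mono fun ε hε => isHopf_equilibrium hε
    have tv := h.tendsto_fast hc.tendsto_param hc.tendsto_point (heq.mono fun ε hε => hε.1)
    have tid : Tendsto (fun ε : ℝ => ε) (𝓝[>] 0) (𝓝 0) :=
      tendsto_nhdsWithin_of_tendsto_nhds tendsto_id
    have tz : Tendsto (fun ε => (ε, α ε)) (𝓝[>] 0) (𝓝 (0, 0)) :=
      tid.prodMk_nhds hc.tendsto_param
    have t1 : Tendsto (fun ε => (p ε).1) (𝓝[>] 0) (𝓝 0) :=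
      (continuous_fst.tendsto _).comp hc.tendsto_point
    have tu : Tendsto (fun ε => ((ε, α ε), ((p ε).1, (p ε).2 / ε))) (𝓝[>] 0)
        (𝓝 ((0, 0), (0, Z.vStar φ))) := tz.prodMk_nhds (t1.prodMk_nhds tv)
    filter_upwards [self_mem_nhdsWithin, heq, hc.isHopf, tu.eventually hEu, tz.eventually hηu,
      tu.eventually hJ] with ε hε e1 e2 u1 u2 u3
    have hε : 0 < ε := hε
    have hy : ε * ((p ε).2 / ε) = (p ε).2 := by field_simp
    have hs := reg_slowFast (Z := Z) (φ := φ) hε.ne' (α ε) (p ε).1 ((p ε).2 / ε)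
    rw [hy, e1.1, e1.2] at hs
    have hEp := u1 (by linarith [hs.1]) (by linarith [hs.2])
    have ht := (u3 hε.ne').1
    simp only [hy] at ht
    rw [show ((p ε).1, (p ε).2) = p ε from rfl, e2.trace_zero, eq_comm, div_eq_zero_iff] at ht
    refine (u2 ?_).symm
    rw [hEp]
    exact ht.resolve_right (by positivity)

/-- The sign of the first Lyapunov coefficient along a Hopf curve. -/
theorem Admissible.tendsto_lyapunovCoeff (h : Z.Admissible φ) (m : Z.MelnikovData φ)
    {α : ℝ → ℝ} {p : ℝ → ℝ × ℝ} (hc : Z.IsHopfCurve φ α p) : ∃ k : ℝ, 0 < k ∧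
      Tendsto (fun ε => ε * lyapunovCoeff (Z.reg1 φ ε (α ε)) (Z.reg2 φ ε (α ε)) (p ε)) (𝓝[>] 0)
        (𝓝 (k * Z.dvMn φ 3 (Z.deltaH φ))) := by
  have heq := hc.isHopf.mono fun ε hε => isHopf_equilibrium hε
  have tv := h.tendsto_fast hc.tendsto_param hc.tendsto_point (heq.mono fun ε hε => hε.1)
  obtain ⟨β, hβ, hL⟩ := h.lyapunovLimit_eq
  obtain ⟨k, hk, h3⟩ := m.third
  have hn := h.f2x_vStar_neg
  have e1 : Z.f1x φ (Z.vStar φ) / 2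
      = 1 / 2 * dx (Z.A1 0) 0 0 + 1 / 2 * (φ (Z.vStar φ) * dx (Z.B1 0) 0 0) := by
    rw [h.f1x_eq]; ring
  have e2 : Z.f2x φ (Z.vStar φ) / 2
      = 1 / 2 * dx (Z.A2 0) 0 0 + 1 / 2 * (φ (Z.vStar φ) * dx (Z.B2 0) 0 0) := by
    rw [h.f2x_eq]; ring
  have e3 : Z.f2xx φ (Z.vStar φ) / 2
      = 1 / 2 * dx (dx (Z.A2 0)) 0 0 + 1 / 2 * (φ (Z.vStar φ) * dx (dx (Z.B2 0)) 0 0) := by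
    rw [h.f2xx_eq]; ring
  have key := tendsto_mul_lyapunovCoeff (h.A1_smooth.of_le (by norm_num))
    (h.B1_smooth.of_le (by norm_num)) (h.A2_smooth.of_le (by norm_num))
    (h.B2_smooth.of_le (by norm_num)) (h.phi_smooth.of_le (by norm_num)) hc.tendsto_param
    hc.tendsto_point tv (hc.isHopf.mono fun ε hε => by
      have := hε.trace_zero
      rwa [reg1_eq, reg2_eq] at this) h.deriv_phi_pos h.B1_pos e1 e2 (by linarith) (β := β)
    (by rw [hβ]; ring)
  rw [← e3, hL] at key
  -- The third derivative is k L with k < 0 and the limit of ε ℓ₁ is (F²_x/32) L with F²_x < 0, so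
  -- their ratio is positive; L itself may vanish.
  refine ⟨Z.f2x φ (Z.vStar φ) / 32 / k, div_pos_of_neg_of_neg (by linarith) hk, ?_⟩
  simp only [reg1_eq, reg2_eq]
  rw [h3]
  convert key using 2
  have := hk.ne
  field_simp

end Unfolding

end FoldFold
end

theorem mainTheorem11 (Z : FoldFold.Unfolding) (φ : ℝ → ℝ)
    (hφ : FoldFold.IsTransition φ) (hZ : Z.Smooth) (hfold : Z.IsFoldFold)
    (hX1 : 0 < Z.X1 0 0 0) (hXY : Z.X1 0 0 0 * Z.Y1 0 0 0 < 0)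
    (hdet : Z.detx < 0) (hversal : Z.Versal) :
    -- the Melnikov function is regular up to `v*`, so that all derivatives below make sense
    (∀ δ : ℝ, ContDiffWithinAt ℝ 3 (fun v => Z.melnikov φ v δ) (Ici (Z.vStar φ)) (Z.vStar φ)) ∧
    -- `M(v*, δ) = 0` for all `δ`
    (∀ δ : ℝ, Z.melnikov φ (Z.vStar φ) δ = 0) ∧
    -- `∂M/∂v(v*, δ_H) = 0`
    Z.dvM φ (Z.deltaH φ) = 0 ∧
    -- the mixed derivative, in both orders, and its sign
    HasDerivAt (Z.dvM φ) (Z.mixedValue φ) (Z.deltaH φ) ∧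
    (∀ᶠ v in 𝓝[≥] (Z.vStar φ), DifferentiableAt ℝ (Z.melnikov φ v) (Z.deltaH φ)) ∧
    HasDerivWithinAt (fun v => deriv (Z.melnikov φ v) (Z.deltaH φ)) (Z.mixedValue φ)
      (Ici (Z.vStar φ)) (Z.vStar φ) ∧
    (Z.InvisibleInvisible → 0 < Z.mixedValue φ) ∧
    (Z.VisibleInvisible → Z.mixedValue φ < 0) ∧
    -- the second derivative at `(v*, δ_H)` always vanishes
    Z.dvMn φ 2 (Z.deltaH φ) = 0 ∧
    -- there is a Hopf curve, every Hopf curve is `α = δ_H ε + O(ε²)`, and the sign of the first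
    -- nonzero one of the derivatives of order two and three decides the character
    (∃ α p, Z.IsHopfCurve φ α p) ∧
    ∀ α p, Z.IsHopfCurve φ α p →
      ((fun ε => α ε - Z.deltaH φ * ε) =O[𝓝[>] 0] fun ε => ε ^ 2) ∧
      ((0 < Z.dvMn φ 2 (Z.deltaH φ) ∨
          Z.dvMn φ 2 (Z.deltaH φ) = 0 ∧ 0 < Z.dvMn φ 3 (Z.deltaH φ)) →
        ∀ᶠ ε in 𝓝[>] 0,
          FoldFold.IsSubcriticalHopf (Z.reg1 φ ε) (Z.reg2 φ ε) (α ε) (p ε)) ∧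
      ((Z.dvMn φ 2 (Z.deltaH φ) < 0 ∨
          Z.dvMn φ 2 (Z.deltaH φ) = 0 ∧ Z.dvMn φ 3 (Z.deltaH φ) < 0) →
        ∀ᶠ ε in 𝓝[>] 0,
          FoldFold.IsSupercriticalHopf (Z.reg1 φ ε) (Z.reg2 φ ε) (α ε) (p ε)) := by
  have h : Z.Admissible φ := ⟨hφ, hZ, hfold, hX1, hXY, hdet, hversal⟩
  have m := h.melnikovData
  have hsign := h.mixed_sign (by rw [h.iteratedDeriv_two_V]; exact h.deriv_Vp_pos)
  obtain ⟨η, hO, ⟨p₀, hp₀⟩, hu⟩ := h.exists_hopfCurve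
  refine ⟨m.regular, m.zero, m.first, m.mixed, m.differentiable, m.mixed', hsign.1, hsign.2,
    m.second, ⟨η, p₀, hp₀⟩, fun α p hc => ⟨?_, fun hs => ?_, fun hs => ?_⟩⟩
  · refine (hO.mono nhdsWithin_le_nhds).congr' ?_ EventuallyEq.rfl
    filter_upwards [hu α p hc] with ε hε
    rw [hε]
  -- The second derivative is always zero, so only the alternative with the third derivative can
  -- occur. Then ε ℓ₁ has a nonzero limit, whose sign ℓ₁ takes for small ε > 0.
  · have h3 : 0 < Z.dvMn φ 3 (Z.deltaH φ) := by
      rcases hs with hs | hs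
      · exact absurd m.second hs.ne'
      · exact hs.2
    obtain ⟨k, hk, ht⟩ := h.tendsto_lyapunovCoeff m hc
    filter_upwards [hc.isHopf, ht.eventually (lt_mem_nhds (mul_pos hk h3)), self_mem_nhdsWithin]
      with ε h1 h2 hε
    exact ⟨h1, (mul_pos_iff_of_pos_left (show 0 < ε from hε)).1 h2⟩
  · have h3 : Z.dvMn φ 3 (Z.deltaH φ) < 0 := by
      rcases hs with hs | hs
      · exact absurd m.second hs.ne
      · exact hs.2
    obtain ⟨k, hk, ht⟩ := h.tendsto_lyapunovCoeff m hc
    filter_upwards [hc.isHopf, ht.eventually (gt_mem_nhds (mul_neg_of_pos_of_neg hk h3)),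
      self_mem_nhdsWithin] with ε h1 h2 hε
    exact ⟨h1, neg_of_mul_neg_right h2 (show 0 < ε from hε).le⟩
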